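/- Conventions. All graphs are finite and simple, and $n=|V(G)|$. For $t\ge 1$, $P_t$ is the path with $t$ vertices, and $P_6+rP_3$ is the disjoint union of one $P_6$ and $r$ copies of $P_3$. A graph is $H$-free if no induced subgraph of it is isomorphic to $H$; $G|X$ denotes the subgraph of $G$ induced by $X$. A vertex $a\notin X$ is mixed on $X$ if it has both a neighbour and a non-neighbour in $X$. Let $r\ge 1$. An $r$-seeded precoloring of a pair $(G,L')$, where $L'$ assigns to every vertex a subset of $\{1,2,3\}$, is a triple $P=(G,L,S)$ with $S\subseteq V(G)$ and $L(v)\subseteq\{1,2,3\}$ for all $v\in V(G)$, such that $|L(v)|=1$ and $L(v)\subseteq L'(v)$ for every $v\in S$, such that $L(u)\ne L(v)$ for adjacent $u,v\in S$, and such that $G|S$ contains $P_6+(r-1)P_3$ as an induced subgraph. It is an $r$-seeded precoloring of $G$ if this holds for some $L'$. The set $S=S(P)$ is its seed. $P$ is updated if there are no adjacent $u,v$ with $|L(u)|=1$ and $L(u)\subseteq L(v)$. A precoloring extension of $P$ is a map $c:V(G)\to\{1,2,3\}$ with $c(v)\in L(v)$ for all $v$ and $c(u)\neq c(v)$ for adjacent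 $u,v$. The boundary $B(P)$ is the set of vertices $v$ with $|L(v)|=2$ that have a neighbour $s\in S$ with $L(s)=\{1,2,3\}\setminus L(v)$. The wilderness is $W(P)=V(G)\setminus(\{v:|L(v)|=1\}\cup B(P))$. $P$ is nice if no vertex of $B(P)$ is mixed on the set of ends of an edge of $G|W(P)$; $P$ is easy if $G|(B(P)\cup W(P))$ is $P_6$-free. A collection $\mathcal L$ of $r$-seeded precolorings is equivalent to $P$ if $P$ has a precoloring extension if and only if some member of $\mathcal L$ has one, and, given $P$, a member $P'$ of $\mathcal L$ and a precoloring extension of $P'$, a precoloring extension of $P$ can be constructed in time polynomial in $n$. Theorem. There exist a function $g_1:\mathbb N\to\mathbb N$ and an algorithm with the following properties. Let $r\ge 1$, let $G$ be a $(P_6+rP_3)$-free graph with no clique of size four, and let $P=(G,L,S)$ be an $r$-seeded precoloring of $G$. Then there is a finite collection $\mathcal L$ of updated $r$-seeded precolorings of $(G,L)$ such that 1. $\mathcal L$ is equivalent to $P$ (the extensions being recovered by a single algorithm and within a polynomial time bound that depend neither on $P$ nor on $r$); 2. every $P'\in\mathcal L$ is nice or easy; 3. $|S(P')|\le g_1(|S|)$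 for every $P'\in\mathcal L$; 4. $|\mathcal L|\le n^{g_1(|S|)}$. Moreover, given $P$, the algorithm constructs $\mathcal L$ in time at most $C\,n^{g_1(|S|)}$, where $C$ is an absolute constant. -/

import Mathlib

/-! ## Computations with a step count

The programs of a small deterministic while-language whose values are finite binary trees. Each
primitive operation (constant, copy, left or right subtree, allocation of one cell, test whether a
value is the leaf) costs one step, as on a pointer machine or in Lisp; the language is
polynomially equivalent to Turing machines. -/

/-- The values: finite binary trees. -/
inductive Data : Type
  | nil : Data
  | cons (a b : Data) : Data

/-- The programs; each one takes one value and, if it halts, returns one value. -/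
inductive Prog : Type
  /-- return the leaf -/
  | nil : Prog
  /-- return the input -/
  | ident : Prog
  /-- return the left subtree of the input -/
  | fst : Prog
  /-- return the right subtree of the input -/
  | snd : Prog
  /-- run both programs on the input and return the tree with these two subtrees -/
  | pair (p q : Prog) : Prog
  /-- first `q`, then `p` on its result -/
  | comp (p q : Prog) : Prog
  /-- run the test `c` on the input, then `p` on the input if the test did not return the leaf,
  and `q` on the input if it did -/
  | cond (c p q : Prog) : Prog
  /-- while the test `c` on the current value does not return the leaf, replace the current value
  by the result of `p` on it -/
  | loop (c p : Prog) : Prog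

/-- `p.Runs x y t`: on input `x` the program `p` halts with output `y` after exactly `t` steps. -/
inductive Prog.Runs : Prog → Data → Data → ℕ → Prop
  | nil (x : Data) : Runs Prog.nil x Data.nil 1
  | ident (x : Data) : Runs Prog.ident x x 1
  | fst_nil : Runs Prog.fst Data.nil Data.nil 1
  | fst_cons (a b : Data) : Runs Prog.fst (Data.cons a b) a 1
  | snd_nil : Runs Prog.snd Data.nil Data.nil 1
  | snd_cons (a b : Data) : Runs Prog.snd (Data.cons a b) b 1
  | pair {p q : Prog} {x a b : Data} {s t : ℕ} :
      Runs p x a s → Runs q x b t → Runs (Prog.pair p q) x (Data.cons a b) (s + t + 1)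
  | comp {p q : Prog} {x y z : Data} {s t : ℕ} :
      Runs q x y s → Runs p y z t → Runs (Prog.comp p q) x z (s + t + 1)
  | cond_true {c p q : Prog} {x a b y : Data} {s t : ℕ} :
      Runs c x (Data.cons a b) s → Runs p x y t → Runs (Prog.cond c p q) x y (s + t + 1)
  | cond_false {c p q : Prog} {x y : Data} {s t : ℕ} :
      Runs c x Data.nil s → Runs q x y t → Runs (Prog.cond c p q) x y (s + t + 1)
  | loop_done {c p : Prog} {x : Data} {s : ℕ} :
      Runs c x Data.nil s → Runs (Prog.loop c p) x x (s + 1)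
  | loop_step {c p : Prog} {x a b y z : Data} {s t u : ℕ} :
      Runs c x (Data.cons a b) s → Runs p x y t → Runs (Prog.loop c p) y z u →
        Runs (Prog.loop c p) x z (s + t + u + 1)

/-- On input `x` the program halts with output `y` after at most `T` steps. -/
def Prog.OutputsWithin (p : Prog) (x y : Data) (T : ℕ) : Prop :=
  ∃ t, p.Runs x y t ∧ t ≤ T

/-! ## Graphs -/

/-- The graph `P₆ + rP₃`: the disjoint union of a six-vertex path and of `r` three-vertex paths. -/
def pathSixAddPathThree (r : ℕ) : SimpleGraph (Fin 6 ⊕ (Fin r × Fin 3)) :=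
  SimpleGraph.pathGraph 6 ⊕g ((⊥ : SimpleGraph (Fin r)) □ SimpleGraph.pathGraph 3)

/-- No induced subgraph of `G` is isomorphic to `H`. -/
def IsInducedFree {W V : Type} (H : SimpleGraph W) (G : SimpleGraph V) : Prop :=
  ¬ H.IsIndContained G

/-- `a` is mixed on `X`: it lies outside `X`, and has both a neighbour and a non-neighbour in `X`. -/
def IsMixedOn {V : Type} (G : SimpleGraph V) (a : V) (X : Set V) : Prop :=
  a ∉ X ∧ (∃ x ∈ X, G.Adj a x) ∧ ∃ x ∈ X, ¬ G.Adj a x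

/-! ## Seeded precolorings -/

/-- A triple `(G, L, S)` of a graph, a list assignment with lists contained in a fixed set of three
colors, and a set of vertices. -/
structure SeededTriple (V : Type) where
  graph : SimpleGraph V
  list : V → Finset (Fin 3)
  seed : Finset V

namespace SeededTriple

variable {V : Type}

/-- `(G, L, S)` is an `r`-seeded precoloring of `(G, L')`, where `r ≥ 1`: the lists on `S` have
size one, the coloring of `S` that they define is proper and uses only colors allowed by `L'`, and
`G|S` contains `P₆ + (r-1)P₃` as an induced subgraph. -/
def IsSeededPrecoloring (r : ℕ) (L' : V → Finset (Fin 3)) (P : SeededTriple V) : Prop :=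
  (∀ v ∈ P.seed, (P.list v).card = 1) ∧
  (∀ v ∈ P.seed, P.list v ⊆ L' v) ∧
  (∀ u ∈ P.seed, ∀ v ∈ P.seed, P.graph.Adj u v → P.list u ≠ P.list v) ∧
  (pathSixAddPathThree (r - 1)).IsIndContained (P.graph.induce (P.seed : Set V))

/-- The vertices whose list has size one. -/
def fixed (P : SeededTriple V) : Set V :=
  {v | (P.list v).card = 1}

/-- The lists are updated exhaustively: no vertex `v` has a neighbour `u` whose list is a single
color that belongs to the list of `v`. -/
def IsUpdated (P : SeededTriple V) : Prop :=
  ∀ u v, P.graph.Adj u v → u ∈ P.fixed → ¬ P.list u ⊆ P.list v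

/-- The boundary: the vertices `v` with a list of size two and with a neighbour in the seed whose
list consists of the third color. -/
def boundary (P : SeededTriple V) : Set V :=
  {v | (P.list v).card = 2 ∧ ∃ s ∈ P.seed, P.graph.Adj v s ∧ P.list s = (P.list v)ᶜ}

/-- The wilderness. -/
def wilderness (P : SeededTriple V) : Set V :=
  (P.fixed ∪ P.boundary)ᶜ

/-- No vertex of the boundary is mixed on an edge with both ends in the wilderness. -/
def IsNice (P : SeededTriple V) : Prop :=
  ∀ b ∈ P.boundary, ∀ w₁ ∈ P.wilderness, ∀ w₂ ∈ P.wilderness,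
    P.graph.Adj w₁ w₂ → ¬ IsMixedOn P.graph b {w₁, w₂}

/-- Boundary and wilderness together induce a `P₆`-free graph. -/
def IsEasy (P : SeededTriple V) : Prop :=
  IsInducedFree (SimpleGraph.pathGraph 6) (P.graph.induce (P.boundary ∪ P.wilderness))

/-- `c` is a precoloring extension: a proper coloring of `G` from the lists. As the lists on the
seed are singletons, it extends the coloring of the seed. -/
def IsExtension (P : SeededTriple V) (c : V → Fin 3) : Prop :=
  (∀ v, c v ∈ P.list v) ∧ ∀ u v, P.graph.Adj u v → c u ≠ c v

end SeededTriple

/-! ## Encodings -/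

/-- A list of values as one value. -/
def encList : List Data → Data
  | [] => Data.nil
  | a :: l => Data.cons a (encList l)

/-- A finite sequence of values as one value. -/
def encFun {n : ℕ} (f : Fin n → Data) : Data :=
  encList (List.ofFn f)

open Classical in
/-- A truth value. -/
noncomputable def encProp (p : Prop) : Data :=
  if p then Data.cons Data.nil Data.nil else Data.nil

/-- A triple `(G, L, S)`: the adjacency matrix, for each vertex the three bits of its list, and the
characteristic vector of the seed. -/
noncomputable def encTriple {n : ℕ} (P : SeededTriple (Fin n)) : Data :=
  Data.cons (encFun fun u => encFun fun v => encProp (P.graph.Adj u v))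
    (Data.cons (encFun fun v => encFun fun i : Fin 3 => encProp (i ∈ P.list v))
      (encFun fun v => encProp (v ∈ P.seed)))

/-- A coloring: for each vertex three bits, which mark its color. -/
noncomputable def encColoring {n : ℕ} (c : Fin n → Fin 3) : Data :=
  encFun fun v => encFun fun i : Fin 3 => encProp (i = c v)

/-- A collection of triples. -/
noncomputable def encCollection {n : ℕ} (Q : List (SeededTriple (Fin n))) : Data :=
  encList (Q.map encTriple)

/-- The collection `Q` is equivalent to `P`, where the program `back`, given `P`, a member `P'` of
`Q` and a precoloring extension of `P'`, finds a precoloring extension of `P` in at most `T`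
steps. -/
def IsEquivalentCollection {n : ℕ} (back : Prog) (T : ℕ) (P : SeededTriple (Fin n))
    (Q : List (SeededTriple (Fin n))) : Prop :=
  ((∃ c, P.IsExtension c) ↔ ∃ P' ∈ Q, ∃ c, P'.IsExtension c) ∧
  ∀ P' ∈ Q, ∀ c', P'.IsExtension c' →
    ∃ c, P.IsExtension c ∧
      back.OutputsWithin
        (Data.cons (encTriple P) (Data.cons (encTriple P') (encColoring c'))) (encColoring c) T

section

open Finset

/-! ## Recognizing `P₆ + rP₃` -/

/-! The collection consists of all nice or easy triples with a colored seed that arise from `P` by a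
fixed number of moves. A move puts a vertex into the seed with a color, or gives one color to all
common neighbours of four vertices, and then propagates exhaustively. There are polynomially many
choices for each move, and moves only shrink lists, so an extension of a member is already an
extension of `P`. The real content is the converse, `exists_reach_moveBound`: if `P` has an
extension `c`, then boundedly many moves that agree with `c` reach a nice or easy triple. The
analysis may consult `c` freely, since the algorithm tries all sequences of moves.

Let s be the size of the seed. The seed contains P₆+(r-1)P₃, so r ≤ s, the graph is (P₆+sP₃)-free,
and every bound can be stated in terms of s. For the same reason every induced P₃ has a vertex with
a neighbour in the seed. Hence the wilderness is a disjoint union of cliques, and these have at most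
three vertices because `c` is proper.

The engine is an Erdős–Pósa type statement, `HittingSystem.exists_hitting_set`: a family of small
vertex sets, each to be hit by an adjacent vertex, has a hitting set of bounded size unless it
contains many members without common hitting vertices. Its proof passes from a fractional hitting
statement (`exists_heavy_point`) through multiplicative weights to a measure on the vertices, and
then samples an ε-net (`exists_net`). A failure at either end produces an induced subdivision of a
graph with many more edges than vertices, and such a subdivision contains P₆+qP₃. Classes of
vertices that record the color under `c` supply the nonadjacencies that make the subdivision
induced.

This is applied first to the induced P₆'s on vertices that are not fixed, where a boundary vertex
hits a path if adding it to the seed removes a vertex of the path from the wilderness or a color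
from its list. With a bounded hitting set, every path that survives has lost a wilderness vertex;
after at most seven such rounds no path is left and the triple is easy. Otherwise there are three
paths without common hitting vertices (or one path that nothing hits, taken three times). They join
the seed. Common neighbours of an old seed vertex and of one vertex on each path are then forced to
have a single color, so after coloring them every remaining old boundary vertex is anticomplete to
one of the three paths. A boundary vertex mixed on a wilderness edge gives an induced P₃, and many
independent ones complete such a path to P₆+qP₃. So a bounded set hits all components concerned, and
two rounds leave no mixed vertex: the triple is nice.

The running time is handled by a small calculus of feasible functions, `Feasible`, in which one
program serves all inputs and the exponent of the time bound depends only on s. -/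

theorem pathSixAddPathThree_isIndContained_of_forall {V : Type} {G : SimpleGraph V} {r : ℕ}
    (a : Fin 6 → V) (b : Fin r → Fin 3 → V)
    (ha : ∀ i j, G.Adj (a i) (a j) ↔ (SimpleGraph.pathGraph 6).Adj i j)
    (hb : ∀ t i j, G.Adj (b t i) (b t j) ↔ (SimpleGraph.pathGraph 3).Adj i j)
    (hbb : ∀ t t', t ≠ t' → ∀ i j, ¬ G.Adj (b t i) (b t' j))
    (hab : ∀ i t j, ¬ G.Adj (a i) (b t j))
    (hne : ∀ t, b t 0 ≠ b t 2) : (pathSixAddPathThree r).IsIndContained G := by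
  have hb01 : ∀ t, G.Adj (b t 0) (b t 1) := fun t => by
    rw [hb, SimpleGraph.pathGraph_adj]; simp
  have hb12 : ∀ t, G.Adj (b t 1) (b t 2) := fun t => by
    rw [hb, SimpleGraph.pathGraph_adj]; simp
  -- Each vertex of a piece has a neighbour inside that piece, so a vertex shared by two pieces
  -- would violate anticompleteness. Only the two ends of one P₃ are twins, which is why `hne` has
  -- to be assumed.
  have hnb : ∀ t i, ∃ j, G.Adj (b t i) (b t j) := by
    intro t i
    fin_cases i
    · exact ⟨1, hb01 t⟩
    · exact ⟨2, hb12 t⟩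
    · exact ⟨1, (hb12 t).symm⟩
  have hainj : Function.Injective a := by
    intro i j hij
    -- No two vertices of P₆ have the same neighbourhood, so injectivity on the long path is
    -- automatic.
    have h : ∀ k, (SimpleGraph.pathGraph 6).Adj i k ↔ (SimpleGraph.pathGraph 6).Adj j k := by
      intro k; rw [← ha, ← ha, hij]
    simp only [SimpleGraph.pathGraph_adj] at h
    revert i j
    have : ∀ i j : Fin 6, (∀ k : Fin 6, (i.val + 1 = k.val ∨ k.val + 1 = i.val ↔
      j.val + 1 = k.val ∨ k.val + 1 = j.val)) → i = j := by decide
    intro i j _ h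
    exact this i j h
  have hbinj : ∀ t t' i j, b t i = b t' j → t = t' ∧ i = j := by
    intro t t' i j hij
    have htt : t = t' := by
      by_contra hne'
      obtain ⟨k, hk⟩ := hnb t i
      rw [hij] at hk
      exact hbb t' t (Ne.symm hne') _ _ hk
    subst htt
    refine ⟨rfl, ?_⟩
    have h01 := (hb01 t).ne
    have h12 := (hb12 t).ne
    have h02 := hne t
    clear hb hbb hab ha hnb hb01 hb12 hainj hne
    fin_cases i <;> fin_cases j <;>
      first
        | rfl
        | exact absurd hij h01
        | exact absurd hij h12
        | exact absurd hij h02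
        | exact absurd hij.symm h01
        | exact absurd hij.symm h12
        | exact absurd hij.symm h02
  have hinj : Function.Injective (Sum.elim a fun p : Fin r × Fin 3 => b p.1 p.2) := by
    rintro (i | ⟨t, i⟩) (j | ⟨t', j⟩) h
    · exact congrArg _ (hainj h)
    · obtain ⟨k, hk⟩ := hnb t' j
      have h' : a i = b t' j := h
      rw [← h'] at hk
      exact absurd hk (hab _ _ _)
    · obtain ⟨k, hk⟩ := hnb t i
      have h' : b t i = a j := h
      rw [h'] at hk
      exact absurd hk (hab _ _ _)
    · obtain ⟨h1, h2⟩ := hbinj _ _ _ _ h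
      exact congrArg _ (Prod.ext h1 h2)
  refine ⟨⟨⟨_, hinj⟩, ?_⟩⟩
  rintro (i | ⟨t, i⟩) (j | ⟨t', j⟩)
  · change G.Adj (a i) (a j) ↔ _
    simpa [pathSixAddPathThree] using ha i j
  · change G.Adj (a i) (b t' j) ↔ _
    simpa [pathSixAddPathThree] using hab i t' j
  · change G.Adj (b t i) (a j) ↔ _
    simpa [pathSixAddPathThree, SimpleGraph.adj_comm] using hab j t i
  · change G.Adj (b t i) (b t' j) ↔ _
    by_cases htt : t = t'
    · subst htt
      simpa [pathSixAddPathThree, SimpleGraph.boxProd_adj] using hb t i j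
    · simpa [pathSixAddPathThree, SimpleGraph.boxProd_adj, htt] using hbb t t' htt i j

/-- Three vertices `x - y - z` that induce a path. -/
def IsInducedPathThree {V : Type} (G : SimpleGraph V) (f : Fin 3 → V) : Prop :=
  G.Adj (f 0) (f 1) ∧ G.Adj (f 1) (f 2) ∧ ¬ G.Adj (f 0) (f 2) ∧ f 0 ≠ f 2

theorem IsInducedPathThree.adj_iff {V : Type} {G : SimpleGraph V} {f : Fin 3 → V}
    (h : IsInducedPathThree G f) (i j : Fin 3) :
    G.Adj (f i) (f j) ↔ (SimpleGraph.pathGraph 3).Adj i j := by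
  obtain ⟨h1, h2, h3, -⟩ := h
  have h1' := h1.symm
  have h2' := h2.symm
  have h3' : ¬ G.Adj (f 2) (f 0) := fun h => h3 h.symm
  rw [SimpleGraph.pathGraph_adj]
  fin_cases i <;> fin_cases j <;> simp_all

theorem pathSixAddPathThree_isIndContained {V : Type} {G : SimpleGraph V} {r : ℕ}
    (a : Fin 6 → V) (b : Fin r → Fin 3 → V)
    (ha : ∀ i j, G.Adj (a i) (a j) ↔ (SimpleGraph.pathGraph 6).Adj i j)
    (hb : ∀ t, IsInducedPathThree G (b t))
    (hbb : ∀ t t', t ≠ t' → ∀ i j, ¬ G.Adj (b t i) (b t' j))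
    (hab : ∀ i t j, ¬ G.Adj (a i) (b t j)) : (pathSixAddPathThree r).IsIndContained G :=
  pathSixAddPathThree_isIndContained_of_forall a b ha (fun t => (hb t).adj_iff) hbb hab
    fun t => (hb t).2.2.2

/-- An induced `P₆ + qP₃` and an anticomplete induced `P₃` form an induced `P₆ + (q+1)P₃`. -/
theorem pathSixAddPathThree_succ_isIndContained {V : Type} {G : SimpleGraph V} {q : ℕ} {S : Set V}
    (hS : (pathSixAddPathThree q).IsIndContained (G.induce S)) {f : Fin 3 → V}
    (hf : IsInducedPathThree G f) (hfS : ∀ i, ∀ s ∈ S, ¬ G.Adj s (f i)) :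
    (pathSixAddPathThree (q + 1)).IsIndContained G := by
  obtain ⟨φ⟩ := hS
  have hφ : ∀ x y, G.Adj (φ x) (φ y) ↔ (pathSixAddPathThree q).Adj x y := fun x y =>
    φ.map_rel_iff
  refine pathSixAddPathThree_isIndContained_of_forall (fun i => (φ (Sum.inl i) : V))
    (fun t i => Fin.cases (motive := fun _ => V) (f i) (fun t => (φ (Sum.inr (t, i)) : V)) t)
    ?_ ?_ ?_ ?_ ?_
  · intro i j
    rw [hφ]; simp [pathSixAddPathThree]
  · intro t
    refine Fin.cases ?_ (fun t => ?_) t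
    · exact hf.adj_iff
    · intro i j
      simp only [Fin.cases_succ]
      rw [hφ]; simp [pathSixAddPathThree, SimpleGraph.boxProd_adj]
  · intro t t' htt i j
    revert htt
    refine Fin.cases ?_ (fun t => ?_) t <;> refine Fin.cases ?_ (fun t' => ?_) t' <;> intro htt
    · exact absurd rfl htt
    · simp only [Fin.cases_succ, Fin.cases_zero]
      exact fun h => hfS i _ (φ _).2 h.symm
    · simp only [Fin.cases_succ, Fin.cases_zero]
      exact hfS j _ (φ _).2
    · simp only [Fin.cases_succ]
      have : t ≠ t' := fun h => htt (by rw [h])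
      rw [hφ]; simp [pathSixAddPathThree, SimpleGraph.boxProd_adj, this]
  · intro i t j
    refine Fin.cases ?_ (fun t => ?_) t
    · exact hfS j _ (φ _).2
    · simp only [Fin.cases_succ]
      rw [hφ]; simp [pathSixAddPathThree]
  · intro t
    refine Fin.cases ?_ (fun t => ?_) t
    · exact hf.2.2.2
    · simp only [Fin.cases_succ]
      intro h
      have := φ.injective (Subtype.ext h)
      simp at this

/-! ## Induced subdivisions -/

/-- The pairs with an end in `U` are few. -/
theorem card_filter_touching_le {N : ℕ} (Γ : Finset (Fin N × Fin N)) (U : Finset (Fin N)) :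
    (Γ.filter fun e => e.1 ∈ U ∨ e.2 ∈ U).card ≤ 2 * N * U.card := by
  have h : (Γ.filter fun e => e.1 ∈ U ∨ e.2 ∈ U) ⊆ U ×ˢ univ ∪ univ ×ˢ U := by
    intro e he
    simp only [mem_filter] at he
    simpa using he.2
  refine (card_le_card h).trans ((card_union_le _ _).trans ?_)
  simp only [card_product, card_univ, Fintype.card_fin]
  exact le_of_eq (by ring)

/-- Greedy choice: each chosen pair forbids two further indices, and a forbidden index destroys at
most 2N pairs. -/
theorem exists_disjoint_pairs {N : ℕ} (Γ : Finset (Fin N × Fin N)) (r : ℕ) :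
    ∀ U : Finset (Fin N), 2 * N * (U.card + 2 * r) < Γ.card →
      ∃ f : Fin r → Fin N × Fin N, (∀ t, f t ∈ Γ ∧ (f t).1 ∉ U ∧ (f t).2 ∉ U) ∧
        ∀ t t', t ≠ t' → (f t).1 ≠ (f t').1 ∧ (f t).1 ≠ (f t').2 ∧ (f t).2 ≠ (f t').1 ∧
          (f t).2 ≠ (f t').2 := by
  induction r with
  | zero => intro U _; exact ⟨Fin.elim0, fun t => t.elim0, fun t => t.elim0⟩
  | succ r ih =>
    intro U hU
    have h1 : ∃ e ∈ Γ, e.1 ∉ U ∧ e.2 ∉ U := by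
      by_contra! hcon
      have h2 := card_filter_touching_le Γ U
      rw [filter_true_of_mem (fun e he => by
        by_cases h : e.1 ∈ U
        · exact Or.inl h
        · exact Or.inr (hcon e he h))] at h2
      have : 2 * N * U.card ≤ 2 * N * (U.card + 2 * (r + 1)) :=
        Nat.mul_le_mul_left _ (by omega)
      omega
    obtain ⟨e, he, he1, he2⟩ := h1
    obtain ⟨f, hf, hff⟩ := ih (U ∪ {e.1, e.2}) (by
      have h3 : (U ∪ {e.1, e.2}).card ≤ U.card + 2 :=
        (card_union_le _ _).trans (Nat.add_le_add_left (card_insert_le _ _) _)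
      have : 2 * N * ((U ∪ {e.1, e.2}).card + 2 * r) ≤ 2 * N * (U.card + 2 * (r + 1)) :=
        Nat.mul_le_mul_left _ (by omega)
      exact this.trans_lt hU)
    simp only [mem_union, mem_insert, mem_singleton, not_or] at hf
    refine ⟨Fin.cons e f, ?_, ?_⟩
    · intro t
      refine Fin.cases ?_ (fun t => ?_) t
      · exact ⟨he, he1, he2⟩
      · simp only [Fin.cons_succ]
        exact ⟨(hf t).1, (hf t).2.1.1, (hf t).2.2.1⟩
    · intro t t'
      refine Fin.cases ?_ (fun t => ?_) t <;> refine Fin.cases ?_ (fun t' => ?_) t' <;> intro htt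
      · exact absurd rfl htt
      · simp only [Fin.cons_succ, Fin.cons_zero]
        have h := hf t'
        exact ⟨Ne.symm h.2.1.2.1, Ne.symm h.2.2.2.1, Ne.symm h.2.1.2.2, Ne.symm h.2.2.2.2⟩
      · simp only [Fin.cons_succ, Fin.cons_zero]
        have h := hf t
        exact ⟨h.2.1.2.1, h.2.1.2.2, h.2.2.2.1, h.2.2.2.2⟩
      · simp only [Fin.cons_succ]
        exact hff t t' fun h => htt (by rw [h])

/-- The pairs whose first entry occurs in only one pair are few. -/
theorem card_filter_unique_fst_le {N : ℕ} (Γ : Finset (Fin N × Fin N)) :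
    (Γ.filter fun e => ¬ ∃ f ∈ Γ, f.1 = e.1 ∧ f.2 ≠ e.2).card ≤ N := by
  have h : Set.InjOn Prod.fst
      ((Γ.filter fun e => ¬ ∃ f ∈ Γ, f.1 = e.1 ∧ f.2 ≠ e.2 : Finset _) : Set (Fin N × Fin N)) := by
    intro e he f hf hef
    simp only [coe_filter, Set.mem_ofPred_eq, not_exists, not_and, not_not] at he hf
    exact Prod.ext hef (he.2 f hf.1 hef.symm).symm
  rw [← card_image_of_injOn h]
  exact (card_le_univ _).trans (by simp)

/-- The pairs whose second entry occurs in at most two pairs are few. -/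
theorem card_filter_two_snd_le {N : ℕ} (Γ : Finset (Fin N × Fin N)) :
    (Γ.filter fun e => (Γ.filter fun f => f.2 = e.2).card ≤ 2).card ≤ 2 * N := by
  have h := card_le_mul_card_image_of_maps_to (f := Prod.snd)
    (s := Γ.filter fun e => (Γ.filter fun f => f.2 = e.2).card ≤ 2) (t := univ)
    (fun _ _ => mem_univ _) 2 (by
      intro j _
      by_cases hne : ((Γ.filter fun e => (Γ.filter fun f => f.2 = e.2).card ≤ 2).filter
        fun e => e.2 = j).Nonempty
      · obtain ⟨e, he⟩ := hne
        simp only [mem_filter] at he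
        obtain ⟨⟨-, h2⟩, rfl⟩ := he
        refine (card_le_card ?_).trans h2
        intro f hf
        simp only [mem_filter] at hf ⊢
        exact ⟨hf.1.1, hf.2⟩
      · rw [not_nonempty_iff_eq_empty] at hne
        rw [hne]; simp)
  simpa using h

/-- The middle edge (i₂, j₁) is chosen so that its row contains another pair and its column at least
three. At most N pairs fail the first demand and at most 2N the second. The third pair in the column
lets i₁ avoid both i₂ and j₂. -/
theorem exists_path_of_card {N : ℕ} (Γ : Finset (Fin N × Fin N))
    (hcard : 3 * N < Γ.card) :
    ∃ i₁ j₁ i₂ j₂, (i₁, j₁) ∈ Γ ∧ (i₂, j₁) ∈ Γ ∧ (i₂, j₂) ∈ Γ ∧ i₁ ≠ i₂ ∧ j₁ ≠ j₂ ∧ i₁ ≠ j₂ := by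
  have h1 : ∃ e ∈ Γ, (∃ f ∈ Γ, f.1 = e.1 ∧ f.2 ≠ e.2) ∧
      2 < (Γ.filter fun f => f.2 = e.2).card := by
    by_contra! hcon
    have hsub : Γ ⊆ (Γ.filter fun e => ¬ ∃ f ∈ Γ, f.1 = e.1 ∧ f.2 ≠ e.2) ∪
        Γ.filter fun e => (Γ.filter fun f => f.2 = e.2).card ≤ 2 := by
      intro e he
      simp only [mem_union, mem_filter]
      by_cases h : ∃ f ∈ Γ, f.1 = e.1 ∧ f.2 ≠ e.2
      · exact Or.inr ⟨he, hcon e he h⟩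
      · exact Or.inl ⟨he, h⟩
    have := (card_le_card hsub).trans (card_union_le _ _)
    have h2 := card_filter_unique_fst_le Γ
    have h3 := card_filter_two_snd_le Γ
    omega
  obtain ⟨⟨i₂, j₁⟩, he, ⟨⟨i, j₂⟩, hf, hi, hj⟩, hc⟩ := h1
  simp only at hi hj hc
  subst hi
  obtain ⟨g, hg, hg2⟩ : ∃ g ∈ Γ.filter (fun f => f.2 = j₁), g ∉ ({(i, j₁), (j₂, j₁)} : Finset _) := by
    by_contra! hcon
    have := (card_le_card hcon).trans card_le_two
    omega
  simp only [mem_filter] at hg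
  obtain ⟨i₁, j⟩ := g
  obtain ⟨hg1, rfl⟩ := hg
  simp only [mem_insert, mem_singleton, Prod.mk.injEq, and_true, not_or] at hg2
  exact ⟨i₁, j, i, j₂, hg1, he, hf, hg2.1, Ne.symm hj, hg2.2⟩

/-- A graph with few vertices and many edges whose subdivision is an induced subgraph yields
`P₆ + rP₃`. -/
theorem pathSixAddPathThree_isIndContained_of_subdivision {V : Type} {G : SimpleGraph V}
    {N r : ℕ} (lo hi : Fin N → V) (mid : Fin N → Fin N → V) (Γ : Finset (Fin N × Fin N))
    (hlt : ∀ e ∈ Γ, e.1 < e.2)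
    (hlo : ∀ e ∈ Γ, G.Adj (mid e.1 e.2) (lo e.1))
    (hhi : ∀ e ∈ Γ, G.Adj (mid e.1 e.2) (hi e.2))
    (hnlo : ∀ e ∈ Γ, ∀ f ∈ Γ, f.1 ≠ e.1 → f.1 ≠ e.2 → ¬ G.Adj (mid e.1 e.2) (lo f.1))
    (hnhi : ∀ e ∈ Γ, ∀ f ∈ Γ, f.2 ≠ e.1 → f.2 ≠ e.2 → ¬ G.Adj (mid e.1 e.2) (hi f.2))
    (hll : ∀ e ∈ Γ, ∀ f ∈ Γ, e.1 ≠ f.1 → ¬ G.Adj (lo e.1) (lo f.1))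
    (hhh : ∀ e ∈ Γ, ∀ f ∈ Γ, e.2 ≠ f.2 → ¬ G.Adj (hi e.2) (hi f.2))
    (hlh : ∀ e ∈ Γ, ∀ f ∈ Γ, e.1 ≠ f.2 → ¬ G.Adj (lo e.1) (hi f.2))
    (hmm : ∀ e ∈ Γ, ∀ f ∈ Γ, ¬ G.Adj (mid e.1 e.2) (mid f.1 f.2))
    (hcard : (4 * r + 9) * N < Γ.card) : (pathSixAddPathThree r).IsIndContained G := by
  obtain ⟨i₁, j₁, i₂, j₂, h11, h21, h22, hi12, hj12, hij⟩ := exists_path_of_card Γ (by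
    have : 3 * N ≤ (4 * r + 9) * N := by gcongr; omega
    omega)
  have hij1 : i₁ ≠ j₁ := (hlt _ h11).ne
  have hij2 : i₂ ≠ j₁ := (hlt _ h21).ne
  have hij3 : i₂ ≠ j₂ := (hlt _ h22).ne
  -- The r short paths use only edges whose lower index carries a second edge. This costs at most N
  -- edges and separates the two ends of the short path: the midpoint of the second edge sees `lo`
  -- but not `hi`. Of the (4r+9)N edges, 2N(4+2r) pay for the four indices of the long path and for
  -- the short paths.
  set Γ' := Γ.filter fun e => ∃ f ∈ Γ, f.1 = e.1 ∧ f.2 ≠ e.2 with hΓ'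
  have hcard' : 2 * N * (({i₁, j₁, i₂, j₂} : Finset (Fin N)).card + 2 * r) < Γ'.card := by
    have h1 := card_filter_unique_fst_le Γ
    have h2 := card_filter_add_card_filter_not (s := Γ) fun e => ∃ f ∈ Γ, f.1 = e.1 ∧ f.2 ≠ e.2
    have h3 : ({i₁, j₁, i₂, j₂} : Finset (Fin N)).card ≤ 4 := card_le_four
    have h4 : 2 * N * (({i₁, j₁, i₂, j₂} : Finset (Fin N)).card + 2 * r) ≤ 2 * N * (4 + 2 * r) := by
      gcongr
    have h5 : (4 * r + 9) * N = 2 * N * (4 + 2 * r) + N := by ring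
    rw [h5] at hcard
    refine h4.trans_lt ?_
    simp only [hΓ']
    omega
  obtain ⟨f, hf, hff⟩ := exists_disjoint_pairs Γ' r _ hcard'
  have hfΓ : ∀ t, f t ∈ Γ := fun t => (mem_filter.1 (hf t).1).1
  have hlh' : ∀ t, lo (f t).1 ≠ hi (f t).2 := by
    intro t heq
    obtain ⟨g, hg, hg1, hg2⟩ := (mem_filter.1 (hf t).1).2
    refine hnhi g hg (f t) (hfΓ t) ?_ (Ne.symm hg2) ?_
    · rw [hg1]; exact (hlt _ (hfΓ t)).ne'
    · rw [← heq, ← hg1]; exact hlo g hg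
  simp only [mem_insert, mem_singleton, not_or] at hf
  have symm : ∀ {x y}, ¬ G.Adj x y → ¬ G.Adj y x := fun h h' => h h'.symm
  refine pathSixAddPathThree_isIndContained
    -- The long path stops at a midpoint, so the last index j₂ contributes no branch vertex.
    ![lo i₁, mid i₁ j₁, hi j₁, mid i₂ j₁, lo i₂, mid i₂ j₂]
    (fun t => ![lo (f t).1, mid (f t).1 (f t).2, hi (f t).2]) ?_ ?_ ?_ ?_
  · have a01 := hlo _ h11
    have a12 := hhi _ h11
    have a23 := hhi _ h21
    have a34 := hlo _ h21
    have a45 := hlo _ h22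
    have n02 := hlh _ h11 _ h11 hij1
    have n03 := hnlo _ h21 _ h11 hi12 hij1
    have n04 := hll _ h11 _ h22 hi12
    have n05 := hnlo _ h22 _ h11 hi12 hij
    have n13 := hmm _ h11 _ h21
    have n14 := hnlo _ h11 _ h22 (Ne.symm hi12) hij2
    have n15 := hmm _ h11 _ h22
    have n24 := hlh _ h22 _ h11 hij2
    have n25 := hnhi _ h22 _ h11 (Ne.symm hij2) hj12
    have n35 := hmm _ h21 _ h22
    simp only at a01 a12 a23 a34 a45 n02 n03 n04 n05 n13 n14 n15 n24 n25 n35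
    intro i j
    rw [SimpleGraph.pathGraph_adj]
    fin_cases i <;> fin_cases j <;>
      simp [a01, a12, a23, a34, a45, a01.symm, a12.symm, a23.symm, a34.symm, a45.symm,
        n02, n03, n04, n05, n13, n14, n15, n24, n25, n35, symm n02, symm n03, symm n04, symm n05,
        symm n13, symm n14, symm n15, symm n24, symm n25, symm n35]
  · intro t
    exact ⟨(hlo _ (hfΓ t)).symm, hhi _ (hfΓ t), hlh _ (hfΓ t) _ (hfΓ t) (hlt _ (hfΓ t)).ne,
      hlh' t⟩
  · intro t t' htt
    obtain ⟨d1, d2, d3, d4⟩ := hff t t' htt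
    have n00 := hll _ (hfΓ t) _ (hfΓ t') d1
    have n01 := symm (hnlo _ (hfΓ t') _ (hfΓ t) d1 d2)
    have n02 := hlh _ (hfΓ t) _ (hfΓ t') d2
    have n10 := hnlo _ (hfΓ t) _ (hfΓ t') (Ne.symm d1) (Ne.symm d3)
    have n11 := hmm _ (hfΓ t) _ (hfΓ t')
    have n12 := hnhi _ (hfΓ t) _ (hfΓ t') (Ne.symm d2) (Ne.symm d4)
    have n20 := symm (hlh _ (hfΓ t') _ (hfΓ t) (Ne.symm d3))
    have n21 := symm (hnhi _ (hfΓ t') _ (hfΓ t) d3 d4)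
    have n22 := hhh _ (hfΓ t) _ (hfΓ t') d4
    intro i j
    fin_cases i <;> fin_cases j <;>
      simp [n00, n01, n02, n10, n11, n12, n20, n21, n22]
  · have key : ∀ t, ∀ e ∈ Γ, (f t).1 ≠ e.1 → (f t).1 ≠ e.2 → (f t).2 ≠ e.1 → (f t).2 ≠ e.2 →
        ∀ j, ¬ G.Adj (lo e.1) (![lo (f t).1, mid (f t).1 (f t).2, hi (f t).2] j) ∧
          ¬ G.Adj (mid e.1 e.2) (![lo (f t).1, mid (f t).1 (f t).2, hi (f t).2] j) ∧
          ¬ G.Adj (hi e.2) (![lo (f t).1, mid (f t).1 (f t).2, hi (f t).2] j) := by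
      intro t e he d1 d2 d3 d4 j
      have n00 := symm (hll _ (hfΓ t) _ he d1)
      have n02 := symm (hlh _ (hfΓ t) _ he d2)
      have n20 := hlh _ he _ (hfΓ t) (Ne.symm d3)
      have n22 := symm (hhh _ (hfΓ t) _ he d4)
      have n10 := symm (hnlo _ (hfΓ t) _ he (Ne.symm d1) (Ne.symm d3))
      have n12 := symm (hnhi _ (hfΓ t) _ he (Ne.symm d2) (Ne.symm d4))
      have n11 := symm (hmm _ (hfΓ t) _ he)
      have m0 := hnlo _ he _ (hfΓ t) d1 d2
      have m2 := hnhi _ he _ (hfΓ t) d3 d4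
      fin_cases j
      · exact ⟨n00, m0, n02⟩
      · exact ⟨n10, n11, n12⟩
      · exact ⟨n20, m2, n22⟩
    intro i t j
    obtain ⟨-, ⟨a1, a2, a3, a4⟩, b1, b2, b3, b4⟩ := hf t
    have k1 := key t _ h11 a1 a2 b1 b2 j
    have k2 := key t _ h21 a3 a2 b3 b2 j
    have k3 := key t _ h22 a3 a4 b3 b4 j
    fin_cases i
    · exact k1.1
    · exact k1.2.1
    · exact k1.2.2
    · exact k2.2.1
    · exact k2.1
    · exact k3.2.1

/-! ## Weighted averages over tuples -/

/-- Resampling one coordinate: exchanging the l-th entry of a tuple with an independent sample is an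
involution that preserves the product weight. -/
theorem sum_prod_mul_update {α : Type} [Fintype α] [DecidableEq α] {k : ℕ} (w : α → ℝ)
    (f : (Fin k → α) → ℝ) (l : Fin k) :
    (∑ s, w s) * ∑ e : Fin k → α, (∏ i, w (e i)) * f e =
      ∑ e : Fin k → α, (∏ i, w (e i)) * ∑ s, w s * f (Function.update e l s) := by
  have hprod : ∀ (e : Fin k → α) (s : α),
      w (e l) * ∏ i, w (Function.update e l s i) = w s * ∏ i, w (e i) := by
    intro e s
    rw [Fintype.prod_eq_mul_prod_compl l, Fintype.prod_eq_mul_prod_compl l (fun i => w (e i)),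
      Function.update_self]
    have : ∏ i ∈ {l}ᶜ, w (Function.update e l s i) = ∏ i ∈ {l}ᶜ, w (e i) := by
      refine prod_congr rfl fun i hi => ?_
      rw [Function.update_of_ne (by simpa using hi)]
    rw [this]; ring
  have hinv : Function.Involutive
      (fun p : (Fin k → α) × α => (Function.update p.1 l p.2, p.1 l)) := by
    rintro ⟨e, s⟩
    simp
  calc (∑ s, w s) * ∑ e : Fin k → α, (∏ i, w (e i)) * f e
      = ∑ p : (Fin k → α) × α, w p.2 * (∏ i, w (p.1 i)) * f p.1 := by
        rw [sum_mul_sum, sum_comm, ← univ_product_univ, sum_product]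
        simp only [mul_assoc]
    _ = ∑ p : (Fin k → α) × α, w (p.1 l) * (∏ i, w (Function.update p.1 l p.2 i)) *
          f (Function.update p.1 l p.2) :=
        (Equiv.sum_comp hinv.toPerm
          (fun p : (Fin k → α) × α => w p.2 * (∏ i, w (p.1 i)) * f p.1)).symm
    _ = ∑ e : Fin k → α, (∏ i, w (e i)) * ∑ s, w s * f (Function.update e l s) := by
        rw [← univ_product_univ, sum_product]
        refine sum_congr rfl fun e _ => ?_
        rw [mul_sum]
        refine sum_congr rfl fun s _ => ?_
        simp only [hprod]
        ring

theorem sum_prod_eq_pow {α : Type} [Fintype α] {k : ℕ} (w : α → ℝ) :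
    ∑ e : Fin k → α, ∏ i, w (e i) = (∑ s, w s) ^ k := by
  classical
  rw [← Fin.prod_const k (∑ s, w s), prod_univ_sum, Fintype.piFinset_univ]

open Classical in
/-- If every set in a family indexed by pairs is light, then some tuple avoids it throughout. -/
theorem exists_tuple_avoiding {α : Type} [Fintype α] {k : ℕ} {w : α → ℝ} (hw : ∀ s, 0 ≤ w s)
    (hW : 0 < ∑ s, w s) {ε : ℝ} (hε : (k : ℝ) ^ 3 * ε < 1) (R : α → α → α → Prop)
    (hR : ∀ e e', ∑ l with R e e' l, w l ≤ ε * ∑ s, w s) :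
    ∃ e : Fin k → α, ∀ i j l, l ≠ i → l ≠ j → ¬ R (e i) (e j) (e l) := by
  by_contra! hcon
  set W := ∑ s, w s with hWdef
  -- For fixed i and j the l-th entry is an independent sample, so it falls into a light set with
  -- proportion at most ε. A union bound over the k³ triples then finishes. The case i = j is
  -- included and later yields distinct entries.
  have h1 : ∀ i j l : Fin k, l ≠ i → l ≠ j →
      ∑ e : Fin k → α, (∏ i, w (e i)) * (if R (e i) (e j) (e l) then 1 else 0) ≤ ε * W ^ k := by
    intro i j l hi hj
    have h2 := sum_prod_mul_update w (fun e => if R (e i) (e j) (e l) then (1 : ℝ) else 0) l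
    have h3 : ∑ e : Fin k → α, (∏ i, w (e i)) * ∑ s, w s *
        (if R (Function.update e l s i) (Function.update e l s j) (Function.update e l s l)
          then (1 : ℝ) else 0) ≤ ∑ e : Fin k → α, (∏ i, w (e i)) * (ε * W) := by
      refine sum_le_sum fun e _ => mul_le_mul_of_nonneg_left ?_ (prod_nonneg fun i _ => hw _)
      simp only [Function.update_of_ne hi.symm, Function.update_of_ne hj.symm,
        Function.update_self, mul_ite, mul_one, mul_zero]
      rw [← sum_filter]
      exact hR _ _
    rw [← sum_mul, sum_prod_eq_pow] at h3
    rw [← h2] at h3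
    refine le_of_mul_le_mul_left (h3.trans (le_of_eq ?_)) hW
    ring
  have h4 : W ^ k ≤ ∑ t : Fin k × Fin k × Fin k, ε * W ^ k := by
    calc W ^ k = ∑ e : Fin k → α, ∏ i, w (e i) := (sum_prod_eq_pow w).symm
      _ ≤ ∑ e : Fin k → α, ∑ t : Fin k × Fin k × Fin k, (∏ i, w (e i)) *
          (if t.2.2 ≠ t.1 ∧ t.2.2 ≠ t.2.1 ∧ R (e t.1) (e t.2.1) (e t.2.2) then 1 else 0) := by
          refine sum_le_sum fun e _ => ?_
          obtain ⟨i, j, l, hi, hj, hR'⟩ := hcon e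
          refine le_trans ?_ (single_le_sum (fun t _ => mul_nonneg (prod_nonneg fun i _ => hw _)
            (by split_ifs <;> simp)) (mem_univ (i, j, l)))
          simp [hi, hj, hR']
      _ = ∑ t : Fin k × Fin k × Fin k, ∑ e : Fin k → α, (∏ i, w (e i)) *
          (if t.2.2 ≠ t.1 ∧ t.2.2 ≠ t.2.1 ∧ R (e t.1) (e t.2.1) (e t.2.2) then 1 else 0) :=
          sum_comm
      _ ≤ _ := by
          refine sum_le_sum fun t _ => ?_
          by_cases ht : t.2.2 ≠ t.1 ∧ t.2.2 ≠ t.2.1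
          · simpa [ht.1, ht.2] using h1 t.1 t.2.1 t.2.2 ht.1 ht.2
          · have h0 : ∀ e : Fin k → α, ¬ (t.2.2 ≠ t.1 ∧ t.2.2 ≠ t.2.1 ∧
                R (e t.1) (e t.2.1) (e t.2.2)) := fun e h => ht ⟨h.1, h.2.1⟩
            simp only [h0, if_false, mul_zero, sum_const_zero]
            have hε0 : 0 ≤ ε * W := by
              by_contra! hneg
              have hne : Nonempty α := by
                by_contra hemp
                rw [not_nonempty_iff] at hemp
                simp [hWdef] at hW
              have s := hne.some
              exact absurd ((sum_nonneg fun l _ => hw l).trans (hR s s)) (not_le.2 hneg)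
            have hε1 : 0 ≤ ε := nonneg_of_mul_nonneg_left hε0 hW
            positivity
  simp only [sum_const, card_univ, Fintype.card_prod, Fintype.card_fin, nsmul_eq_mul] at h4
  have hpos : 0 < W ^ k := by positivity
  have h5 : ((k * (k * k) : ℕ) : ℝ) * (ε * W ^ k) = ((k : ℝ) ^ 3 * ε) * W ^ k := by
    push_cast; ring
  rw [h5] at h4
  nlinarith

/-! ## Independent sets in sparse relations -/

/-- Greedy choice: taking v discards v and its fewer than δ relatives, so at most δ elements per
step. -/
theorem exists_independent_of_degree_lt {k : ℕ} (I : Fin k → Fin k → Prop) [DecidableRel I]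
    (hI : ∀ i j, I i j → I j i) {δ : ℕ} (hδ : 0 < δ) (ν : ℕ) :
    ∀ A : Finset (Fin k), (∀ v ∈ A, (A.filter fun u => u ≠ v ∧ I v u).card < δ) → ν * δ ≤ A.card →
      ∃ f : Fin ν → Fin k, (∀ t, f t ∈ A) ∧ ∀ s t, s ≠ t → ¬ I (f s) (f t) := by
  induction ν with
  | zero => intro A _ _; exact ⟨Fin.elim0, fun t => t.elim0, fun t => t.elim0⟩
  | succ ν ih =>
    intro A hA hcard
    rcases A.eq_empty_or_nonempty with rfl | ⟨v, hv⟩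
    · simp only [card_empty, Nat.le_zero, mul_eq_zero] at hcard
      omega
    · set A' := (A.erase v).filter fun u => ¬ I v u with hA'
      have hsub : A' ⊆ A := (filter_subset _ _).trans (erase_subset _ _)
      have h1 := card_filter_add_card_filter_not (s := A.erase v) fun u => I v u
      have h2 : ((A.erase v).filter fun u => I v u) = A.filter fun u => u ≠ v ∧ I v u := by
        ext u
        simp only [mem_filter, mem_erase]
        tauto
      have h3 := card_erase_of_mem hv
      have h4 := hA v hv
      have h5 : 0 < A.card := card_pos.2 ⟨v, hv⟩
      rw [h2] at h1
      obtain ⟨f, hf, hff⟩ := ih A' (fun u hu => lt_of_le_of_lt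
        (card_le_card (filter_subset_filter _ hsub)) (hA u (hsub hu))) (by
          rw [hA']
          rw [add_mul, one_mul] at hcard
          omega)
      have hv' : ∀ t, ¬ I v (f t) := fun t => (mem_filter.1 (hf t)).2
      refine ⟨Fin.cons v f, ?_, ?_⟩
      · intro t
        refine Fin.cases hv (fun t => ?_) t
        simpa using hsub (hf t)
      · intro s t
        refine Fin.cases ?_ (fun s => ?_) s <;> refine Fin.cases ?_ (fun t => ?_) t <;> intro hst
        · exact absurd rfl hst
        · simpa using hv' t
        · simpa using fun h => hv' s (hI _ _ h)
        · simpa using hff s t fun h => hst (by rw [h])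

/-- A symmetric relation without large independent sets has many related pairs. -/
theorem le_card_pairs_of_not_independent {k : ℕ} (I : Fin k → Fin k → Prop) [DecidableRel I]
    (hI : ∀ i j, I i j → I j i) {δ : ℕ} (hδ : 0 < δ) {ν : ℕ}
    (hν : ¬ ∃ f : Fin ν → Fin k, ∀ s t, s ≠ t → ¬ I (f s) (f t)) (A : Finset (Fin k)) :
    (A.card - ν * δ) * δ ≤ ((A ×ˢ A).filter fun e => e.1 < e.2 ∧ I e.1 e.2).card := by
  induction A using Finset.strongInduction with
  | H A ih =>
    rcases Nat.lt_or_ge A.card (ν * δ) with h | h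
    · rw [Nat.sub_eq_zero_of_le h.le, zero_mul]; exact Nat.zero_le _
    -- While ν·δ elements remain, some degree is at least δ, or the greedy choice would succeed.
    -- Deleting such a vertex accounts for δ pairs that do not occur later.
    · obtain ⟨v, hv, hdeg⟩ : ∃ v ∈ A, δ ≤ (A.filter fun u => u ≠ v ∧ I v u).card := by
        by_contra! hcon
        obtain ⟨f, -, hf⟩ := exists_independent_of_degree_lt I hI hδ ν A hcon h
        exact hν ⟨f, hf⟩
      have h1 := ih (A.erase v) (erase_ssubset hv)
      have h2 := card_erase_of_mem hv
      have h5 : 0 < A.card := card_pos.2 ⟨v, hv⟩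
      have h3 : (A.card - ν * δ) * δ ≤ ((A.erase v).card - ν * δ) * δ + δ := by
        rw [h2, ← add_one_mul]
        exact Nat.mul_le_mul_right _ (by omega)
      refine h3.trans ((Nat.add_le_add h1 hdeg).trans ?_)
      have hinj : Set.InjOn (fun u => (min v u, max v u))
          ((A.filter fun u => u ≠ v ∧ I v u : Finset _) : Set (Fin k)) := by
        intro a _ b _ hab
        simp only [Prod.mk.injEq] at hab
        obtain ⟨hmin, hmax⟩ := hab
        rcases le_total v a with h | h <;> rcases le_total v b with h' | h' <;> simp_all
      rw [← card_image_of_injOn hinj, ← card_union_of_disjoint]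
      · refine card_le_card fun e he => ?_
        rw [mem_union] at he
        rcases he with he | he
        · simp only [mem_filter, mem_product, mem_erase] at he ⊢
          tauto
        · simp only [mem_image, mem_filter] at he
          obtain ⟨u, ⟨hu, hne, hvu⟩, rfl⟩ := he
          rcases lt_or_gt_of_ne hne with h | h
          · simp [h.le, hu, hv, h, hI _ _ hvu]
          · simp [h.le, hu, hv, h, hvu]
      · rw [disjoint_left]
        intro e he he'
        simp only [mem_filter, mem_product, mem_erase] at he
        simp only [mem_image, mem_filter] at he'
        obtain ⟨u, -, rfl⟩ := he'
        rcases le_total v u with h | h <;> simp [h] at he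

/-! ## Multiplicative weights -/

open Classical in
/-- If under all weights on `ι` some point hits a fixed proportion, then for some weights on the
points all members of `ι` are hit by a fixed proportion. -/
theorem exists_weights_of_forall_weights {V ι : Type} [Fintype V] [Fintype ι] [Nonempty ι]
    (hit : ι → V → Prop) {ε : ℝ} (hε : 0 < ε)
    (H : ∀ w : ι → ℝ, (∀ e, 0 < w e) → ∃ u, ε * ∑ e, w e ≤ ∑ e with hit e u, w e) :
    ∃ μ : V → ℝ, (∀ u, 0 ≤ μ u) ∧ 0 < ∑ u, μ u ∧
      ∀ e, ε / 4 * ∑ u, μ u ≤ ∑ u with hit e u, μ u := by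
  -- In each round the members of `ι` are weighted by the exponential of minus the measure that hits
  -- them so far, and a heavy point under these weights receives one more unit. As exp(-1) ≤ 1/2,
  -- the potential shrinks by a factor of at most 1 - ε/2.
  have step : ∀ T : ℕ, ∃ μ : V → ℝ, (∀ u, 0 ≤ μ u) ∧ ∑ u, μ u = T ∧
      ∑ e, Real.exp (-∑ u with hit e u, μ u) ≤ Fintype.card ι * Real.exp (-(ε / 2 * T)) := by
    intro T
    induction T with
    | zero => exact ⟨0, by simp, by simp, by simp⟩
    | succ T ih =>
      obtain ⟨μ, hμ, hT, hΦ⟩ := ih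
      obtain ⟨u, hu⟩ := H (fun e => Real.exp (-∑ u with hit e u, μ u)) fun e => Real.exp_pos _
      refine ⟨fun v => μ v + if v = u then 1 else 0, ?_, ?_, ?_⟩
      · intro v
        have := hμ v
        dsimp only
        split_ifs <;> linarith
      · rw [sum_add_distrib, hT]; simp
      · set Φ := ∑ e, Real.exp (-∑ u with hit e u, μ u) with hΦdef
        have h1 : ∀ e, Real.exp (-∑ v with hit e v, (μ v + if v = u then 1 else 0)) ≤
            Real.exp (-∑ v with hit e v, μ v) -
              1 / 2 * (if hit e u then Real.exp (-∑ v with hit e v, μ v) else 0) := by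
          intro e
          rw [sum_add_distrib]
          by_cases he : hit e u
          · have h2 : ∑ v with hit e v, (if v = u then (1 : ℝ) else 0) = 1 := by
              rw [sum_ite_eq' _ u]; simp [he]
            rw [h2, if_pos he, neg_add, Real.exp_add]
            have h3 : Real.exp (-1) ≤ 1 / 2 := by
              rw [Real.exp_neg, one_div]
              refine inv_anti₀ two_pos ?_
              have := Real.add_one_le_exp (1 : ℝ)
              linarith
            nlinarith [Real.exp_pos (-∑ v with hit e v, μ v)]
          · have h2 : ∑ v with hit e v, (if v = u then (1 : ℝ) else 0) = 0 := by
              rw [sum_ite_eq' _ u]; simp [he]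
            rw [h2, if_neg he]; simp
        have h4 := sum_le_sum fun e (_ : e ∈ (univ : Finset ι)) => h1 e
        rw [sum_sub_distrib, ← mul_sum, ← sum_filter] at h4
        have h5 : Φ - 1 / 2 * (ε * Φ) = Φ * (1 - ε / 2) := by ring
        have hΦ0 : 0 < Φ := sum_pos (fun e _ => Real.exp_pos _) univ_nonempty
        have h6 : 1 - ε / 2 ≤ Real.exp (-(ε / 2)) := by
          have := Real.add_one_le_exp (-(ε / 2))
          linarith
        calc _ ≤ Φ * (1 - ε / 2) := by rw [← h5]; linarith
          _ ≤ Φ * Real.exp (-(ε / 2)) := by gcongr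
          _ ≤ (Fintype.card ι * Real.exp (-(ε / 2 * T))) * Real.exp (-(ε / 2)) := by gcongr
          _ = _ := by
            rw [mul_assoc, ← Real.exp_add]
            congr 2
            push_cast; ring
  -- A single term of the potential shows that each member is hit by at least εT/2 minus the
  -- logarithm of the number of members; for T this large that is at least εT/4.
  obtain ⟨T, hT⟩ := exists_nat_gt (4 * Real.log (Fintype.card ι) / ε)
  obtain ⟨μ, hμ, hsum, hΦ⟩ := step (T + 1)
  refine ⟨μ, hμ, by rw [hsum]; positivity, fun e => ?_⟩
  have h1 : Real.exp (-∑ u with hit e u, μ u) ≤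
      Fintype.card ι * Real.exp (-(ε / 2 * (T + 1 : ℕ))) :=
    (single_le_sum (f := fun e => Real.exp (-∑ u with hit e u, μ u))
      (fun e _ => (Real.exp_pos _).le) (mem_univ e)).trans hΦ
  have hc : (0 : ℝ) < Fintype.card ι := by exact_mod_cast Fintype.card_pos
  have h2 := Real.log_le_log (Real.exp_pos _) h1
  rw [Real.log_exp, Real.log_mul hc.ne' (Real.exp_pos _).ne', Real.log_exp] at h2
  rw [div_lt_iff₀ hε] at hT
  rw [hsum]
  push_cast at h2 ⊢
  nlinarith

/-! ## Hitting sets -/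

/-- A family of sextuples of vertices of a graph, and a rule that says, in terms of classes of
vertices, which adjacencies count as hits. -/
structure HittingSystem (V ι τ : Type) where
  graph : SimpleGraph V
  cls : V → τ
  rel : τ → τ → Prop
  mem : ι → Fin 6 → V

namespace HittingSystem

variable {V ι τ : Type}

/-- The adjacencies that count. -/
def Attached (A : HittingSystem V ι τ) (q u : V) : Prop :=
  A.graph.Adj q u ∧ A.rel (A.cls q) (A.cls u)

/-- `u` hits the sextuple `e`. -/
def Hit (A : HittingSystem V ι τ) (e : ι) (u : V) : Prop :=
  ∃ a, A.Attached (A.mem e a) u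

/-- The conditions under which nonadjacency is known. -/
structure IsAdmissible (A : HittingSystem V ι τ) : Prop where
  points : ∀ q q' u u', A.Attached q u → A.Attached q' u' → A.cls u = A.cls u' →
    ¬ A.graph.Adj u u'
  centers : ∀ q q' u u', A.Attached q u → A.Attached q' u' → A.cls u = A.cls u' →
    A.cls q = A.cls q' → ¬ A.graph.Adj q q'
  members : ∀ e e' a b u u', e ≠ e' → A.Attached (A.mem e a) u → A.Attached (A.mem e' b) u' →
    A.cls u = A.cls u' → ¬ A.graph.Adj (A.mem e a) (A.mem e' b)
  nonempty : ∀ e, ∃ u, A.Hit e u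

theorem Attached.of_cls {A : HittingSystem V ι τ} {q q' u u' : V} (h : A.Attached q u)
    (hq : A.cls q' = A.cls q) (hu : A.cls u' = A.cls u) (hadj : A.graph.Adj q' u') :
    A.Attached q' u' :=
  ⟨hadj, by rw [hq, hu]; exact h.2⟩

/-- `ν` sextuples no two of which are hit by the same vertex. -/
def HasDisjoint (A : HittingSystem V ι τ) (ν : ℕ) : Prop :=
  ∃ f : Fin ν → ι, ∀ s t, s ≠ t → ∀ u, ¬ (A.Hit (f s) u ∧ A.Hit (f t) u)

end HittingSystem

/-- A degree that forces many equally labelled pairs. -/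
def degreeBound (t r : ℕ) : ℕ := 72 * t ^ 3 * (4 * r + 9) + 1

/-- A length of tuples. -/
def tupleBound (t r ν : ℕ) : ℕ := 2 * ν * degreeBound t r

/-- A bound on the size of a hitting set is `2 * netBound t r ν`. -/
def netBound (t r ν : ℕ) : ℕ :=
  2 * t ^ 2 * (4 * r + 9) * (24 * t * (tupleBound t r ν ^ 3 + 1)) ^ 2 + 1

namespace HittingSystem

variable {V ι τ : Type}

-- If no point is heavy, a random k-tuple of hyperedges has the property that the chosen point
-- common to two of them hits no third one. Without ν disjoint hyperedges, many pairs in the tuple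
-- do have a common point. Members of the hyperedges as branch vertices and the common points as
-- subdivision vertices then form the subdivision of a dense graph.
open Classical in
theorem exists_heavy_point [Fintype V] [Fintype ι] [Fintype τ] {A : HittingSystem V ι τ} {r ν : ℕ}
    (hG : IsInducedFree (pathSixAddPathThree r) A.graph) (hA : A.IsAdmissible) (hν : 0 < ν)
    (hdisj : ¬ A.HasDisjoint ν) (w : ι → ℝ)
    (hw : ∀ e, 0 < w e) [Nonempty ι] :
    ∃ u, (1 / ((tupleBound (Fintype.card τ) r ν : ℝ) ^ 3 + 1)) * ∑ e, w e ≤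
      ∑ e with (A.Hit e u), w e := by
  by_contra! hcon
  set t := Fintype.card τ with ht
  set k := tupleBound t r ν with hk
  have hp : ∀ e e', ∃ u, (∃ v, A.Hit e v ∧ A.Hit e' v) → A.Hit e u ∧ A.Hit e' u := by
    intro e e'
    by_cases h : ∃ v, A.Hit e v ∧ A.Hit e' v
    · obtain ⟨v, hv⟩ := h
      exact ⟨v, fun _ => hv⟩
    · obtain ⟨u, -⟩ := hA.nonempty e
      exact ⟨u, fun h' => absurd h' h⟩
  choose p hp using hp
  obtain ⟨e, he⟩ := exists_tuple_avoiding (k := k) (fun s => (hw s).le)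
    (sum_pos (fun s _ => hw s) univ_nonempty)
    (ε := 1 / ((k : ℝ) ^ 3 + 1)) (by rw [mul_one_div, div_lt_one (by positivity)]; linarith)
    (fun a b l => A.Hit l (p a b)) (fun a b => by
      exact (hcon (p a b)).le)
  let I : Fin k → Fin k → Prop := fun i j => ∃ v, A.Hit (e i) v ∧ A.Hit (e j) v
  have hIs : ∀ i j, I i j → I j i := fun i j ⟨v, h1, h2⟩ => ⟨v, h2, h1⟩
  have hδ : 0 < degreeBound t r := by unfold degreeBound; omega
  have hcount := le_card_pairs_of_not_independent I hIs hδ (ν := ν) (by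
    rintro ⟨f, hf⟩
    exact hdisj ⟨fun s => e (f s), fun s t hst u hu => hf s t hst ⟨u, hu⟩⟩) univ
  set Γ := ((univ : Finset (Fin k)) ×ˢ univ).filter fun e => e.1 < e.2 ∧ I e.1 e.2 with hΓ
  have hlab : ∀ i j, I i j → ∃ a b, A.Attached (A.mem (e i) a) (p (e i) (e j)) ∧
      A.Attached (A.mem (e j) b) (p (e i) (e j)) := by
    intro i j hij
    obtain ⟨⟨a, ha⟩, b, hb⟩ := hp _ _ hij
    exact ⟨a, b, ha, hb⟩
  have hlab' : ∀ i j, ∃ a b, I i j → A.Attached (A.mem (e i) a) (p (e i) (e j)) ∧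
      A.Attached (A.mem (e j) b) (p (e i) (e j)) := by
    intro i j
    by_cases h : I i j
    · obtain ⟨a, b, h1⟩ := hlab i j h
      exact ⟨a, b, fun _ => h1⟩
    · exact ⟨0, 0, fun h' => absurd h' h⟩
  choose a b hab using hlab'
  let lab : Fin k × Fin k → (Fin 6 × Fin 6) × (τ × τ × τ) := fun x =>
    ((a x.1 x.2, b x.1 x.2), (A.cls (p (e x.1) (e x.2)), A.cls (A.mem (e x.1) (a x.1 x.2)),
      A.cls (A.mem (e x.2) (b x.1 x.2))))
  -- A label consists of the two positions within the sextuples and of three classes, so there are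
  -- 36t³ labels. With k = 2νδ there are at least νδ² pairs, and δ > 72t³(4r+9) leaves more than
  -- (4r+9)k pairs with one label.
  obtain ⟨⟨⟨a₀, b₀⟩, γ, α, β⟩, -, hfib⟩ := exists_lt_card_fiber_of_mul_lt_card_of_maps_to
    (s := Γ) (t := univ) (f := lab) (n := (4 * r + 9) * k) (fun _ _ => mem_univ _) (by
      refine lt_of_lt_of_le ?_ hcount
      simp only [card_univ, Fintype.card_prod, Fintype.card_fin, ← ht]
      have hk2 : k = ν * degreeBound t r + ν * degreeBound t r := by
        rw [hk, tupleBound]; ring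
      have h1 : k - ν * degreeBound t r = ν * degreeBound t r := by omega
      rw [h1]
      have h2 : 6 * 6 * (t * (t * t)) * ((4 * r + 9) * k) =
          ν * degreeBound t r * (72 * t ^ 3 * (4 * r + 9)) := by
        rw [hk2]; ring
      rw [h2]
      exact Nat.mul_lt_mul_of_pos_left (by unfold degreeBound; omega) (Nat.mul_pos hν hδ))
  refine hG ?_
  have hI : ∀ x ∈ Γ, x.1 < x.2 ∧ I x.1 x.2 := fun x hx => (mem_filter.1 hx).2
  have hΓ' : ∀ x ∈ Γ.filter (fun x => lab x = ((a₀, b₀), γ, α, β)), x.1 < x.2 ∧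
      A.Attached (A.mem (e x.1) a₀) (p (e x.1) (e x.2)) ∧
      A.Attached (A.mem (e x.2) b₀) (p (e x.1) (e x.2)) ∧ A.cls (p (e x.1) (e x.2)) = γ ∧
      A.cls (A.mem (e x.1) a₀) = α ∧ A.cls (A.mem (e x.2) b₀) = β := by
    intro x hx
    obtain ⟨hx, hxl⟩ := mem_filter.1 hx
    have hlt := (hI x hx).1
    obtain ⟨h1, h2⟩ := hab x.1 x.2 (hI x hx).2
    simp only [lab, Prod.mk.injEq] at hxl
    obtain ⟨⟨rfl, rfl⟩, rfl, rfl, rfl⟩ := hxl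
    exact ⟨hlt, h1, h2, rfl, rfl, rfl⟩
  -- The avoidance property for a repeated index: the point chosen for (e i, e i) hits e i, but does
  -- not hit e j.
  have hne : ∀ i j, i ≠ j → e i ≠ e j := by
    intro i j hij heq
    obtain ⟨v, hv⟩ := hA.nonempty (e i)
    have := (hp (e i) (e i) ⟨v, hv, hv⟩).1
    exact he i i j (Ne.symm hij) (Ne.symm hij) (heq ▸ this)
  refine pathSixAddPathThree_isIndContained_of_subdivision (fun i => A.mem (e i) a₀)
    (fun j => A.mem (e j) b₀) (fun i j => p (e i) (e j))
    (Γ.filter fun x => lab x = ((a₀, b₀), γ, α, β)) ?_ ?_ ?_ ?_ ?_ ?_ ?_ ?_ ?_ hfib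
  · exact fun x hx => (hΓ' x hx).1
  · exact fun x hx => (hΓ' x hx).2.1.1.symm
  · exact fun x hx => (hΓ' x hx).2.2.1.1.symm
  · intro x hx y hy h1 h2 hadj
    obtain ⟨-, kx, -, cx, dx, -⟩ := hΓ' x hx
    obtain ⟨-, -, -, -, dy, -⟩ := hΓ' y hy
    exact he _ _ _ h1 h2 ⟨a₀, kx.of_cls (dy.trans dx.symm) rfl hadj.symm⟩
  · intro x hx y hy h1 h2 hadj
    obtain ⟨-, -, kx, cx, -, dx⟩ := hΓ' x hx
    obtain ⟨-, -, -, -, -, dy⟩ := hΓ' y hy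
    exact he _ _ _ h1 h2 ⟨b₀, kx.of_cls (dy.trans dx.symm) rfl hadj.symm⟩
  · intro x hx y hy h1
    obtain ⟨-, kx, -, cx, -, -⟩ := hΓ' x hx
    obtain ⟨-, ky, -, cy, -, -⟩ := hΓ' y hy
    exact hA.members _ _ _ _ _ _ (hne _ _ h1) kx ky (cx.trans cy.symm)
  · intro x hx y hy h1
    obtain ⟨-, -, kx, cx, -, -⟩ := hΓ' x hx
    obtain ⟨-, -, ky, cy, -, -⟩ := hΓ' y hy
    exact hA.members _ _ _ _ _ _ (hne _ _ h1) kx ky (cx.trans cy.symm)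
  · intro x hx y hy h1
    obtain ⟨-, kx, -, cx, -, -⟩ := hΓ' x hx
    obtain ⟨-, -, ky, cy, -, -⟩ := hΓ' y hy
    exact hA.members _ _ _ _ _ _ (hne _ _ h1) kx ky (cx.trans cy.symm)
  · intro x hx y hy
    obtain ⟨-, kx, -, cx, -, -⟩ := hΓ' x hx
    obtain ⟨-, ky, -, cy, -, -⟩ := hΓ' y hy
    exact hA.points _ _ _ _ kx ky (cx.trans cy.symm)


open Classical in
/-- Under a measure that gives every hyperedge a fixed proportion, a bounded number of points hits
every hyperedge. -/
theorem exists_net [Fintype V] [Fintype τ] {A : HittingSystem V ι τ} {r : ℕ}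
    (hG : IsInducedFree (pathSixAddPathThree r) A.graph) (hA : A.IsAdmissible) {μ : V → ℝ}
    (hμ : ∀ u, 0 ≤ μ u) (hμ0 : 0 < ∑ u, μ u) {k : ℕ}
    (hhit : ∀ e, 1 / ((k : ℝ) + 1) / 4 * ∑ u, μ u ≤ ∑ u with A.Hit e u, μ u) {M : ℕ}
    (hM : 2 * Fintype.card τ ^ 2 * (4 * r + 9) * (24 * Fintype.card τ * (k + 1)) ^ 2 < M) :
    ∃ X : Finset V, X.card ≤ 2 * M ∧ ∀ e, ∃ u ∈ X, A.Hit e u := by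
  by_contra! hcon
  set t := Fintype.card τ with ht
  set W := ∑ u, μ u with hW
  have hne : Nonempty τ := by
    by_contra hemp
    rw [not_nonempty_iff] at hemp
    obtain ⟨e, -⟩ := hcon ∅ (by simp)
    obtain ⟨u, -⟩ := hA.nonempty e
    exact hemp.elim (A.cls u)
  have ht0 : 0 < t := Fintype.card_pos
  -- The sample consists of two halves of size M. For a in the first half and b in the second, the
  -- remaining points do not hit everything, so they miss some hyperedge.
  let X : (Fin (M + M) → V) → Fin M → Fin M → Finset V := fun z a b =>
    (univ.filter fun i => i ≠ Fin.castAdd M a ∧ i ≠ Fin.natAdd M b).image z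
  have hX : ∀ z a b, ∃ e, ∀ u ∈ X z a b, ¬ A.Hit e u := fun z a b =>
    hcon (X z a b) (card_image_le.trans ((card_filter_le _ _).trans (by simp; omega)))
  -- The missed hyperedge is a function of the set of remaining points alone. So it does not change
  -- when the two omitted coordinates are resampled.
  let e₀ : Finset V → ι := fun Y => if h : ∃ e, ∀ u ∈ Y, ¬ A.Hit e u then h.choose else
    (hcon ∅ (by simp)).choose
  have he₀ : ∀ z a b, ∀ u ∈ X z a b, ¬ A.Hit (e₀ (X z a b)) u := by
    intro z a b
    simp only [e₀, dif_pos (hX z a b)]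
    exact (hX z a b).choose_spec
  let good : ι → V → V → Prop := fun e u v => ∃ c, A.Attached (A.mem e c) u ∧
    A.Attached (A.mem e c) v ∧ A.cls u = A.cls v
  set ε : ℝ := 1 / ((k : ℝ) + 1) / 4 / (6 * t) with hε
  have hε0 : 0 < ε := by positivity
  -- Among the 6t combinations of a member of the hyperedge and a class of points, one carries a
  -- proportion ε of the measure; two independent samples both fall there with proportion at least
  -- ε².
  have hgood : ∀ e, (ε * W) ^ 2 ≤ ∑ s, μ s * ∑ s', μ s' * (if good e s s' then 1 else 0) := by
    intro e
    have h1 : ∑ u with A.Hit e u, μ u ≤ ∑ y : Fin 6 × τ,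
        ∑ u with (A.Attached (A.mem e y.1) u ∧ A.cls u = y.2), μ u := by
      simp only [sum_filter]
      rw [sum_comm]
      refine sum_le_sum fun u _ => ?_
      have h0 : ∀ y ∈ (univ : Finset (Fin 6 × τ)),
          0 ≤ if A.Attached (A.mem e y.1) u ∧ A.cls u = y.2 then μ u else 0 := by
        intro y _
        split_ifs
        · exact hμ u
        · exact le_rfl
      by_cases hu : A.Hit e u
      · obtain ⟨c, hc⟩ := hu
        rw [if_pos ⟨c, hc⟩]
        refine le_trans (le_of_eq ?_) (single_le_sum h0 (mem_univ (c, A.cls u)))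
        rw [if_pos ⟨hc, rfl⟩]
      · rw [if_neg hu]
        exact sum_nonneg h0
    obtain ⟨⟨c, γ⟩, hm⟩ : ∃ y : Fin 6 × τ,
        ε * W ≤ ∑ u with (A.Attached (A.mem e y.1) u ∧ A.cls u = y.2), μ u := by
      by_contra! hlt
      have h2 := sum_lt_sum_of_nonempty (univ_nonempty (α := Fin 6 × τ)) fun y _ => hlt y
      have h3 := (hhit e).trans (h1.trans h2.le)
      have h4 := h1.trans_lt h2
      rw [sum_const, card_univ, Fintype.card_prod, Fintype.card_fin, ← ht, nsmul_eq_mul] at h4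
      refine absurd ((hhit e).trans_lt h4) (not_lt.2 (le_of_eq ?_))
      rw [hε]
      push_cast
      field_simp
    have h5 : ∀ s, 0 ≤ ∑ s', μ s' * (if good e s s' then (1 : ℝ) else 0) := fun s =>
      sum_nonneg fun s' _ => mul_nonneg (hμ _) (by split_ifs <;> simp)
    calc (ε * W) ^ 2 ≤ (∑ u with (A.Attached (A.mem e c) u ∧ A.cls u = γ), μ u) ^ 2 := by
          gcongr
      _ = ∑ s with (A.Attached (A.mem e c) s ∧ A.cls s = γ), μ s *
            ∑ s' with (A.Attached (A.mem e c) s' ∧ A.cls s' = γ), μ s' := by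
          rw [pow_two, sum_mul]
      _ ≤ ∑ s with (A.Attached (A.mem e c) s ∧ A.cls s = γ), μ s *
            ∑ s', μ s' * (if good e s s' then 1 else 0) := by
          refine sum_le_sum fun s hs => mul_le_mul_of_nonneg_left ?_ (hμ s)
          rw [sum_filter]
          refine sum_le_sum fun s' _ => ?_
          by_cases hs' : A.Attached (A.mem e c) s' ∧ A.cls s' = γ
          · rw [mem_filter] at hs
            have : good e s s' := ⟨c, hs.2.1, hs'.1, hs.2.2.trans hs'.2.symm⟩
            simp [hs', this]
          · rw [if_neg hs']
            exact mul_nonneg (hμ _) (by split_ifs <;> simp)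
      _ ≤ _ := sum_le_sum_of_subset_of_nonneg (filter_subset _ _)
          fun s _ _ => mul_nonneg (hμ s) (h5 s)
  have hswap : ∀ a b, (ε * W) ^ 2 * W ^ (M + M) ≤ W ^ 2 * ∑ z : Fin (M + M) → V, (∏ i, μ (z i)) *
      (if good (e₀ (X z a b)) (z (Fin.castAdd M a)) (z (Fin.natAdd M b)) then 1 else 0) := by
    intro a b
    have hab : Fin.castAdd M a ≠ Fin.natAdd M b := by
      intro h
      have := congrArg Fin.val h
      simp at this
      omega
    have hXu : ∀ z s s', X (Function.update (Function.update z (Fin.natAdd M b) s')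
        (Fin.castAdd M a) s) a b = X z a b := by
      intro z s s'
      refine image_congr fun i hi => ?_
      simp only [coe_filter, mem_univ, true_and, Set.mem_ofPred_eq] at hi
      rw [Function.update_of_ne hi.1, Function.update_of_ne hi.2]
    rw [pow_two W, mul_assoc, sum_prod_mul_update μ _ (Fin.castAdd M a), sum_prod_mul_update μ _
      (Fin.natAdd M b), ← sum_prod_eq_pow, mul_sum]
    refine sum_le_sum fun z _ => ?_
    rw [mul_comm]
    refine mul_le_mul_of_nonneg_left ?_ (prod_nonneg fun i _ => hμ _)
    simp only [hXu, Function.update_self, Function.update_of_ne hab.symm]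
    refine (hgood (e₀ (X z a b))).trans (le_of_eq ?_)
    simp only [mul_sum]
    rw [sum_comm]
    refine sum_congr rfl fun s _ => sum_congr rfl fun s' _ => ?_
    ring
  -- By averaging, some sample has at least M²ε² good pairs. The choice of M makes this exceed
  -- t²(4r+9)·2M, so more than (4r+9)·2M of them share the class of the midpoint and the class of
  -- the ends.
  obtain ⟨z, hz⟩ : ∃ z : Fin (M + M) → V, (M : ℝ) ^ 2 * ε ^ 2 ≤ ∑ y : Fin M × Fin M,
      (if good (e₀ (X z y.1 y.2)) (z (Fin.castAdd M y.1)) (z (Fin.natAdd M y.2)) then (1 : ℝ)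
        else 0) := by
    by_contra! hlt
    have h1 : ∑ y : Fin M × Fin M, (ε * W) ^ 2 * W ^ (M + M) ≤
        W ^ 2 * ∑ z : Fin (M + M) → V, (∏ i, μ (z i)) * ∑ y : Fin M × Fin M,
      (if good (e₀ (X z y.1 y.2)) (z (Fin.castAdd M y.1)) (z (Fin.natAdd M y.2)) then (1 : ℝ)
        else 0) := by
      simp only [mul_sum]
      rw [sum_comm]
      refine sum_le_sum fun y _ => ?_
      simpa only [mul_sum] using hswap y.1 y.2
    obtain ⟨z₀, hz₀⟩ : ∃ z : Fin (M + M) → V, 0 < ∏ i, μ (z i) := by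
      by_contra! hle
      have h2 := sum_nonpos fun z (_ : z ∈ (univ : Finset (Fin (M + M) → V))) => hle z
      rw [sum_prod_eq_pow] at h2
      exact absurd (pow_pos hμ0 (M + M)) (not_lt.2 h2)
    have h3 := sum_lt_sum (fun z (_ : z ∈ (univ : Finset (Fin (M + M) → V))) =>
      mul_le_mul_of_nonneg_left (hlt z).le (prod_nonneg fun i _ => hμ (z i)))
      ⟨z₀, mem_univ _, mul_lt_mul_of_pos_left (hlt z₀) hz₀⟩
    rw [← sum_mul, sum_prod_eq_pow] at h3
    have h4 := h1.trans_lt (mul_lt_mul_of_pos_left h3 (pow_pos hμ0 2))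
    simp only [sum_const, card_univ, Fintype.card_prod, Fintype.card_fin, nsmul_eq_mul] at h4
    refine absurd h4 (not_lt.2 (le_of_eq ?_))
    push_cast
    ring
  have hq : ∀ a b, ∃ c, good (e₀ (X z a b)) (z (Fin.castAdd M a)) (z (Fin.natAdd M b)) →
      A.Attached (A.mem (e₀ (X z a b)) c) (z (Fin.castAdd M a)) ∧
      A.Attached (A.mem (e₀ (X z a b)) c) (z (Fin.natAdd M b)) ∧
      A.cls (z (Fin.castAdd M a)) = A.cls (z (Fin.natAdd M b)) := by
    intro a b
    by_cases h : good (e₀ (X z a b)) (z (Fin.castAdd M a)) (z (Fin.natAdd M b))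
    · obtain ⟨c, hc⟩ := h
      exact ⟨c, fun _ => hc⟩
    · exact ⟨0, fun h' => absurd h' h⟩
  choose c hc using hq
  let P := univ.filter fun y : Fin M × Fin M =>
    good (e₀ (X z y.1 y.2)) (z (Fin.castAdd M y.1)) (z (Fin.natAdd M y.2))
  have hP : ((t * t * ((4 * r + 9) * (M + M)) : ℕ) : ℝ) < P.card := by
    have h1 : (M : ℝ) ^ 2 * ε ^ 2 ≤ P.card := by rwa [sum_boole] at hz
    refine lt_of_lt_of_le ?_ h1
    have h2 : ε = 1 / (24 * t * (k + 1)) := by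
      rw [hε]; field_simp; norm_num
    have h3 : (2 * t ^ 2 * (4 * r + 9) * (24 * t * (k + 1)) ^ 2 : ℝ) < M := by exact_mod_cast hM
    have hM0 : (0 : ℝ) < M := lt_of_le_of_lt (by positivity) h3
    have h4 : (M : ℝ) ^ 2 * ε ^ 2 = M * M / (24 * t * (k + 1)) ^ 2 := by
      rw [h2]; field_simp
    rw [h4, lt_div_iff₀ (by positivity)]
    calc _ = (2 * t ^ 2 * (4 * r + 9) * (24 * t * (k + 1)) ^ 2 : ℝ) * M := by push_cast; ring
      _ < _ := by gcongr
  let q : Fin M × Fin M → V := fun y => A.mem (e₀ (X z y.1 y.2)) (c y.1 y.2)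
  obtain ⟨⟨α, γ⟩, -, hfib⟩ := exists_lt_card_fiber_of_mul_lt_card_of_maps_to
    (s := P) (t := univ) (f := fun y => (A.cls (q y), A.cls (z (Fin.castAdd M y.1))))
    (n := (4 * r + 9) * (M + M)) (fun _ _ => mem_univ _) (by
      rw [card_univ, Fintype.card_prod, ← ht]
      exact_mod_cast hP)
  let φ : Fin M × Fin M → Fin (M + M) × Fin (M + M) := fun y =>
    (Fin.castAdd M y.1, Fin.natAdd M y.2)
  have hφ : Function.Injective φ := by
    rintro ⟨a, b⟩ ⟨a', b'⟩ h
    simpa [φ] using h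
  set F := P.filter fun y => (A.cls (q y), A.cls (z (Fin.castAdd M y.1))) = (α, γ) with hF
  -- The value off the image of `φ` is irrelevant, as only pairs in that image are used as edges.
  let mid : Fin (M + M) → Fin (M + M) → V := fun i j =>
    Function.extend φ q (fun x => z x.1) (i, j)
  have key : ∀ x ∈ F.image φ, x.1 < x.2 ∧ A.Attached (mid x.1 x.2) (z x.1) ∧
      A.Attached (mid x.1 x.2) (z x.2) ∧ A.cls (mid x.1 x.2) = α ∧ A.cls (z x.1) = γ ∧
      A.cls (z x.2) = γ ∧
      ∀ i, i ≠ x.1 → i ≠ x.2 → A.cls (z i) = γ → ¬ A.graph.Adj (mid x.1 x.2) (z i) := by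
    intro x hx
    obtain ⟨y, hy, rfl⟩ := mem_image.1 hx
    obtain ⟨hyP, hy2⟩ := mem_filter.1 hy
    obtain ⟨h1, h2, h3⟩ := hc _ _ (mem_filter.1 hyP).2
    simp only [Prod.mk.injEq] at hy2
    have hmid : mid (φ y).1 (φ y).2 = q y := hφ.extend_apply q _ y
    rw [hmid]
    refine ⟨?_, h1, h2, hy2.1, hy2.2, h3.symm.trans hy2.2, fun i hi1 hi2 hi hadj => ?_⟩
    · rw [Fin.lt_def]
      simp only [φ, Fin.val_castAdd, Fin.val_natAdd]
      omega
    -- The midpoint belongs to a hyperedge missed by all other sample points, and an adjacency to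
    -- one of them in the same class would count as a hit.
    · refine he₀ z y.1 y.2 (z i) (mem_image_of_mem z ?_) ⟨_, h1.of_cls rfl (hi.trans hy2.2.symm) hadj⟩
      exact mem_filter.2 ⟨mem_univ _, hi1, hi2⟩
  refine hG (pathSixAddPathThree_isIndContained_of_subdivision z z mid (F.image φ)
    (fun x hx => (key x hx).1) (fun x hx => (key x hx).2.1.1) (fun x hx => (key x hx).2.2.1.1)
    (fun x hx y hy h1 h2 => (key x hx).2.2.2.2.2.2 _ h1 h2 (key y hy).2.2.2.2.1)
    (fun x hx y hy h1 h2 => (key x hx).2.2.2.2.2.2 _ h1 h2 (key y hy).2.2.2.2.2.1)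
    (fun x hx y hy _ => hA.points _ _ _ _ (key x hx).2.1 (key y hy).2.1
      ((key x hx).2.2.2.2.1.trans (key y hy).2.2.2.2.1.symm))
    (fun x hx y hy _ => hA.points _ _ _ _ (key x hx).2.2.1 (key y hy).2.2.1
      ((key x hx).2.2.2.2.2.1.trans (key y hy).2.2.2.2.2.1.symm))
    (fun x hx y hy _ => hA.points _ _ _ _ (key x hx).2.1 (key y hy).2.2.1
      ((key x hx).2.2.2.2.1.trans (key y hy).2.2.2.2.2.1.symm))
    (fun x hx y hy => hA.centers _ _ _ _ (key x hx).2.1 (key y hy).2.1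
      ((key x hx).2.2.2.2.1.trans (key y hy).2.2.2.2.1.symm)
      ((key x hx).2.2.2.1.trans (key y hy).2.2.2.1.symm)) ?_)
  rw [card_image_of_injective _ hφ]
  exact hfib

/-- In a `(P₆ + rP₃)`-free graph, either a bounded number of points hits every hyperedge or there
are `ν` disjoint hyperedges. -/
theorem exists_hitting_set [Fintype V] [Fintype ι] [Fintype τ] {A : HittingSystem V ι τ} {r ν : ℕ}
    (hG : IsInducedFree (pathSixAddPathThree r) A.graph) (hA : A.IsAdmissible) (hν : 0 < ν)
    (hdisj : ¬ A.HasDisjoint ν) :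
    ∃ X : Finset V, X.card ≤ 2 * netBound (Fintype.card τ) r ν ∧ ∀ e, ∃ u ∈ X, A.Hit e u := by
  classical
  rcases isEmpty_or_nonempty ι with hι | hι
  · exact ⟨∅, by simp, fun e => hι.elim e⟩
  set k := tupleBound (Fintype.card τ) r ν with hk
  obtain ⟨μ, hμ, hμ0, hhit⟩ := exists_weights_of_forall_weights A.Hit
    (ε := 1 / ((k : ℝ) ^ 3 + 1)) (by positivity)
    (fun w hw => by
      obtain ⟨u, hu⟩ := exists_heavy_point hG hA hν hdisj w hw
      exact ⟨u, by convert hu⟩)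
  refine exists_net hG hA hμ hμ0 (k := k ^ 3) (fun e => ?_) (Nat.lt_succ_self _)
  push_cast
  convert hhit e

end HittingSystem

/-! ## Moves -/

namespace SeededTriple

variable {V : Type}

open Classical in
/-- Remove from each list the colors that are forced on some neighbour. -/
noncomputable def propagate (R : SeededTriple V) : SeededTriple V where
  graph := R.graph
  list v := (R.list v).filter fun i => ¬ ∃ u, R.graph.Adj v u ∧ R.list u = {i}
  seed := R.seed

/-- Exhaustive propagation. -/
noncomputable def update [Fintype V] (R : SeededTriple V) : SeededTriple V :=
  propagate^[3 * Fintype.card V] R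

open Classical in
/-- Put a vertex into the seed, with a given color. -/
noncomputable def addSeed (R : SeededTriple V) (v : V) (j : Fin 3) : SeededTriple V where
  graph := R.graph
  list u := if u = v ∧ j ∈ R.list u then {j} else R.list u
  seed := insert v R.seed

open Classical in
/-- Give a color to all common neighbours of four vertices that may have it. -/
noncomputable def fixCommon (R : SeededTriple V) (q : Fin 4 → V) (j : Fin 3) : SeededTriple V where
  graph := R.graph
  list u := if (∀ i, R.graph.Adj u (q i)) ∧ j ∈ R.list u then {j} else R.list u
  seed := R.seed

/-- One move, with an exhaustive propagation. -/
def Step [Fintype V] (R R' : SeededTriple V) : Prop :=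
  (∃ v j, R' = (R.addSeed v j).update) ∨ ∃ q j, R' = (R.fixCommon q j).update

/-- `m` moves. -/
def Reach [Fintype V] : ℕ → SeededTriple V → SeededTriple V → Prop
  | 0, R, R' => R' = R
  | m + 1, R, R' => ∃ R₁, Reach m R R₁ ∧ Step R₁ R'

/-- The graph is the same, the lists shrink, and the seed grows. -/
structure Refines (R R' : SeededTriple V) : Prop where
  graph : R'.graph = R.graph
  list : ∀ v, R'.list v ⊆ R.list v
  seed : R.seed ⊆ R'.seed

theorem Refines.refl (R : SeededTriple V) : R.Refines R :=
  ⟨rfl, fun _ => Subset.rfl, Subset.rfl⟩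

theorem Refines.trans {R R' R'' : SeededTriple V} (h : R.Refines R') (h' : R'.Refines R'') :
    R.Refines R'' :=
  ⟨h'.graph.trans h.graph, fun v => (h'.list v).trans (h.list v), h.seed.trans h'.seed⟩

theorem mem_propagate_list {R : SeededTriple V} {v : V} {i : Fin 3} :
    i ∈ R.propagate.list v ↔ i ∈ R.list v ∧ ¬ ∃ u, R.graph.Adj v u ∧ R.list u = {i} := by
  classical
  exact mem_filter

open Classical in
theorem propagate_refines (R : SeededTriple V) : R.Refines R.propagate :=
  ⟨rfl, fun _ => filter_subset _ _, Subset.rfl⟩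

theorem propagate_iterate_refines (R : SeededTriple V) (k : ℕ) : R.Refines (propagate^[k] R) := by
  induction k with
  | zero => exact Refines.refl R
  | succ k ih =>
    rw [Function.iterate_succ_apply']
    exact ih.trans (propagate_refines _)

theorem propagate_iterate_seed (R : SeededTriple V) (k : ℕ) :
    (propagate^[k] R).seed = R.seed := by
  induction k with
  | zero => rfl
  | succ k ih => rw [Function.iterate_succ_apply']; exact ih

theorem addSeed_refines (R : SeededTriple V) (v : V) (j : Fin 3) : R.Refines (R.addSeed v j) := by
  classical
  refine ⟨rfl, fun u => ?_, ?_⟩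
  · simp only [addSeed]
    split_ifs with h
    · simpa using h.2
    · exact Subset.rfl
  · intro u hu
    simp only [addSeed, mem_insert]
    exact Or.inr hu

theorem fixCommon_refines (R : SeededTriple V) (q : Fin 4 → V) (j : Fin 3) :
    R.Refines (R.fixCommon q j) := by
  classical
  refine ⟨rfl, fun u => ?_, Subset.rfl⟩
  simp only [fixCommon]
  split_ifs with h
  · simpa using h.2
  · exact Subset.rfl

theorem ext_list {R R' : SeededTriple V} (hg : R.graph = R'.graph) (hl : ∀ v, R.list v = R'.list v)
    (hs : R.seed = R'.seed) : R = R' := by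
  cases R; cases R'
  simp only [mk.injEq]
  exact ⟨hg, funext hl, hs⟩

open Classical in
theorem isUpdated_of_propagate_eq {R : SeededTriple V} (h : R.propagate = R) : R.IsUpdated := by
  intro u v hadj hu hsub
  obtain ⟨i, hi⟩ := card_eq_one.1 hu
  have h1 : i ∈ R.propagate.list v := by
    rw [h]; exact hsub (by rw [hi]; exact mem_singleton_self i)
  exact (mem_filter.1 h1).2 ⟨u, hadj.symm, hi⟩

open Classical in
theorem IsUpdated.propagate_eq {R : SeededTriple V} (h : R.IsUpdated) : R.propagate = R := by
  refine ext_list rfl (fun v => ?_) rfl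
  refine filter_true_of_mem ?_
  rintro i hi ⟨u, hadj, hu⟩
  refine h u v hadj.symm ?_ (by rw [hu]; simpa using hi)
  simp [fixed, hu]

theorem update_refines [Fintype V] (R : SeededTriple V) : R.Refines R.update :=
  propagate_iterate_refines R _

theorem update_seed [Fintype V] (R : SeededTriple V) : R.update.seed = R.seed :=
  propagate_iterate_seed R _

theorem IsUpdated.update_eq [Fintype V] {R : SeededTriple V} (h : R.IsUpdated) : R.update = R :=
  Function.iterate_fixed h.propagate_eq _

/-- A round that changes anything deletes a color from some list, and there are at most 3|V| colors
to delete. If all are deleted, no list is a singleton and there is nothing left to propagate. -/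
theorem update_isUpdated [Fintype V] (R : SeededTriple V) : R.update.IsUpdated := by
  have hle : ∀ R : SeededTriple V, ∑ v, (R.list v).card ≤ 3 * Fintype.card V := by
    intro R
    refine (sum_le_card_nsmul univ _ 3 fun v _ => ?_).trans (by simp [mul_comm])
    exact (card_le_univ _).trans (by simp)
  have hlt : ∀ R : SeededTriple V, ¬ R.IsUpdated →
      ∑ v, (R.propagate.list v).card + 1 ≤ ∑ v, (R.list v).card := by
    intro R hR
    refine Nat.succ_le_of_lt (sum_lt_sum (fun v _ =>
      card_le_card ((propagate_refines R).list v)) ?_)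
    by_contra! hcon
    refine hR (isUpdated_of_propagate_eq (ext_list rfl (fun v => ?_) rfl))
    exact eq_of_subset_of_card_le ((propagate_refines R).list v) (hcon v (mem_univ v))
  have key : ∀ k, (propagate^[k] R).IsUpdated ∨
      ∑ v, ((propagate^[k] R).list v).card + k ≤ 3 * Fintype.card V := by
    intro k
    induction k with
    | zero => exact Or.inr (hle R)
    | succ k ih =>
      rw [Function.iterate_succ_apply']
      rcases ih with h | h
      · left; rwa [h.propagate_eq]
      · by_cases hu : (propagate^[k] R).IsUpdated
        · left; rwa [hu.propagate_eq]
        · right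
          have := hlt _ hu
          omega
  rcases key (3 * Fintype.card V) with h | h
  · exact h
  · have h0 : ∑ v, ((propagate^[3 * Fintype.card V] R).list v).card = 0 := by omega
    rw [sum_eq_zero_iff] at h0
    intro u v _ hu _
    have h1 := h0 u (mem_univ u)
    have h2 : ((propagate^[3 * Fintype.card V] R).list u).card = 1 := hu
    omega

theorem Step.refines [Fintype V] {R R' : SeededTriple V} (h : Step R R') : R.Refines R' := by
  rcases h with ⟨v, j, rfl⟩ | ⟨q, j, rfl⟩
  · exact (addSeed_refines _ _ _).trans (update_refines _)
  · exact (fixCommon_refines _ _ _).trans (update_refines _)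

open Classical in
theorem Step.card_seed_le [Fintype V] {R R' : SeededTriple V} (h : Step R R') :
    R'.seed.card ≤ R.seed.card + 1 := by
  rcases h with ⟨v, j, rfl⟩ | ⟨q, j, rfl⟩
  · rw [update_seed]
    simp only [addSeed]
    exact card_insert_le _ _
  · rw [update_seed]
    simp [fixCommon]

theorem Reach.refines [Fintype V] {m : ℕ} {R R' : SeededTriple V} (h : Reach m R R') : R.Refines R' := by
  induction m generalizing R' with
  | zero => rw [show R' = R from h]; exact Refines.refl R
  | succ m ih =>
    obtain ⟨R₁, h₁, h₂⟩ := h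
    exact (ih h₁).trans h₂.refines

theorem Reach.card_seed_le [Fintype V] {m : ℕ} {R R' : SeededTriple V} (h : Reach m R R') :
    R'.seed.card ≤ R.seed.card + m := by
  induction m generalizing R' with
  | zero => rw [show R' = R from h]; simp
  | succ m ih =>
    obtain ⟨R₁, h₁, h₂⟩ := h
    have := ih h₁
    have := h₂.card_seed_le
    omega

theorem Reach.trans [Fintype V] {m m' : ℕ} {R R' R'' : SeededTriple V} (h : Reach m R R')
    (h' : Reach m' R' R'') : Reach (m + m') R R'' := by
  induction m' generalizing R'' with
  | zero => rw [show R'' = R' from h']; exact h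
  | succ m' ih =>
    obtain ⟨R₁, h₁, h₂⟩ := h'
    exact ⟨R₁, ih h₁, h₂⟩

theorem Refines.isExtension {R R' : SeededTriple V} (h : R.Refines R') {c : V → Fin 3}
    (hc : R'.IsExtension c) : R.IsExtension c :=
  ⟨fun v => h.list v (hc.1 v), fun u v huv => hc.2 u v (by rw [h.graph]; exact huv)⟩

theorem IsExtension.propagate {R : SeededTriple V} {c : V → Fin 3} (hc : R.IsExtension c) :
    R.propagate.IsExtension c := by
  refine ⟨fun v => mem_propagate_list.2 ⟨hc.1 v, ?_⟩, hc.2⟩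
  rintro ⟨u, hadj, hu⟩
  have := hc.1 u
  rw [hu, mem_singleton] at this
  exact hc.2 v u hadj this.symm

theorem IsExtension.update [Fintype V] {R : SeededTriple V} {c : V → Fin 3} (hc : R.IsExtension c) :
    R.update.IsExtension c := by
  unfold SeededTriple.update
  generalize 3 * Fintype.card V = k
  induction k with
  | zero => exact hc
  | succ k ih => rw [Function.iterate_succ_apply']; exact ih.propagate

/-! ## Stages -/

/-- An updated triple that is compatible with the coloring `c`. -/
structure IsStage (G : SimpleGraph V) (c : V → Fin 3) (R : SeededTriple V) : Prop where
  graph : R.graph = G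
  updated : R.IsUpdated
  extension : R.IsExtension c
  seed : ∀ v ∈ R.seed, R.list v = {c v}

variable {G : SimpleGraph V} {c : V → Fin 3} {R R' : SeededTriple V}

theorem Refines.list_eq_singleton {R R' : SeededTriple V} (h : R.Refines R')
    (hc : R'.IsExtension c) {v : V} (hv : R.list v = {c v}) : R'.list v = {c v} := by
  refine (subset_singleton_iff.1 (hv ▸ h.list v)).resolve_left fun h0 => ?_
  have := hc.1 v
  rw [h0] at this
  exact absurd this (notMem_empty _)

theorem isStage_addSeed [Fintype V] (hg : R.graph = G) (hc : R.IsExtension c)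
    (hs : ∀ v ∈ R.seed, R.list v = {c v}) (v : V) : (R.addSeed v (c v)).update.IsStage G c := by
  classical
  have h1 : (R.addSeed v (c v)).IsExtension c := by
    refine ⟨fun u => ?_, hc.2⟩
    simp only [addSeed]
    split_ifs with h
    · rw [h.1]; exact mem_singleton_self _
    · exact hc.1 u
  refine ⟨(update_refines _).graph.trans hg, update_isUpdated _, h1.update, fun u hu => ?_⟩
  rw [update_seed] at hu
  refine Refines.list_eq_singleton (update_refines _) h1.update ?_
  simp only [addSeed, mem_insert] at hu ⊢
  by_cases h : u = v
  · rw [h, if_pos ⟨rfl, hc.1 v⟩]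
  · rw [if_neg fun h' => h h'.1]
    exact hs u (hu.resolve_left h)

theorem IsStage.exists_addSeeds [Fintype V] (hR : R.IsStage G c) (X : Finset V) :
    ∃ R', Reach X.card R R' ∧ R'.IsStage G c ∧ R.seed ⊆ R'.seed ∧ X ⊆ R'.seed := by
  classical
  induction X using Finset.induction with
  | empty => exact ⟨R, rfl, hR, Subset.rfl, empty_subset _⟩
  | insert v X hv ih =>
    obtain ⟨R', h1, h2, h3, h4⟩ := ih
    refine ⟨(R'.addSeed v (c v)).update, ?_, isStage_addSeed h2.graph h2.extension h2.seed v, ?_, ?_⟩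
    · rw [card_insert_of_notMem hv]
      exact ⟨R', h1, Or.inl ⟨v, _, rfl⟩⟩
    · rw [update_seed]
      exact h3.trans (addSeed_refines _ _ _).seed
    · rw [update_seed]
      refine insert_subset ?_ (h4.trans (addSeed_refines _ _ _).seed)
      simp [addSeed]

/-- Adding a seed vertex again changes nothing. This pads a short sequence of moves to the common
length. -/
theorem IsStage.reach_self [Fintype V] (hR : R.IsStage G c) {s : V} (hs : s ∈ R.seed) (k : ℕ) :
    Reach k R R := by
  classical
  induction k with
  | zero => rfl
  | succ k ih =>
    refine ⟨R, ih, Or.inl ⟨s, c s, ?_⟩⟩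
    have h : R.addSeed s (c s) = R := by
      refine ext_list rfl (fun v => ?_) ?_
      · simp only [addSeed]
        split_ifs with h
        · rw [h.1, hR.seed s hs]
        · rfl
      · simp [addSeed, hs]
    rw [h, hR.updated.update_eq]

theorem IsStage.not_mem_list (hR : R.IsStage G c) {s v : V} (hs : s ∈ R.seed) (h : G.Adj v s) :
    c s ∉ R.list v := by
  intro hmem
  refine hR.updated s v (by rw [hR.graph]; exact h.symm) ?_ ?_
  · simp [fixed, hR.seed s hs]
  · rw [hR.seed s hs]; simpa using hmem

theorem IsStage.two_le_card (hR : R.IsStage G c) {v : V} (hv : v ∉ R.fixed) :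
    2 ≤ (R.list v).card := by
  have h1 : 0 < (R.list v).card := card_pos.2 ⟨_, hR.extension.1 v⟩
  have h2 : (R.list v).card ≠ 1 := hv
  omega

theorem IsStage.list_eq_compl (hR : R.IsStage G c) {s v : V} (hv : v ∉ R.fixed) (hs : s ∈ R.seed)
    (h : G.Adj v s) : R.list v = {c s}ᶜ := by
  refine eq_of_subset_of_card_le ?_ ?_
  · intro i hi
    rw [mem_compl, mem_singleton]
    rintro rfl
    exact hR.not_mem_list hs h hi
  · rw [card_compl, Fintype.card_fin, card_singleton]
    exact hR.two_le_card hv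

/-- Propagation has removed the color of the seed neighbour from the list of v, and an unfixed
vertex keeps at least two colors. So the list is exactly the complement, and the condition on lists
comes for free. -/
theorem IsStage.mem_boundary_iff (hR : R.IsStage G c) {v : V} :
    v ∈ R.boundary ↔ v ∉ R.fixed ∧ ∃ s ∈ R.seed, G.Adj v s := by
  constructor
  · rintro ⟨h1, s, hs, hadj, -⟩
    refine ⟨fun h => ?_, s, hs, by rw [← hR.graph]; exact hadj⟩
    have h2 : (R.list v).card = 1 := h
    omega
  · rintro ⟨h1, s, hs, hadj⟩
    have h2 := hR.list_eq_compl h1 hs hadj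
    refine ⟨?_, s, hs, by rw [hR.graph]; exact hadj, ?_⟩
    · rw [h2, card_compl, Fintype.card_fin, card_singleton]
    · rw [h2, compl_compl, hR.seed s hs]

theorem IsStage.mem_wilderness_iff (hR : R.IsStage G c) {v : V} :
    v ∈ R.wilderness ↔ v ∉ R.fixed ∧ ∀ s ∈ R.seed, ¬ G.Adj v s := by
  rw [wilderness, Set.mem_compl_iff, Set.mem_union, hR.mem_boundary_iff]
  constructor
  · intro h
    push Not at h
    exact ⟨h.1, h.2 h.1⟩
  · rintro ⟨h1, h2⟩ (h | ⟨-, s, hs, hadj⟩)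
    · exact h1 h
    · exact h2 s hs hadj

theorem IsStage.not_mem_fixed (hR' : R'.IsStage G c) (h : R.Refines R')
    {v : V} (hv : v ∉ R'.fixed) : v ∉ R.fixed := by
  intro hf
  have h1 := card_le_card (h.list v)
  have h2 := hR'.two_le_card hv
  have h3 : (R.list v).card = 1 := hf
  omega

theorem IsStage.wilderness_subset (hR : R.IsStage G c) (hR' : R'.IsStage G c) (h : R.Refines R') :
    R'.wilderness ⊆ R.wilderness := by
  intro v hv
  rw [hR'.mem_wilderness_iff] at hv
  exact hR.mem_wilderness_iff.2 ⟨hR'.not_mem_fixed h hv.1, fun s hs => hv.2 s (h.seed hs)⟩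

theorem IsStage.fixCommon [Fintype V] (hR : R.IsStage G c) {q : Fin 4 → V} {j : Fin 3}
    (hq : ∀ u, u ∉ R.fixed → (∀ i, G.Adj u (q i)) → c u = j) :
    (R.fixCommon q j).update.IsStage G c ∧
      ∀ u, u ∉ (R.fixCommon q j).update.fixed → ¬ ∀ i, G.Adj u (q i) := by
  classical
  have h1 : (R.fixCommon q j).IsExtension c := by
    refine ⟨fun u => ?_, hR.extension.2⟩
    simp only [SeededTriple.fixCommon]
    split_ifs with h
    · rw [mem_singleton]
      by_cases hu : u ∈ R.fixed
      · obtain ⟨i, hi⟩ := card_eq_one.1 hu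
        have h2 := hR.extension.1 u
        have h3 := h.2
        rw [hi, mem_singleton] at h2 h3
        rw [h2, h3]
      · rw [hR.graph] at h
        exact hq u hu h.1
    · exact hR.extension.1 u
  have href := (fixCommon_refines R q j).trans (update_refines _)
  have hst : (R.fixCommon q j).update.IsStage G c := by
    refine ⟨href.graph.trans hR.graph, update_isUpdated _, h1.update, fun u hu => ?_⟩
    rw [update_seed] at hu
    exact Refines.list_eq_singleton href h1.update (hR.seed u hu)
  refine ⟨hst, fun u hu hadj => hu ?_⟩
  have hu' := hst.not_mem_fixed href hu
  have hj := hq u hu' hadj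
  have h2 : (R.fixCommon q j).list u = {c u} := by
    simp only [SeededTriple.fixCommon]
    rw [if_pos ⟨by rw [hR.graph]; exact hadj, hj ▸ hR.extension.1 u⟩, hj]
  have h3 := Refines.list_eq_singleton (update_refines _) h1.update h2
  simp [fixed, h3]

/-- The quadruples are treated one at a time. The assumption persists because the set of unfixed
vertices only shrinks. -/
theorem IsStage.exists_fixCommons [Fintype V] (hR : R.IsStage G c) (X : Finset (Fin 4 → V))
    (hX : ∀ q ∈ X, ∀ u v, u ∉ R.fixed → v ∉ R.fixed → (∀ i, G.Adj u (q i)) →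
      (∀ i, G.Adj v (q i)) → c u = c v) :
    ∃ R', Reach X.card R R' ∧ R'.IsStage G c ∧ R'.seed = R.seed ∧
      ∀ q ∈ X, ∀ u, u ∉ R'.fixed → ¬ ∀ i, G.Adj u (q i) := by
  classical
  induction X using Finset.induction with
  | empty => exact ⟨R, rfl, hR, rfl, by simp⟩
  | insert q X hq ih =>
    obtain ⟨R', h1, h2, h3, h4⟩ := ih fun q hq => hX q (mem_insert_of_mem hq)
    have href := h1.refines
    obtain ⟨j, hj⟩ : ∃ j, ∀ u, u ∉ R'.fixed → (∀ i, G.Adj u (q i)) → c u = j := by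
      by_cases h : ∃ v, v ∉ R'.fixed ∧ ∀ i, G.Adj v (q i)
      · obtain ⟨v, hv, hvq⟩ := h
        exact ⟨c v, fun u hu huq => hX q (mem_insert_self _ _) u v (h2.not_mem_fixed href hu)
          (h2.not_mem_fixed href hv) huq hvq⟩
      -- No unfixed common neighbour is left, so any color will do.
      · exact ⟨0, fun u hu huq => absurd ⟨u, hu, huq⟩ h⟩
    obtain ⟨h5, h6⟩ := h2.fixCommon hj
    refine ⟨_, ?_, h5, (update_seed _).trans h3, ?_⟩
    · rw [card_insert_of_notMem hq]
      exact ⟨R', h1, Or.inr ⟨q, j, rfl⟩⟩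
    · intro q' hq' u hu
      rcases mem_insert.1 hq' with rfl | hq'
      · exact h6 u hu
      · exact h4 q' hq' u (h5.not_mem_fixed
          ((fixCommon_refines R' q j).trans (update_refines _)) hu)

end SeededTriple

/-- Hitting systems list their members by `Fin 6`; components with fewer vertices are listed with
repetitions. -/
theorem Finset.exists_enumeration {V : Type} (C : Finset V) (hne : C.Nonempty) {k : ℕ}
    (hk : C.card ≤ k) : ∃ f : Fin k → V, ∀ v, v ∈ C ↔ ∃ a, f a = v := by
  obtain ⟨v₀, hv₀⟩ := hne
  refine ⟨fun a => if h : a.val < C.card then (C.equivFin.symm ⟨a, h⟩ : V) else v₀, fun v => ?_⟩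
  constructor
  · intro hv
    refine ⟨⟨C.equivFin ⟨v, hv⟩, (C.equivFin ⟨v, hv⟩).2.trans_le hk⟩, ?_⟩
    simp
  · rintro ⟨a, rfl⟩
    dsimp only
    split_ifs with h
    · exact (C.equivFin.symm ⟨a, h⟩).2
    · exact hv₀

/-- The six vertices form an induced path, in this order. -/
def IsInducedPathSix {V : Type} (G : SimpleGraph V) (Q : Fin 6 → V) : Prop :=
  ∀ i j, G.Adj (Q i) (Q j) ↔ (SimpleGraph.pathGraph 6).Adj i j

/-! ### Components of the wilderness -/

namespace SeededTriple

variable {V : Type} {G : SimpleGraph V} {c : V → Fin 3} {R R' : SeededTriple V}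

/-- Every induced three-vertex path has a vertex with a neighbour in the seed. -/
def SeedMeetsPaths (G : SimpleGraph V) (R : SeededTriple V) : Prop :=
  ∀ f, IsInducedPathThree G f → ∃ i, ∃ s ∈ R.seed, G.Adj s (f i)

theorem SeedMeetsPaths.mono (h : SeedMeetsPaths G R) (hs : R.seed ⊆ R'.seed) :
    SeedMeetsPaths G R' := fun f hf => by
  obtain ⟨i, s, h1, h2⟩ := h f hf
  exact ⟨i, s, hs h1, h2⟩

theorem IsStage.proper (hR : R.IsStage G c) {u v : V} (h : G.Adj u v) : c u ≠ c v :=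
  hR.extension.2 u v (by rw [hR.graph]; exact h)

/-- Adjacency is transitive on the wilderness. -/
theorem IsStage.adj_of_adj_of_adj (hR : R.IsStage G c) (hW : SeedMeetsPaths G R) {v w x : V}
    (hv : v ∈ R.wilderness) (hw : w ∈ R.wilderness) (hx : x ∈ R.wilderness) (h : G.Adj v w)
    (h' : G.Adj w x) (hne : v ≠ x) : G.Adj v x := by
  by_contra hcon
  obtain ⟨i, s, hs, hadj⟩ := hW ![v, w, x] ⟨h, h', hcon, hne⟩
  have : ∀ i, (![v, w, x] : Fin 3 → V) i ∈ R.wilderness := by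
    intro i; fin_cases i
    · exact hv
    · exact hw
    · exact hx
  exact (hR.mem_wilderness_iff.1 (this i)).2 s hs hadj.symm

open Classical in
/-- The component of `w` in the wilderness. -/
noncomputable def wildComponent [Fintype V] (G : SimpleGraph V) (R : SeededTriple V) (w : V) :
    Finset V :=
  univ.filter fun v => v ∈ R.wilderness ∧ (v = w ∨ G.Adj v w)

theorem mem_wildComponent [Fintype V] {v w : V} :
    v ∈ R.wildComponent G w ↔ v ∈ R.wilderness ∧ (v = w ∨ G.Adj v w) := by
  simp [wildComponent]

theorem IsStage.wildComponent_eq_of_adj [Fintype V] (hR : R.IsStage G c) (hW : SeedMeetsPaths G R)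
    {v w : V} (hv : v ∈ R.wilderness) (hw : w ∈ R.wilderness) (h : G.Adj v w) :
    R.wildComponent G v = R.wildComponent G w := by
  have key : ∀ {v w : V}, v ∈ R.wilderness → w ∈ R.wilderness → G.Adj v w →
      R.wildComponent G v ⊆ R.wildComponent G w := by
    intro v w hv hw h x hx
    rw [mem_wildComponent] at hx ⊢
    refine ⟨hx.1, ?_⟩
    rcases hx.2 with rfl | hx2
    · exact Or.inr h
    · by_cases hxw : x = w
      · exact Or.inl hxw
      · exact Or.inr (hR.adj_of_adj_of_adj hW hx.1 hv hw hx2 h hxw)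
  exact (key hv hw h).antisymm (key hw hv h.symm)

theorem IsStage.wildComponent_eq [Fintype V] (hR : R.IsStage G c) (hW : SeedMeetsPaths G R)
    {v w : V} (hw : w ∈ R.wilderness) (h : v ∈ R.wildComponent G w) :
    R.wildComponent G w = R.wildComponent G v := by
  rw [mem_wildComponent] at h
  rcases h.2 with rfl | h2
  · rfl
  · exact (hR.wildComponent_eq_of_adj hW h.1 hw h2).symm

theorem IsStage.adj_of_mem_wildComponent [Fintype V] (hR : R.IsStage G c)
    (hW : SeedMeetsPaths G R) {v w x : V} (hw : w ∈ R.wilderness) (hv : v ∈ R.wildComponent G w)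
    (hx : x ∈ R.wildComponent G w) (hne : v ≠ x) : G.Adj v x := by
  rw [hR.wildComponent_eq hW hw hx, mem_wildComponent] at hv
  exact hv.2.resolve_left hne

theorem IsStage.card_wildComponent_le [Fintype V] (hR : R.IsStage G c) (hW : SeedMeetsPaths G R)
    {w : V} (hw : w ∈ R.wilderness) : (R.wildComponent G w).card ≤ 3 := by
  have h := card_le_card_of_injOn c (s := R.wildComponent G w) (t := univ)
    (fun _ _ => mem_coe.2 (mem_univ _)) (by
      intro v hv x hx hvx
      by_contra hne
      exact hR.proper (hR.adj_of_mem_wildComponent hW hw hv hx hne) hvx)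
  simpa using h

/-- The classes of vertices that are used for hitting sets. -/
abbrev VertexClass : Type := Fin 3 × Finset (Fin 3) × Prop × Prop

/-- The class of a vertex. -/
def vertexClass (c : V → Fin 3) (R : SeededTriple V) (P : Set V) (v : V) : VertexClass :=
  (c v, R.list v, v ∈ R.wilderness, v ∈ P)

theorem card_vertexClass : Fintype.card VertexClass = 96 := by
  simp [VertexClass]

/-- After a bounded number of moves, a vertex of `P` that is mixed on an edge of the wilderness
sees a component that has become smaller. -/
theorem IsStage.exists_shrink [Fintype V] (hR : R.IsStage G c) (hW : SeedMeetsPaths G R) {q : ℕ}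
    (hq : 0 < q) (hG : IsInducedFree (pathSixAddPathThree q) G) {Q : Fin 3 → Fin 6 → V}
    (hQ : ∀ t, IsInducedPathSix G (Q t)) (hQs : ∀ t i, Q t i ∈ R.seed) {P : Set V}
    (hP : ∀ u ∈ P, ∃ t, ∀ i, ¬ G.Adj u (Q t i)) (hPW : ∀ u ∈ P, u ∉ R.wilderness) :
    ∃ k R', k ≤ 2 * netBound 96 q (9 * q) ∧ Reach k R R' ∧ R'.IsStage G c ∧
      ∀ u ∈ P, ∀ w ∈ R'.wilderness, ∀ w' ∈ R'.wilderness, G.Adj w w' → G.Adj u w → ¬ G.Adj u w' →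
        ∃ x ∈ R.wilderness, x ∉ R'.wilderness ∧ G.Adj x w ∧ G.Adj x w' := by
  classical
  -- The hyperedges are the components on which some vertex of `P` is mixed; any vertex of `P` with
  -- a neighbour in the component hits it.
  let ι := {C : Finset V // ∃ w w' u, w ∈ R.wilderness ∧ w' ∈ R.wilderness ∧ u ∈ P ∧ G.Adj w w' ∧
    G.Adj u w ∧ ¬ G.Adj u w' ∧ C = R.wildComponent G w}
  have hιne : ∀ e : ι, e.1.Nonempty := by
    rintro ⟨C, w, w', u, hw, -, -, -, -, -, rfl⟩
    exact ⟨w, mem_wildComponent.2 ⟨hw, Or.inl rfl⟩⟩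
  have hιcard : ∀ e : ι, e.1.card ≤ 6 := by
    rintro ⟨C, w, w', u, hw, -, -, -, -, -, rfl⟩
    exact (hR.card_wildComponent_le hW hw).trans (by norm_num)
  have hιeq : ∀ (e : ι) v, v ∈ e.1 → v ∈ R.wilderness ∧ e.1 = R.wildComponent G v := by
    rintro ⟨C, w, w', u, hw, -, -, -, -, -, rfl⟩
    intro v hv
    exact ⟨(mem_wildComponent.1 hv).1, hR.wildComponent_eq hW hw hv⟩
  choose mem hmem using fun e : ι => e.1.exists_enumeration (hιne e) (hιcard e)
  let A : HittingSystem V ι VertexClass :=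
    { graph := G
      cls := vertexClass c R P
      rel := fun x y => x.2.2.1 ∧ y.2.2.2
      mem := mem }
  have hatt : ∀ v u, A.Attached v u ↔ G.Adj v u ∧ v ∈ R.wilderness ∧ u ∈ P := fun v u => Iff.rfl
  have hhit : ∀ e u, A.Hit e u ↔ u ∈ P ∧ ∃ v ∈ e.1, G.Adj v u := by
    intro e u
    constructor
    · rintro ⟨a, ha⟩
      exact ⟨ha.2.2, _, (hmem e _).2 ⟨a, rfl⟩, ha.1⟩
    · rintro ⟨hu, v, hv, hadj⟩
      obtain ⟨a, rfl⟩ := (hmem e v).1 hv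
      exact ⟨a, hadj, (hιeq e _ hv).1, hu⟩
  have hιne' : ∀ e e' : ι, e ≠ e' → ∀ v ∈ e.1, ∀ v' ∈ e'.1, ¬ G.Adj v v' := by
    intro e e' hne v hv v' hv' hadj
    obtain ⟨h1, h2⟩ := hιeq e v hv
    obtain ⟨h3, h4⟩ := hιeq e' v' hv'
    exact hne (Subtype.ext (h2.trans ((hR.wildComponent_eq_of_adj hW h1 h3 hadj).trans h4.symm)))
  have hcol : ∀ v v', A.cls v = A.cls v' → ¬ G.Adj v v' := fun v v' h hadj =>
    hR.proper hadj (congrArg Prod.fst h)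
  have hA : A.IsAdmissible :=
    { points := fun _ _ _ _ _ _ h => hcol _ _ h
      centers := fun _ _ _ _ _ _ _ h => hcol _ _ h
      members := fun e e' a b _ _ hne _ _ _ =>
        hιne' e e' hne _ ((hmem e _).2 ⟨a, rfl⟩) _ ((hmem e' _).2 ⟨b, rfl⟩)
      nonempty := by
        rintro ⟨C, w, w', u, hw, hw', hu, h1, h2, h3, rfl⟩
        exact ⟨u, (hhit _ _).2 ⟨hu, w, mem_wildComponent.2 ⟨hw, Or.inl rfl⟩, h2.symm⟩⟩ }
  have hdisj : ¬ A.HasDisjoint (9 * q) := by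
    rintro ⟨f, hf⟩
    have hspec : ∀ t, ∃ w w' u, w ∈ (f t).1 ∧ w' ∈ (f t).1 ∧ u ∈ P ∧ G.Adj w w' ∧ G.Adj u w ∧
        ¬ G.Adj u w' := by
      intro t
      obtain ⟨C, w, w', u, hw, hw', hu, h1, h2, h3, rfl⟩ := f t
      exact ⟨w, w', u, mem_wildComponent.2 ⟨hw, Or.inl rfl⟩, mem_wildComponent.2 ⟨hw', Or.inr h1.symm⟩,
        hu, h1, h2, h3⟩
    choose w w' u hw hw' hu h1 h2 h3 using hspec
    choose T hT using fun t => hP (u t) (hu t)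
    -- Here 9 = 3·3: three colors for the mixed vertex and three paths it may be anticomplete to.
    -- Equal colors make the q mixed vertices pairwise nonadjacent, and the common path supplies the
    -- P₆.
    obtain ⟨y, hy⟩ := Fintype.exists_le_card_fiber_of_mul_le_card
      (f := fun t : Fin (9 * q) => (c (u t), T t)) (n := q) (by simp)
    obtain ⟨g⟩ : Nonempty (Fin q ↪ {t // t ∈ univ.filter fun t : Fin (9 * q) => (c (u t), T t) = y}) := by
      rw [Function.Embedding.nonempty_iff_card_le, Fintype.card_fin, Fintype.card_coe]
      exact hy
    have hg : ∀ t, c (u (g t)) = y.1 ∧ T (g t) = y.2 := by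
      intro t
      have := (mem_filter.1 (g t).2).2
      exact ⟨congrArg Prod.fst this, congrArg Prod.snd this⟩
    have hhitu : ∀ t, A.Hit (f t) (u t) := fun t => (hhit _ _).2 ⟨hu t, w t, hw t, (h2 t).symm⟩
    have hgne : ∀ s t, s ≠ t → (g s : Fin (9 * q)) ≠ g t := fun s t hst h =>
      hst (g.injective (Subtype.ext h))
    have hsep : ∀ s t, s ≠ t → ∀ v ∈ (f t).1, ¬ G.Adj (u s) v := by
      intro s t hst v hv hadj
      exact hf s t hst (u s) ⟨hhitu s, (hhit _ _).2 ⟨hu s, v, hv, hadj.symm⟩⟩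
    have hsep' : ∀ s t, s ≠ t → ∀ v ∈ (f s).1, ∀ v' ∈ (f t).1, ¬ G.Adj v v' := by
      intro s t hst v hv v' hv'
      refine hιne' _ _ (fun heq => ?_) v hv v' hv'
      exact hf s t hst (u s) ⟨hhitu s, heq ▸ hhitu s⟩
    have hseed : ∀ t, ∀ v ∈ (f t).1, ∀ s i, ¬ G.Adj (Q s i) v := fun t v hv s i hadj =>
      (hR.mem_wilderness_iff.1 (hιeq _ v hv).1).2 _ (hQs s i) hadj.symm
    refine hG (pathSixAddPathThree_isIndContained (Q y.2) (fun t => ![u (g t), w (g t), w' (g t)])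
      (hQ _) ?_ ?_ ?_)
    · intro t
      refine ⟨h2 _, h1 _, h3 _, ?_⟩
      rintro (heq : u (g t) = w' (g t))
      exact hPW _ (hu (g t)) (heq ▸ (hιeq _ _ (hw' (g t))).1)
    · intro s t hst i j
      have hst' := hgne s t hst
      have k1 := hsep _ _ hst' _ (hw (g t))
      have k2 := hsep _ _ hst' _ (hw' (g t))
      have k3 : ¬ G.Adj (w (g s)) (u (g t)) := fun h => hsep _ _ hst'.symm _ (hw (g s)) (SimpleGraph.Adj.symm h)
      have k4 : ¬ G.Adj (w' (g s)) (u (g t)) := fun h => hsep _ _ hst'.symm _ (hw' (g s)) (SimpleGraph.Adj.symm h)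
      have k5 : ¬ G.Adj (u (g s)) (u (g t)) := fun h =>
        hR.proper h ((hg s).1.trans (hg t).1.symm)
      have k6 := hsep' _ _ hst' _ (hw (g s)) _ (hw (g t))
      have k7 := hsep' _ _ hst' _ (hw (g s)) _ (hw' (g t))
      have k8 := hsep' _ _ hst' _ (hw' (g s)) _ (hw (g t))
      have k9 := hsep' _ _ hst' _ (hw' (g s)) _ (hw' (g t))
      fin_cases i <;> fin_cases j
      · exact k5
      · exact k1
      · exact k2
      · exact k3
      · exact k6
      · exact k7
      · exact k4
      · exact k8
      · exact k9
    · intro i t j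
      have k1 := hT (g t)
      rw [(hg t).2] at k1
      fin_cases j
      · exact fun h => k1 i h.symm
      · exact hseed _ _ (hw (g t)) _ _
      · exact hseed _ _ (hw' (g t)) _ _
  obtain ⟨X, hX, hXhit⟩ := HittingSystem.exists_hitting_set (A := A) hG hA (by omega) hdisj
  rw [card_vertexClass] at hX
  obtain ⟨R', h1, h2, h3, h4⟩ := hR.exists_addSeeds X
  refine ⟨X.card, R', hX, h1, h2, ?_⟩
  intro u hu w hw w' hw' hadj huw huw'
  have hsub := hR.wilderness_subset h2 h1.refines
  obtain ⟨x, hx, hxhit⟩ := hXhit ⟨R.wildComponent G w, w, w', u, hsub hw, hsub hw', hu, hadj, huw,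
    huw', rfl⟩
  obtain ⟨-, v, hv, hvx⟩ := (hhit _ _).1 hxhit
  -- A vertex of the component next to the hitting set now has a seed neighbour. It differs from w
  -- and w', which are still wild, and is adjacent to both since the component is a clique.
  have hv' : v ∉ R'.wilderness := fun h => (h2.mem_wilderness_iff.1 h).2 x (h4 hx) hvx
  refine ⟨v, (hιeq _ v hv).1, hv', ?_, ?_⟩
  · refine hR.adj_of_mem_wildComponent hW (hsub hw) hv (mem_wildComponent.2 ⟨hsub hw, Or.inl rfl⟩) ?_
    rintro rfl
    exact hv' hw
  · refine hR.adj_of_mem_wildComponent hW (hsub hw) hv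
      (mem_wildComponent.2 ⟨hsub hw', Or.inr hadj.symm⟩) ?_
    rintro rfl
    exact hv' hw'

end SeededTriple

/-! ### Unfixed six-vertex paths and the two outcomes -/

namespace SeededTriple

variable {V : Type} {G : SimpleGraph V} {c : V → Fin 3} {R R' : SeededTriple V}

/-- An induced six-vertex path on vertices that are not fixed. -/
structure IsFreePathSix (G : SimpleGraph V) (R : SeededTriple V) (Q : Fin 6 → V) : Prop where
  path : IsInducedPathSix G Q
  free : ∀ i, Q i ∉ R.fixed

/-- If the boundary vertex `u` joins the seed, then `q` leaves the wilderness or becomes fixed. -/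
def Kills (G : SimpleGraph V) (c : V → Fin 3) (R : SeededTriple V) (q u : V) : Prop :=
  G.Adj q u ∧ u ∈ R.boundary ∧ c q ∉ R.list u ∧ (q ∈ R.wilderness ∨ c u ∈ R.list q)

/-- A boundary list misses exactly one color. This is what lets the list of a killing vertex
determine the color of the vertex it kills. -/
theorem IsStage.eq_of_not_mem_list (hR : R.IsStage G c) {u : V} (hu : u ∈ R.boundary)
    {i j : Fin 3} (hi : i ∉ R.list u) (hj : j ∉ R.list u) : i = j := by
  obtain ⟨h1, s, hs, hadj⟩ := hR.mem_boundary_iff.1 hu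
  rw [hR.list_eq_compl h1 hs hadj] at hi hj
  simp only [mem_compl, mem_singleton, not_not] at hi hj
  rw [hi, hj]

/-- Two differently colored vertices with common neighbours in the seed and on a free path:
one of them kills the vertex of the path. -/
theorem IsStage.kills_or_kills (hR : R.IsStage G c) {s q u v : V} (hs : s ∈ R.seed)
    (hq : q ∉ R.fixed) (hu : u ∉ R.fixed) (hv : v ∉ R.fixed) (hus : G.Adj u s) (hvs : G.Adj v s)
    (huq : G.Adj u q) (hvq : G.Adj v q) (hne : c u ≠ c v) : Kills G c R q u ∨ Kills G c R q v := by
  have hcu := hR.proper hus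
  have hcv := hR.proper hvs
  have hqu := hR.proper huq
  have hqv := hR.proper hvq
  -- Both q and s see the two different colors of u and v, so both have the third one. The list of q
  -- has a further color, which must be that of u or of v; that vertex kills q.
  have hqs : c q = c s := by
    generalize c q = a at *; generalize c s = b at *; generalize c u = d at *
    generalize c v = e at *
    omega
  have hul := hR.list_eq_compl hu hs hus
  have hvl := hR.list_eq_compl hv hs hvs
  have hub := hR.mem_boundary_iff.2 ⟨hu, s, hs, hus⟩
  have hvb := hR.mem_boundary_iff.2 ⟨hv, s, hs, hvs⟩
  by_cases h : c u ∈ R.list q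
  · exact Or.inl ⟨huq.symm, hub, by rw [hul, hqs]; simp, Or.inr h⟩
  · refine Or.inr ⟨hvq.symm, hvb, by rw [hvl, hqs]; simp, Or.inr ?_⟩
    by_contra h'
    have h1 : R.list q ⊆ {c q} := by
      intro i hi
      have h2 : i ≠ c u := by rintro rfl; exact h hi
      have h3 : i ≠ c v := by rintro rfl; exact h' hi
      rw [mem_singleton]
      generalize c q = a at *; generalize c s = b at *; generalize c u = d at *
      generalize c v = e at *
      omega
    have h2 := card_le_card h1
    have h3 := hR.two_le_card hq
    rw [card_singleton] at h2
    omega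

/-- A bound on the number of moves to a nice triple. -/
def niceBound (q m : ℕ) : ℕ := 18 + 216 * m + 4 * netBound 96 q (9 * q)

theorem IsStage.not_four_clique (hR : R.IsStage G c) {x y w z : V} (h1 : G.Adj x w)
    (h2 : G.Adj x z) (h3 : G.Adj y w) (h4 : G.Adj y z) (h5 : G.Adj w z) (h6 : G.Adj x y) : False := by
  have e1 := hR.proper h1
  have e2 := hR.proper h2
  have e3 := hR.proper h3
  have e4 := hR.proper h4
  have e5 := hR.proper h5
  have e6 := hR.proper h6
  clear hR
  omega

/-- On the common neighbours of a seed vertex and of one vertex on each of three free paths that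
are not killed simultaneously, the coloring is constant. -/
theorem IsStage.eq_of_common_neighbor (hR : R.IsStage G c) {Q : Fin 3 → Fin 6 → V}
    (hQ : ∀ t, IsFreePathSix G R (Q t))
    (hdisj : ∀ s t, s ≠ t → ∀ u, (∃ a, Kills G c R (Q s a) u) → ¬ ∃ a, Kills G c R (Q t a) u)
    {s u v : V} {a : Fin 3 → Fin 6} (hs : s ∈ R.seed) (hu : u ∉ R.fixed) (hv : v ∉ R.fixed)
    (hus : G.Adj u s) (hvs : G.Adj v s) (huq : ∀ t, G.Adj u (Q t (a t)))
    (hvq : ∀ t, G.Adj v (Q t (a t))) : c u = c v := by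
  by_contra hne
  -- Two vertices share the kills on three paths, so one of them kills on two paths, against
  -- `hdisj`.
  have key : ∀ t, (∃ a, Kills G c R (Q t a) u) ∨ ∃ a, Kills G c R (Q t a) v := fun t =>
    (hR.kills_or_kills hs ((hQ t).free _) hu hv hus hvs (huq t) (hvq t) hne).imp
      (fun h => ⟨_, h⟩) fun h => ⟨_, h⟩
  have d01 := hdisj 0 1 (by decide)
  have d02 := hdisj 0 2 (by decide)
  have d12 := hdisj 1 2 (by decide)
  rcases key 0 with h0 | h0
  · rcases key 1 with h1 | h1
    · exact d01 _ h0 h1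
    · rcases key 2 with h2 | h2
      · exact d02 _ h0 h2
      · exact d12 _ h1 h2
  · rcases key 1 with h1 | h1
    · rcases key 2 with h2 | h2
      · exact d12 _ h1 h2
      · exact d02 _ h0 h2
    · exact d01 _ h0 h1

-- The three paths join the seed, then the forced common neighbours are colored, and then the mixed
-- components are shrunk twice. Old boundary vertices are cured by the shrinking; boundary vertices
-- that come from the old wilderness are never mixed, because adjacency is transitive there.
set_option linter.constructorNameAsVariable false in
theorem IsStage.exists_isNice [Fintype V] (hR : R.IsStage G c) (hW : SeedMeetsPaths G R) {q : ℕ}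
    (hq : 0 < q) (hG : IsInducedFree (pathSixAddPathThree q) G) {Q : Fin 3 → Fin 6 → V}
    (hQ : ∀ t, IsFreePathSix G R (Q t))
    (hdisj : ∀ s t, s ≠ t → ∀ u, (∃ a, Kills G c R (Q s a) u) → ¬ ∃ a, Kills G c R (Q t a) u) :
    ∃ k R', k ≤ niceBound q R.seed.card ∧ Reach k R R' ∧ R'.IsStage G c ∧ R'.IsNice := by
  classical
  obtain ⟨R₁, hr₁, hR₁, hs₁, hX₁⟩ := hR.exists_addSeeds (univ.image fun x : Fin 3 × Fin 6 => Q x.1 x.2)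
  have hfree₁ := fun {v} => hR₁.not_mem_fixed hr₁.refines (v := v)
  let φ : V × Fin 6 × Fin 6 × Fin 6 → Fin 4 → V := fun x =>
    ![x.1, Q 0 x.2.1, Q 1 x.2.2.1, Q 2 x.2.2.2]
  obtain ⟨R₂, hr₂, hR₂, hs₂, hX₂⟩ := hR₁.exists_fixCommons
    ((R.seed ×ˢ (univ : Finset (Fin 6 × Fin 6 × Fin 6))).image φ) (by
      intro q hq u v hu hv huq hvq
      obtain ⟨⟨s, a, b, d⟩, hx, rfl⟩ := mem_image.1 hq
      have hs := (mem_product.1 hx).1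
      refine hR.eq_of_common_neighbor hQ hdisj (a := ![a, b, d]) (mem_product.1 hx).1 (hfree₁ hu)
        (hfree₁ hv) (huq 0) (hvq 0) (fun t => ?_) fun t => ?_
      · fin_cases t
        · exact huq 1
        · exact huq 2
        · exact huq 3
      · fin_cases t
        · exact hvq 1
        · exact hvq 2
        · exact hvq 3)
  have hr₁₂ := hr₁.trans hr₂
  have hfree₂ := fun {v} => hR₂.not_mem_fixed hr₁₂.refines (v := v)
  have hQs : ∀ t i, Q t i ∈ R₂.seed := fun t i => by
    rw [hs₂]; exact hX₁ (mem_image.2 ⟨(t, i), mem_univ _, rfl⟩)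
  -- A vertex of this set with a neighbour on each of the three paths would be one of the common
  -- neighbours that have just been fixed. So it is anticomplete to some path.
  let P : Set V := {u | u ∈ R.boundary ∧ u ∉ R₂.fixed}
  have hP : ∀ u ∈ P, ∃ t, ∀ i, ¬ G.Adj u (Q t i) := by
    rintro u ⟨hu, hu2⟩
    by_contra hcon
    push Not at hcon
    choose a ha using hcon
    obtain ⟨-, s, hs, hadj⟩ := hR.mem_boundary_iff.1 hu
    refine hX₂ (φ (s, a 0, a 1, a 2)) (mem_image_of_mem _ (mem_product.2 ⟨hs, mem_univ _⟩)) u hu2 ?_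
    intro i
    fin_cases i
    · exact hadj
    · exact ha 0
    · exact ha 1
    · exact ha 2
  have hPW : ∀ u ∈ P, u ∉ R₂.wilderness := by
    rintro u ⟨hu, hu2⟩ hw
    obtain ⟨-, s, hs, hadj⟩ := hR.mem_boundary_iff.1 hu
    exact (hR₂.mem_wilderness_iff.1 hw).2 s (hs₂ ▸ hs₁ hs) hadj
  have hW₂ : SeedMeetsPaths G R₂ := hW.mono (hs₂ ▸ hs₁)
  obtain ⟨k₃, R₃, hk₃, hr₃, hR₃, h₃⟩ :=
    hR₂.exists_shrink hW₂ hq hG (fun t => (hQ t).path) hQs hP hPW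
  have hsub₃ := hR₂.wilderness_subset hR₃ hr₃.refines
  obtain ⟨k₄, R₄, hk₄, hr₄, hR₄, h₄⟩ :=
    hR₃.exists_shrink (hW₂.mono hr₃.refines.seed) hq hG (fun t => (hQ t).path)
      (fun t i => hr₃.refines.seed (hQs t i)) hP (fun u hu h => hPW u hu (hsub₃ h))
  have hsub₄ := hR₃.wilderness_subset hR₄ hr₄.refines
  have hr := (hr₁₂.trans hr₃).trans hr₄
  have hsub := hR.wilderness_subset hR₄ hr.refines
  refine ⟨_, R₄, ?_, hr, hR₄, ?_⟩
  · have h1 : (univ.image fun x : Fin 3 × Fin 6 => Q x.1 x.2).card ≤ 18 := by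
      refine card_image_le.trans ?_
      simp
    have h2 : ((R.seed ×ˢ (univ : Finset (Fin 6 × Fin 6 × Fin 6))).image φ).card ≤
        216 * R.seed.card := by
      refine card_image_le.trans ?_
      rw [card_product]
      simp [mul_comm]
    unfold niceBound
    omega
  · have key : ∀ b ∈ R₄.boundary, ∀ w ∈ R₄.wilderness, ∀ w' ∈ R₄.wilderness, G.Adj w w' →
        G.Adj b w → b ≠ w' → G.Adj b w' := by
      intro b hb w hw w' hw' hww hbw hbne
      by_contra hbw'
      obtain ⟨hb4, -⟩ := hR₄.mem_boundary_iff.1 hb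
      have hb2 : b ∉ R₂.fixed := hR₄.not_mem_fixed (hr₃.trans hr₄).refines hb4
      by_cases hbb : b ∈ R.boundary
      -- Each round removed a vertex adjacent to both w and w'. The two removed vertices are
      -- different and lie in one old component, so the four vertices form a clique, which the
      -- coloring excludes.
      · obtain ⟨x, hx, hx4, hxw, hxw'⟩ := h₄ b ⟨hbb, hb2⟩ w hw w' hw' hww hbw hbw'
        obtain ⟨y, hy, hy3, hyw, hyw'⟩ := h₃ b ⟨hbb, hb2⟩ w (hsub₄ hw) w' (hsub₄ hw') hww hbw hbw'
        have hxy : x ≠ y := by rintro rfl; exact hy3 hx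
        have h0 := hR₂.adj_of_adj_of_adj hW₂ (hsub₃ hx) (hsub₃ (hsub₄ hw)) hy hxw hyw.symm hxy
        exact hR.not_four_clique hxw hxw' hyw hyw' hww h0
      · have hbW : b ∈ R.wilderness := fun h => h.elim (hfree₂ hb2) hbb
        exact hbw' (hR.adj_of_adj_of_adj hW hbW (hsub hw) (hsub hw') hbw hww hbne)
    intro b hb w hw w' hw' hww hmix
    rw [hR₄.graph] at hww hmix
    obtain ⟨hbne, ⟨x, hx, hbx⟩, y, hy, hby⟩ := hmix
    simp only [Set.mem_insert_iff, Set.mem_singleton_iff, not_or] at hbne hx hy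
    rcases hx with rfl | rfl <;> rcases hy with rfl | rfl
    · exact hby hbx
    · exact hby (key b hb _ hw _ hw' hww hbx hbne.2)
    · exact hby (key b hb _ hw' _ hw hww.symm hbx hbne.1)
    · exact hby hbx

open Classical in
/-- The number of vertices of the path in the wilderness. -/
noncomputable def wildCount (R : SeededTriple V) (Q : Fin 6 → V) : ℕ :=
  (univ.filter fun i => Q i ∈ R.wilderness).card

theorem IsStage.isEasy_of_forall (hR : R.IsStage G c) (h : ∀ Q, ¬ IsFreePathSix G R Q) :
    R.IsEasy := by
  rintro ⟨φ⟩
  refine h (fun i => (φ i : V)) ⟨fun i j => ?_, fun i => ?_⟩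
  · rw [← hR.graph]
    exact φ.map_rel_iff
  · rcases (φ i).2 with h | h
    · exact (hR.mem_boundary_iff.1 h).1
    · exact (hR.mem_wilderness_iff.1 h).1

/-- Either a bounded number of moves leads to a nice triple, or to one in which all free paths
have fewer vertices in the wilderness. -/
theorem IsStage.exists_isNice_or_wildCount_lt [Fintype V] (hR : R.IsStage G c)
    (hW : SeedMeetsPaths G R) {q : ℕ} (hq : 0 < q)
    (hG : IsInducedFree (pathSixAddPathThree q) G) :
    (∃ k R', k ≤ niceBound q R.seed.card ∧ Reach k R R' ∧ R'.IsStage G c ∧ R'.IsNice) ∨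
    ∃ k R', k ≤ 2 * netBound 96 q 3 ∧ Reach k R R' ∧ R'.IsStage G c ∧
      ∀ Q, IsFreePathSix G R' Q → R'.wildCount Q < R.wildCount Q := by
  classical
  -- A path that nothing kills serves as all three paths, as the disjointness is then vacuous.
  -- Excluding this case also makes every hyperedge hittable.
  by_cases h0 : ∃ Q, IsFreePathSix G R Q ∧ ¬ ∃ u a, Kills G c R (Q a) u
  · obtain ⟨Q, hQ, hQ0⟩ := h0
    exact Or.inl (hR.exists_isNice hW hq hG (Q := fun _ => Q) (fun _ => hQ)
      fun _ _ _ u h => absurd ⟨u, h⟩ hQ0)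
  push Not at h0
  let ι := {Q : Fin 6 → V // IsFreePathSix G R Q}
  let A : HittingSystem V ι VertexClass :=
    { graph := G
      cls := vertexClass c R R.boundary
      rel := fun x y => y.2.2.2 ∧ x.1 ∉ y.2.1 ∧ (x.2.2.1 ∨ y.1 ∈ x.2.1)
      mem := Subtype.val }
  have hatt : ∀ q u, A.Attached q u ↔ Kills G c R q u := fun _ _ => Iff.rfl
  by_cases hdisj : A.HasDisjoint 3
  · obtain ⟨f, hf⟩ := hdisj
    exact Or.inl (hR.exists_isNice hW hq hG (Q := fun t => (f t).1) (fun t => (f t).2)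
      fun s t hst u hs ht => hf s t hst u ⟨hs, ht⟩)
  have hcol : ∀ v v', A.cls v = A.cls v' → ¬ G.Adj v v' := fun v v' h hadj =>
    hR.proper hadj (congrArg Prod.fst h)
  have hA : A.IsAdmissible :=
    { points := fun _ _ _ _ _ _ h => hcol _ _ h
      centers := fun _ _ _ _ _ _ _ h => hcol _ _ h
      members := by
        intro e e' a b u u' _ h h' hcls hadj
        have h1 : c (e.1 a) ∉ R.list u := h.2.2.1
        have h2 : c (e'.1 b) ∉ R.list u' := h'.2.2.1
        have h3 : R.list u = R.list u' := congrArg (fun x : VertexClass => x.2.1) hcls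
        rw [← h3] at h2
        -- The two killers have the same list, so the two killed vertices have the one color missing
        -- from it and cannot be adjacent.
        exact hR.proper hadj (hR.eq_of_not_mem_list h.2.1 h1 h2)
      nonempty := fun e => h0 e.1 e.2 }
  obtain ⟨X, hX, hXhit⟩ := HittingSystem.exists_hitting_set (A := A) hG hA (by omega) hdisj
  rw [card_vertexClass] at hX
  obtain ⟨R', h1, h2, h3, h4⟩ := hR.exists_addSeeds X
  refine Or.inr ⟨X.card, R', hX, h1, h2, fun Q hQ => ?_⟩
  obtain ⟨u, hu, a, ha⟩ := hXhit ⟨Q, hQ.path, fun i => h2.not_mem_fixed h1.refines (hQ.free i)⟩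
  obtain ⟨hadj, hub, hqu, hor⟩ : Kills G c R (Q a) u := ha
  have hsub := hR.wilderness_subset h2 h1.refines
  refine card_lt_card ⟨fun i hi => ?_, fun hss => ?_⟩
  · rw [mem_filter] at hi ⊢
    exact ⟨mem_univ _, hsub hi.2⟩
  have hout : Q a ∉ R'.wilderness := fun h => (h2.mem_wilderness_iff.1 h).2 u (h4 hu) hadj
  have hin : Q a ∉ R.wilderness := fun h =>
    hout (mem_filter.1 (hss (mem_filter.2 ⟨mem_univ _, h⟩))).2
  have hmem := hor.resolve_left hin
  have hb : Q a ∈ R.boundary := by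
    by_contra hb
    exact hin fun h => h.elim (h2.not_mem_fixed h1.refines (hQ.free a)) hb
  have hnot := h2.not_mem_list (h4 hu) hadj
  have hlt : (R'.list (Q a)).card < (R.list (Q a)).card :=
    card_lt_card ⟨h1.refines.list _, fun h => hnot (h hmem)⟩
  have := h2.two_le_card (hQ.free a)
  have := hb.1
  omega

/-- Induction on a strict bound m for the number of wild vertices on a free path; for m = 0 there is
no free path and the triple is easy. `M` bounds the seed throughout all rounds. -/
theorem IsStage.exists_isNice_or_isEasy [Fintype V] {q : ℕ} (hq : 0 < q)
    (hG : IsInducedFree (pathSixAddPathThree q) G) (m M : ℕ) {R : SeededTriple V}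
    (hR : R.IsStage G c) (hW : SeedMeetsPaths G R)
    (hm : ∀ Q, IsFreePathSix G R Q → R.wildCount Q < m)
    (hM : R.seed.card + m * (2 * netBound 96 q 3) ≤ M) :
    ∃ k R', k ≤ m * (2 * netBound 96 q 3) + niceBound q M ∧ Reach k R R' ∧ R'.IsStage G c ∧
      (R'.IsNice ∨ R'.IsEasy) := by
  induction m generalizing R with
  | zero =>
    exact ⟨0, R, Nat.zero_le _, rfl, hR,
      Or.inr (hR.isEasy_of_forall fun Q hQ => absurd (hm Q hQ) (Nat.not_lt_zero _))⟩
  | succ m ih =>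
    rcases hR.exists_isNice_or_wildCount_lt hW hq hG with ⟨k, R', h1, h2, h3, h4⟩ |
      ⟨k, R', h1, h2, h3, h4⟩
    · refine ⟨k, R', ?_, h2, h3, Or.inl h4⟩
      have : niceBound q R.seed.card ≤ niceBound q M := by
        unfold niceBound
        have : R.seed.card ≤ M := (Nat.le_add_right _ _).trans hM
        omega
      exact h1.trans (this.trans (Nat.le_add_left _ _))
    · rw [Nat.succ_mul] at hM ⊢
      have hseed := h2.card_seed_le
      obtain ⟨k', R'', h5, h6, h7, h8⟩ := ih h3 (hW.mono h2.refines.seed)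
        (fun Q hQ => by
          have h9 := h4 Q hQ
          have h10 := hm Q ⟨hQ.path, fun i => h3.not_mem_fixed h2.refines (hQ.free i)⟩
          omega)
        (by omega)
      exact ⟨k + k', R'', by omega, h2.trans h6, h7, h8⟩

/-- The number of moves that suffice, in terms of the size of the seed. -/
def moveBound (s : ℕ) : ℕ :=
  1 + (7 * (2 * netBound 96 s 3) + niceBound s (s + 1 + 7 * (2 * netBound 96 s 3)))

theorem IsInducedFree.pathSixAddPathThree_mono {r r' : ℕ} (h : r ≤ r')
    (hG : IsInducedFree (pathSixAddPathThree r) G) : IsInducedFree (pathSixAddPathThree r') G := by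
  rintro ⟨φ⟩
  have hφ : ∀ x y, G.Adj (φ x) (φ y) ↔ (pathSixAddPathThree r').Adj x y := fun x y => φ.map_rel_iff
  refine hG (pathSixAddPathThree_isIndContained_of_forall (fun i => φ (Sum.inl i))
    (fun t i => φ (Sum.inr (Fin.castLE h t, i))) ?_ ?_ ?_ ?_ ?_)
  · intro i j
    rw [hφ]; simp [pathSixAddPathThree]
  · intro t i j
    rw [hφ]; simp [pathSixAddPathThree, SimpleGraph.boxProd_adj]
  · intro t t' htt i j
    rw [hφ]; simp [pathSixAddPathThree, SimpleGraph.boxProd_adj, htt]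
  · intro i t j
    rw [hφ]; simp [pathSixAddPathThree]
  · intro t h
    simpa using φ.injective h

theorem le_card_seed_of_isSeededPrecoloring {r : ℕ} {L' : V → Finset (Fin 3)}
    (h : R.IsSeededPrecoloring r L') : 6 + 3 * (r - 1) ≤ R.seed.card := by
  obtain ⟨φ⟩ := h.2.2.2
  have := Fintype.card_le_of_injective φ φ.injective
  simpa [mul_comm] using this

/-- A seeded precoloring with an extension can be turned into a nice or easy one, with the same
extension, by `moveBound` moves. -/
theorem exists_reach_moveBound [Fintype V] {P : SeededTriple V} {r : ℕ} (hr : 1 ≤ r)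
    {L' : V → Finset (Fin 3)} (hfree : IsInducedFree (pathSixAddPathThree r) P.graph)
    (hP : P.IsSeededPrecoloring r L') (hc : P.IsExtension c) :
    ∃ R', Reach (moveBound P.seed.card) P R' ∧ R'.IsStage P.graph c ∧
      (R'.IsNice ∨ R'.IsEasy) := by
  classical
  set s := P.seed.card with hs
  have hcard := le_card_seed_of_isSeededPrecoloring hP
  obtain ⟨v₀, hv₀⟩ : P.seed.Nonempty := card_pos.1 (by omega)
  have hlist : ∀ v ∈ P.seed, P.list v = {c v} := by
    intro v hv
    obtain ⟨i, hi⟩ := card_eq_one.1 (hP.1 v hv)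
    have := hc.1 v
    rw [hi, mem_singleton] at this
    rw [hi, this]
  -- `P` need not be updated. Adding a vertex that is already in the seed serves only to trigger the
  -- propagation.
  have hR := isStage_addSeed rfl hc hlist v₀
  set R := (P.addSeed v₀ (c v₀)).update with hRdef
  have hstep : Reach 1 P R := ⟨P, rfl, Or.inl ⟨_, _, rfl⟩⟩
  have hW : SeedMeetsPaths P.graph R := by
    intro f hf
    by_contra hcon
    push Not at hcon
    refine hfree ?_
    have := pathSixAddPathThree_succ_isIndContained hP.2.2.2 hf
      (fun i v hv => hcon i v (hstep.refines.seed hv))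
    rwa [Nat.sub_add_cancel hr] at this
  have hseed := hstep.card_seed_le
  -- The size of the seed replaces r, so that the number of moves can be computed from `P`. A path
  -- has at most six wild vertices, whence the bound 7.
  obtain ⟨k, R', h1, h2, h3, h4⟩ := IsStage.exists_isNice_or_isEasy (q := s) (by omega)
    (IsInducedFree.pathSixAddPathThree_mono (by omega) hfree) 7
    (s + 1 + 7 * (2 * netBound 96 s 3)) hR hW
    (fun Q _ => Nat.lt_succ_of_le ((card_filter_le _ _).trans (by simp))) (by omega)
  have hk : 1 + k ≤ moveBound s := by unfold moveBound; omega
  refine ⟨R', ?_, h3, h4⟩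
  have h5 := (hstep.trans h2).trans
    (h3.reach_self ((hstep.trans h2).refines.seed hv₀) (moveBound s - (1 + k)))
  rwa [Nat.add_sub_cancel' hk] at h5

end SeededTriple

end

/-! ## Programs -/

theorem Prog.OutputsWithin.mono {p : Prog} {x y : Data} {T T' : ℕ} (h : p.OutputsWithin x y T)
    (hT : T ≤ T') : p.OutputsWithin x y T' := by
  obtain ⟨t, h1, h2⟩ := h
  exact ⟨t, h1, h2.trans hT⟩

theorem Prog.OutputsWithin.pair {p q : Prog} {x a b : Data} {S T : ℕ} (h : p.OutputsWithin x a S)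
    (h' : q.OutputsWithin x b T) : (Prog.pair p q).OutputsWithin x (Data.cons a b) (S + T + 1) := by
  obtain ⟨t, h1, h2⟩ := h
  obtain ⟨t', h3, h4⟩ := h'
  exact ⟨_, Prog.Runs.pair h1 h3, by omega⟩

theorem Prog.OutputsWithin.comp {p q : Prog} {x y z : Data} {S T : ℕ} (h : q.OutputsWithin x y S)
    (h' : p.OutputsWithin y z T) : (Prog.comp p q).OutputsWithin x z (S + T + 1) := by
  obtain ⟨t, h1, h2⟩ := h
  obtain ⟨t', h3, h4⟩ := h'
  exact ⟨_, Prog.Runs.comp h1 h3, by omega⟩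

theorem Prog.OutputsWithin.fst (a b : Data) : Prog.fst.OutputsWithin (Data.cons a b) a 1 :=
  ⟨_, Prog.Runs.fst_cons a b, le_rfl⟩

theorem Prog.OutputsWithin.snd (a b : Data) : Prog.snd.OutputsWithin (Data.cons a b) b 1 :=
  ⟨_, Prog.Runs.snd_cons a b, le_rfl⟩

/-- A program that returns a constant. -/
def constProg : Data → Prog
  | Data.nil => Prog.nil
  | Data.cons a b => Prog.pair (constProg a) (constProg b)

theorem exists_outputsWithin_constProg (a : Data) : ∃ T, ∀ x, (constProg a).OutputsWithin x a T := by
  induction a with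
  | nil => exact ⟨1, fun x => ⟨1, Prog.Runs.nil x, le_rfl⟩⟩
  | cons a b iha ihb =>
    obtain ⟨S, hS⟩ := iha
    obtain ⟨T, hT⟩ := ihb
    exact ⟨S + T + 1, fun x => (hS x).pair (hT x)⟩

/-- The loop that hands the remaining list and the current value to `p`. -/
def listLoop (p : Prog) : Prog :=
  Prog.comp (Prog.comp Prog.snd Prog.snd) (Prog.loop (Prog.comp Prog.fst Prog.snd)
    (Prog.pair Prog.fst (Prog.pair (Prog.comp Prog.snd (Prog.comp Prog.fst Prog.snd)) p)))

/-- The state of the loop is the fixed input, the remaining tail and the current value; the summand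
15 pays for testing and rebuilding the state in each round. -/
theorem outputsWithin_listLoop {p : Prog} {x : Data} {l : List Data} {y : ℕ → Data} {T : ℕ}
    (h : ∀ k < l.length,
      p.OutputsWithin (Data.cons x (Data.cons (encList (l.drop k)) (y k))) (y (k + 1)) T) :
    (listLoop p).OutputsWithin (Data.cons x (Data.cons (encList l) (y 0))) (y l.length)
      (l.length * (T + 15) + 10) := by
  have key : ∀ m k, m + k = l.length →
      (Prog.loop (Prog.comp Prog.fst Prog.snd)
        (Prog.pair Prog.fst (Prog.pair (Prog.comp Prog.snd (Prog.comp Prog.fst Prog.snd)) p))).OutputsWithin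
        (Data.cons x (Data.cons (encList (l.drop k)) (y k)))
        (Data.cons x (Data.cons Data.nil (y l.length))) (m * (T + 15) + 4) := by
    intro m
    induction m with
    | zero =>
      intro k hk
      obtain rfl : k = l.length := by omega
      rw [List.drop_length]
      exact ⟨_, Prog.Runs.loop_done (Prog.Runs.comp (Prog.Runs.snd_cons _ _) (Prog.Runs.fst_cons _ _)),
        by omega⟩
    | succ m ih =>
      intro k hk
      have hkl : k < l.length := by omega
      obtain ⟨t, h1, h2⟩ := h k hkl
      obtain ⟨t', h3, h4⟩ := ih (k + 1) (by omega)
      rw [List.drop_eq_getElem_cons hkl] at h1 ⊢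
      refine ⟨_, Prog.Runs.loop_step
        (Prog.Runs.comp (Prog.Runs.snd_cons _ _) (Prog.Runs.fst_cons _ _))
        (Prog.Runs.pair (Prog.Runs.fst_cons _ _) (Prog.Runs.pair
          (Prog.Runs.comp (Prog.Runs.comp (Prog.Runs.snd_cons _ _) (Prog.Runs.fst_cons _ _))
            (Prog.Runs.snd_cons _ _)) h1)) h3, ?_⟩
      rw [Nat.succ_mul]
      omega
  obtain ⟨t, h1, h2⟩ := key l.length 0 rfl
  exact ⟨_, Prog.Runs.comp h1 (Prog.Runs.comp (Prog.Runs.snd_cons _ _) (Prog.Runs.snd_cons _ _)),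
    by omega⟩

/-! ## Bounds that are polynomial for each value of a parameter -/

/-- `T` is bounded by a power of `n`, with an exponent that depends on `s` only. -/
def XBound {ι : Type} (n s T : ι → ℕ) : Prop :=
  ∃ g : ℕ → ℕ, ∀ i, T i ≤ (n i + 2) ^ g (s i)

namespace XBound

variable {ι κ : Type} {n s S T : ι → ℕ}

theorem mono (hT : XBound n s T) (h : ∀ i, S i ≤ T i) : XBound n s S := by
  obtain ⟨g, hg⟩ := hT
  exact ⟨g, fun i => (h i).trans (hg i)⟩

/-- The base n + 2 is at least 2, so any function of the parameter can be moved into the exponent.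
-/
theorem param (f : ℕ → ℕ) : XBound n s fun i => f (s i) :=
  ⟨f, fun _ => (Nat.lt_two_pow_self).le.trans (Nat.pow_le_pow_left (by omega) _)⟩

theorem const (k : ℕ) : XBound n s fun _ => k := param fun _ => k

theorem size : XBound n s n := ⟨fun _ => 1, fun i => by rw [pow_one]; omega⟩

theorem mul (hS : XBound n s S) (hT : XBound n s T) : XBound n s fun i => S i * T i := by
  obtain ⟨g, hg⟩ := hS
  obtain ⟨g', hg'⟩ := hT
  exact ⟨fun a => g a + g' a, fun i => by rw [pow_add]; exact Nat.mul_le_mul (hg i) (hg' i)⟩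

theorem succ (hS : XBound n s S) : XBound n s fun i => S i + 1 := by
  obtain ⟨g, hg⟩ := hS
  refine ⟨fun a => g a + 1, fun i => ?_⟩
  have h1 := hg i
  have h2 : 1 ≤ (n i + 2) ^ g (s i) := Nat.one_le_pow _ _ (by omega)
  rw [pow_succ]
  nlinarith

theorem add (hS : XBound n s S) (hT : XBound n s T) : XBound n s fun i => S i + T i :=
  (hS.succ.mul hT.succ).mono fun i => by nlinarith [Nat.zero_le (S i * T i)]

theorem pow_param (hS : XBound n s S) (f : ℕ → ℕ) : XBound n s fun i => S i ^ f (s i) := by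
  obtain ⟨g, hg⟩ := hS
  exact ⟨fun a => g a * f a, fun i => by rw [pow_mul]; exact Nat.pow_le_pow_left (hg i) _⟩

theorem reindex (hT : XBound n s T) (π : κ → ι) :
    XBound (fun j => n (π j)) (fun j => s (π j)) fun j => T (π j) := by
  obtain ⟨g, hg⟩ := hT
  exact ⟨g, fun j => hg (π j)⟩

/-- A bound on a family over a larger index set gives a uniform bound. -/
theorem exists_uniform {π : κ → ι} {T : κ → ℕ}
    (hT : XBound (fun j => n (π j)) (fun j => s (π j)) T) :
    ∃ U, XBound n s U ∧ ∀ j, T j ≤ U (π j) := by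
  obtain ⟨g, hg⟩ := hT
  exact ⟨fun i => (n i + 2) ^ g (s i), ⟨g, fun i => le_rfl⟩, hg⟩

end XBound

/-- One program computes `y i` from `x i`, in time bounded by a power of `n` with an exponent that
depends on `s` only. -/
def Feasible {ι : Type} (n s : ι → ℕ) (x y : ι → Data) : Prop :=
  ∃ (p : Prog) (T : ι → ℕ), XBound n s T ∧ ∀ i, p.OutputsWithin (x i) (y i) (T i)

/-- A number in unary. -/
def encNat (k : ℕ) : Data := encList (List.replicate k Data.nil)

theorem encNat_succ (k : ℕ) : encNat (k + 1) = Data.cons Data.nil (encNat k) := rfl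

namespace Feasible

variable {ι κ : Type} {n s : ι → ℕ} {x y z : ι → Data}

theorem const (a : Data) : Feasible n s x fun _ => a := by
  obtain ⟨T, hT⟩ := exists_outputsWithin_constProg a
  exact ⟨constProg a, fun _ => T, XBound.const T, fun i => hT _⟩

theorem refl (x : ι → Data) : Feasible n s x x :=
  ⟨Prog.ident, fun _ => 1, XBound.const 1, fun _ => ⟨1, Prog.Runs.ident _, le_rfl⟩⟩

theorem trans (h : Feasible n s x y) (h' : Feasible n s y z) : Feasible n s x z := by
  obtain ⟨p, S, hS, hp⟩ := h
  obtain ⟨q, T, hT, hq⟩ := h'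
  exact ⟨Prog.comp q p, _, (hS.add hT).add (XBound.const 1), fun i => (hp i).comp (hq i)⟩

theorem pair (h : Feasible n s x y) (h' : Feasible n s x z) :
    Feasible n s x fun i => Data.cons (y i) (z i) := by
  obtain ⟨p, S, hS, hp⟩ := h
  obtain ⟨q, T, hT, hq⟩ := h'
  exact ⟨Prog.pair p q, _, (hS.add hT).add (XBound.const 1), fun i => (hp i).pair (hq i)⟩

theorem fst (h : Feasible n s x fun i => Data.cons (y i) (z i)) : Feasible n s x y :=
  h.trans ⟨Prog.fst, fun _ => 1, XBound.const 1, fun _ => Prog.OutputsWithin.fst _ _⟩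

theorem snd (h : Feasible n s x fun i => Data.cons (y i) (z i)) : Feasible n s x z :=
  h.trans ⟨Prog.snd, fun _ => 1, XBound.const 1, fun _ => Prog.OutputsWithin.snd _ _⟩

theorem congr {y' : ι → Data} (h : Feasible n s x y) (hy : ∀ i, y i = y' i) : Feasible n s x y' :=
  (funext hy : y = y') ▸ h

theorem reindex (h : Feasible n s x y) (π : κ → ι) :
    Feasible (fun j => n (π j)) (fun j => s (π j)) (fun j => x (π j)) fun j => y (π j) := by
  obtain ⟨p, T, hT, hp⟩ := h
  exact ⟨p, _, hT.reindex π, fun j => hp (π j)⟩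

/-- Iteration over the tails of a list. -/
theorem loop {N : ι → ℕ} {l : ι → List Data} {y : ι → ℕ → Data} (hN : ∀ i, (l i).length = N i)
    (hl : Feasible n s x fun i => encList (l i)) (hlen : XBound n s N)
    (h0 : Feasible n s x fun i => y i 0)
    (hstep : Feasible (fun j : Σ i, Fin (N i) => n j.1) (fun j => s j.1)
      (fun j => Data.cons (x j.1) (Data.cons (encList ((l j.1).drop j.2)) (y j.1 j.2)))
      fun j => y j.1 (j.2 + 1)) :
    Feasible n s x fun i => y i (N i) := by
  obtain ⟨p, T, hT, hp⟩ := hstep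
  -- The step is feasible over the larger index set of pairs (input, round), and its bound depends
  -- on the input only; this makes one bound valid for all rounds.
  obtain ⟨U, hU, hTU⟩ := XBound.exists_uniform (n := n) (s := s) (π := Sigma.fst) hT
  refine ((refl x).pair (hl.pair h0)).trans ⟨listLoop p, _,
    (hlen.mul (hU.add (XBound.const 15))).add (XBound.const 10), fun i => ?_⟩
  have h := outputsWithin_listLoop (x := x i) (y := y i) (T := U i) fun k hk =>
    (hp ⟨i, k, (hN i) ▸ hk⟩).mono (hTU ⟨i, k, (hN i) ▸ hk⟩)
  rw [hN] at h
  exact h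

/-- Iteration over the elements of a list. -/
theorem forEach {N : ι → ℕ} {l : ∀ i, Fin (N i) → Data} {y : ι → ℕ → Data}
    (hl : Feasible n s x fun i => encFun (l i)) (hlen : XBound n s N)
    (h0 : Feasible n s x fun i => y i 0)
    (hstep : Feasible (fun j : Σ i, Fin (N i) => n j.1) (fun j => s j.1)
      (fun j => Data.cons (x j.1) (Data.cons (l j.1 j.2) (y j.1 j.2)))
      fun j => y j.1 (j.2 + 1)) :
    Feasible n s x fun i => y i (N i) := by
  refine loop (l := fun i => List.ofFn (l i)) (fun i => List.length_ofFn) hl hlen h0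
    (trans ((refl _).fst.pair (Feasible.pair ?_ (refl _).snd.snd)) hstep)
  refine ((refl _).snd.fst.congr (y' := fun j : Σ i, Fin (N i) => Data.cons (l j.1 j.2)
    (encList ((List.ofFn (l j.1)).drop (j.2 + 1)))) fun j => ?_).fst
  rw [List.drop_eq_getElem_cons (by rw [List.length_ofFn]; exact j.2.2), List.getElem_ofFn]
  rfl

/-- Iteration over the numbers below `N`, in descending order. -/
theorem countdown {N : ι → ℕ} {y : ι → ℕ → Data}
    (hN : Feasible n s x fun i => encNat (N i)) (hNb : XBound n s N)
    (h0 : Feasible n s x fun i => y i (N i))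
    (hstep : Feasible (fun j : Σ i, Fin (N i) => n j.1) (fun j => s j.1)
      (fun j => Data.cons (x j.1) (Data.cons (encNat j.2) (y j.1 (j.2 + 1))))
      fun j => y j.1 j.2) :
    Feasible n s x fun i => y i 0 := by
  -- The tail left after removing a unit of a unary number is itself a unary number, so the loop
  -- gets its counter for free if it counts down.
  let π : (Σ i, Fin (N i)) → Σ i, Fin (N i) := fun j => ⟨j.1, N j.1 - j.2 - 1, by omega⟩
  have h1 : ∀ j : Σ i, Fin (N i), N j.1 - j.2 - 1 + 1 = N j.1 - j.2 := fun j => by omega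
  have h := loop (l := fun i => List.replicate (N i) Data.nil) (y := fun i k => y i (N i - k))
    (fun i => List.length_replicate) hN hNb h0 ?_
  · simpa using h
  · refine trans (y := fun j : Σ i, Fin (N i) => Data.cons (x j.1)
      (Data.cons (encNat (N j.1 - j.2 - 1)) (y j.1 (N j.1 - j.2))))
      ((refl _).fst.pair (Feasible.pair ?_ (refl _).snd.snd)) ?_
    · refine ((refl _).snd.fst.congr (y' := fun j : Σ i, Fin (N i) => Data.cons Data.nil
        (encNat (N j.1 - j.2 - 1))) fun j => ?_).snd
      rw [List.drop_replicate, ← encNat_succ, h1]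
      rfl
    · have h' := hstep.reindex π
      simp only [π, h1] at h'
      exact h'

end Feasible

/-! ## Lists, truth values and numbers -/

namespace Feasible

variable {ι : Type} {n s : ι → ℕ} {x y z : ι → Data} {φ ψ : ι → Prop} {N : ι → ℕ}

theorem encProp_of {p : Prop} (h : p) : encProp p = Data.cons Data.nil Data.nil := if_pos h

theorem encProp_of_not {p : Prop} (h : ¬ p) : encProp p = Data.nil := if_neg h

theorem ite {w : ι → Data} (hφ : Feasible n s x fun i => encProp (φ i)) (hy : Feasible n s x y)
    (hz : Feasible n s x z) (h1 : ∀ i, φ i → w i = y i) (h2 : ∀ i, ¬ φ i → w i = z i) :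
    Feasible n s x w := by
  obtain ⟨p, S, hS, hp⟩ := hφ
  obtain ⟨q, T, hT, hq⟩ := hy
  obtain ⟨q', U, hU, hq'⟩ := hz
  refine ⟨Prog.cond p q q', _, ((hS.add hT).add hU).succ, fun i => ?_⟩
  obtain ⟨t, a1, a2⟩ := hp i
  obtain ⟨t', b1, b2⟩ := hq i
  obtain ⟨t'', c1, c2⟩ := hq' i
  by_cases h : φ i
  · replace a1 : p.Runs (x i) (Data.cons Data.nil Data.nil) t := encProp_of h ▸ a1
    rw [h1 i h]
    exact ⟨_, Prog.Runs.cond_true a1 b1, by omega⟩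
  · replace a1 : p.Runs (x i) Data.nil t := encProp_of_not h ▸ a1
    rw [h2 i h]
    exact ⟨_, Prog.Runs.cond_false a1 c1, by omega⟩

theorem not (h : Feasible n s x fun i => encProp (φ i)) :
    Feasible n s x fun i => encProp (¬ φ i) :=
  ite h (const Data.nil) (const (Data.cons Data.nil Data.nil)) (fun _ h => encProp_of_not (not_not.2 h))
    fun _ h => encProp_of h

theorem and (h : Feasible n s x fun i => encProp (φ i)) (h' : Feasible n s x fun i => encProp (ψ i)) :
    Feasible n s x fun i => encProp (φ i ∧ ψ i) :=
  ite h h' (const Data.nil) (fun i h => by rw [and_iff_right h])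
    fun i h => encProp_of_not fun h' => h h'.1

theorem or (h : Feasible n s x fun i => encProp (φ i)) (h' : Feasible n s x fun i => encProp (ψ i)) :
    Feasible n s x fun i => encProp (φ i ∨ ψ i) :=
  ite h (const (Data.cons Data.nil Data.nil)) h' (fun i h => encProp_of (Or.inl h))
    fun i h => by rw [or_iff_right h]

theorem imp (h : Feasible n s x fun i => encProp (φ i)) (h' : Feasible n s x fun i => encProp (ψ i)) :
    Feasible n s x fun i => encProp (φ i → ψ i) :=
  (h.not.or h').congr fun i => by rw [imp_iff_not_or]

theorem iff (h : Feasible n s x fun i => encProp (φ i)) (h' : Feasible n s x fun i => encProp (ψ i)) :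
    Feasible n s x fun i => encProp (φ i ↔ ψ i) :=
  ((h.imp h').and (h'.imp h)).congr fun i => by rw [iff_iff_implies_and_implies]

/-- What can be computed from `x` can be computed from `x` and a further value. -/
theorem liftData {w : (Σ i, Fin (N i)) → Data} (h : Feasible n s x y) :
    Feasible (fun j : Σ i, Fin (N i) => n j.1) (fun j => s j.1)
      (fun j => Data.cons (x j.1) (w j)) fun j => y j.1 :=
  (refl _).fst.trans (h.reindex Sigma.fst)

/-- What can be computed from `x` can be computed from `x` and a further number. -/
theorem lift (h : Feasible n s x y) :
    Feasible (fun j : Σ i, Fin (N i) => n j.1) (fun j => s j.1)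
      (fun j => Data.cons (x j.1) (encNat j.2)) fun j => y j.1 :=
  h.liftData

/-- The number that has been added last. -/
theorem new : Feasible (fun j : Σ i, Fin (N i) => n j.1) (fun j => s j.1)
    (fun j => Data.cons (x j.1) (encNat j.2)) fun j => encNat j.2 :=
  (refl _).snd

/-- Iteration over the numbers below `N`, in descending order, where each step combines a value
that does not depend on the state with the state. -/
theorem countdown_of {y : ι → ℕ → Data} {f : (Σ i, Fin (N i)) → Data}
    (hN : Feasible n s x fun i => encNat (N i)) (hNb : XBound n s N)
    (hf : Feasible (fun j : Σ i, Fin (N i) => n j.1) (fun j => s j.1)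
      (fun j => Data.cons (x j.1) (encNat j.2)) f)
    (h0 : Feasible n s x fun i => y i (N i))
    (hstep : Feasible (fun j : Σ i, Fin (N i) => n j.1) (fun j => s j.1)
      (fun j => Data.cons (f j) (y j.1 (j.2 + 1))) fun j => y j.1 j.2) :
    Feasible n s x fun i => y i 0 := by
  refine countdown hN hNb h0 (trans (pair ?_ (refl _).snd.snd) hstep)
  exact trans ((refl _).fst.pair (refl _).snd.fst) hf

theorem tabulate {f : ∀ i, Fin (N i) → Data} (hN : Feasible n s x fun i => encNat (N i))
    (hNb : XBound n s N)
    (hf : Feasible (fun j : Σ i, Fin (N i) => n j.1) (fun j => s j.1)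
      (fun j => Data.cons (x j.1) (encNat j.2)) fun j => f j.1 j.2) :
    Feasible n s x fun i => encFun (f i) := by
  refine countdown_of (y := fun i k => encList ((List.ofFn (f i)).drop k)) hN hNb hf
    ((const Data.nil).congr fun i => ?_) ((refl _).congr fun j => ?_)
  · rw [List.drop_of_length_le (by rw [List.length_ofFn])]; rfl
  · rw [List.drop_eq_getElem_cons (i := j.2) (by rw [List.length_ofFn]; exact j.2.2),
      List.getElem_ofFn]
    rfl

theorem exists_fin {φ : ∀ i, Fin (N i) → Prop} (hN : Feasible n s x fun i => encNat (N i))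
    (hNb : XBound n s N)
    (hφ : Feasible (fun j : Σ i, Fin (N i) => n j.1) (fun j => s j.1)
      (fun j => Data.cons (x j.1) (encNat j.2)) fun j => encProp (φ j.1 j.2)) :
    Feasible n s x fun i => encProp (∃ v, φ i v) := by
  have h := countdown_of (y := fun i k => encProp (∃ v : Fin (N i), k ≤ v ∧ φ i v)) hN hNb hφ
    ((const Data.nil).congr fun i => ?_) ?_
  · simpa using h
  · refine (encProp_of_not ?_).symm
    rintro ⟨v, hv, -⟩
    exact absurd hv (by omega)
  · refine (or (refl _).fst (refl _).snd).congr fun j => ?_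
    congr 1
    refine propext ⟨?_, ?_⟩
    · rintro (h | ⟨v, hv, h⟩)
      · exact ⟨j.2, le_rfl, h⟩
      · exact ⟨v, by omega, h⟩
    · rintro ⟨v, hv, h⟩
      rcases hv.eq_or_lt with h' | h'
      · exact Or.inl (by rwa [Fin.ext h'])
      · exact Or.inr ⟨v, h', h⟩

theorem forall_fin {φ : ∀ i, Fin (N i) → Prop} (hN : Feasible n s x fun i => encNat (N i))
    (hNb : XBound n s N)
    (hφ : Feasible (fun j : Σ i, Fin (N i) => n j.1) (fun j => s j.1)
      (fun j => Data.cons (x j.1) (encNat j.2)) fun j => encProp (φ j.1 j.2)) :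
    Feasible n s x fun i => encProp (∀ v, φ i v) :=
  (exists_fin hN hNb hφ.not).not.congr fun i => by rw [not_exists_not]

theorem nth {f : ∀ i, Fin (N i) → Data} {v : ∀ i, Fin (N i)}
    (hf : Feasible n s x fun i => encFun (f i)) (hv : Feasible n s x fun i => encNat (v i))
    (hNb : XBound n s N) : Feasible n s x fun i => f i (v i) := by
  have h := loop (N := fun i => v i) (l := fun i => List.replicate (v i) Data.nil)
    (y := fun i k => encList ((List.ofFn (f i)).drop k)) (fun i => List.length_replicate) hv
    (hNb.mono fun i => (v i).2.le) hf ?_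
  · refine (h.congr (y' := fun i => Data.cons (f i (v i)) (encList ((List.ofFn (f i)).drop (v i + 1))))
      fun i => ?_).fst
    rw [List.drop_eq_getElem_cons (by rw [List.length_ofFn]; exact (v i).2), List.getElem_ofFn]
    rfl
  · refine ((refl _).snd.snd.congr (y' := fun j : Σ i, Fin (v i) => Data.cons
      (f j.1 ⟨j.2, j.2.2.trans (v j.1).2⟩) (encList ((List.ofFn (f j.1)).drop (j.2 + 1)))) fun j => ?_).snd
    rw [List.drop_eq_getElem_cons (by rw [List.length_ofFn]; exact j.2.2.trans (v j.1).2),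
      List.getElem_ofFn]
    rfl

/-- The length of a list. -/
theorem length {f : ∀ i, Fin (N i) → Data} (hf : Feasible n s x fun i => encFun (f i))
    (hNb : XBound n s N) : Feasible n s x fun i => encNat (N i) :=
  forEach (y := fun _ k => encNat k) hf hNb (const Data.nil) ((const Data.nil).pair (refl _).snd.snd)

theorem reverseAppend {l l' : ι → List Data} (hl : Feasible n s x fun i => encList (l i))
    (hl' : Feasible n s x fun i => encList (l' i)) (hlen : XBound n s fun i => (l i).length) :
    Feasible n s x fun i => encList ((l i).reverse ++ l' i) := by
  have h := loop (y := fun i k => encList (((l i).take k).reverse ++ l' i)) (fun _ => rfl) hl hlen hl' ?_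
  · simpa using h
  · refine (pair ((refl _).snd.fst.congr (y' := fun j : Σ i, Fin (l i).length => Data.cons (l j.1)[j.2]
      (encList ((l j.1).drop (j.2 + 1)))) fun j => ?_).fst (refl _).snd.snd).congr fun j => ?_
    · rw [List.drop_eq_getElem_cons j.2.2]; rfl
    · rw [List.take_succ_eq_append_getElem j.2.2, List.reverse_append]; rfl

/-- A list can be extended cheaply only at the front, so the first list is reversed twice. -/
theorem append {l l' : ι → List Data} (hl : Feasible n s x fun i => encList (l i))
    (hl' : Feasible n s x fun i => encList (l' i)) (hlen : XBound n s fun i => (l i).length) :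
    Feasible n s x fun i => encList (l i ++ l' i) := by
  have h := (hl.reverseAppend (l' := fun _ => []) (const Data.nil) hlen).reverseAppend hl'
    (by simpa using hlen)
  simpa using h

theorem flatten {l : ∀ i, Fin (N i) → List Data} (hN : Feasible n s x fun i => encNat (N i))
    (hNb : XBound n s N)
    (hl : Feasible (fun j : Σ i, Fin (N i) => n j.1) (fun j => s j.1)
      (fun j => Data.cons (x j.1) (encNat j.2)) fun j => encList (l j.1 j.2))
    (hlen : XBound (fun j : Σ i, Fin (N i) => n j.1) (fun j => s j.1) fun j => (l j.1 j.2).length) :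
    Feasible n s x fun i => encList (List.ofFn (l i)).flatten := by
  refine countdown_of (y := fun i k => encList ((List.ofFn (l i)).drop k).flatten) hN hNb hl
    ((const Data.nil).congr fun i => ?_) (((refl _).fst.append (refl _).snd hlen).congr fun j => ?_)
  · rw [List.drop_of_length_le (by rw [List.length_ofFn])]; rfl
  · rw [List.drop_eq_getElem_cons (i := j.2) (by rw [List.length_ofFn]; exact j.2.2), List.getElem_ofFn,
      List.flatten_cons]

theorem flatMap {α : ι → Type} {Q : ∀ i, List (α i)} {e : ∀ i, α i → Data}
    {f : ∀ i, α i → List Data} {U : ι → ℕ} (hQ : Feasible n s x fun i => encList ((Q i).map (e i)))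
    (hlen : XBound n s fun i => (Q i).length)
    (hf : Feasible (fun j : Σ i, Fin (Q i).length => n j.1) (fun j => s j.1)
      (fun j => Data.cons (x j.1) (e j.1 (Q j.1)[j.2])) fun j => encList (f j.1 (Q j.1)[j.2]))
    (hU : XBound n s U) (hfU : ∀ i a, (f i a).length ≤ U i) :
    Feasible n s x fun i => encList ((Q i).flatMap (f i)) := by
  have h := forEach (N := fun i => (Q i).length) (l := fun i k => e i (Q i)[k])
    (y := fun i k => encList (((Q i).take k).flatMap (f i))) (hQ.congr fun i => ?_) hlen
    (const Data.nil) ?_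
  · simpa using h
  · rw [encFun]
    congr 1
    exact (List.ofFn_getElem_eq_map (Q i) (e i)).symm
  · refine (append (l := fun j : Σ i, Fin (Q i).length => ((Q j.1).take j.2).flatMap (f j.1))
      (refl _).snd.snd (trans (pair (refl _).fst (refl _).snd.fst) hf)
      (((hlen.mul hU).reindex Sigma.fst).mono fun j => ?_)).congr fun j => ?_
    · rw [List.length_flatMap]
      refine (List.sum_le_card_nsmul _ (U j.1) ?_).trans ?_
      · simp only [List.mem_map, forall_exists_index, and_imp, forall_apply_eq_imp_iff₂]
        exact fun a _ => hfU _ a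
      · rw [List.length_map, smul_eq_mul]
        exact Nat.mul_le_mul_right _ (by rw [List.length_take]; exact min_le_right _ _)
    · rw [List.take_succ_eq_append_getElem j.2.2, List.flatMap_append]
      simp

/-! ### Arithmetic -/

theorem add {a b : ι → ℕ} (ha : Feasible n s x fun i => encNat (a i))
    (hb : Feasible n s x fun i => encNat (b i)) (hbb : XBound n s b) :
    Feasible n s x fun i => encNat (a i + b i) :=
  loop (y := fun i k => encNat (a i + k)) (fun _ => List.length_replicate) hb hbb ha
    ((const Data.nil).pair (refl _).snd.snd)

theorem mul {a b : ι → ℕ} (ha : Feasible n s x fun i => encNat (a i))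
    (hb : Feasible n s x fun i => encNat (b i)) (hab : XBound n s a) (hbb : XBound n s b) :
    Feasible n s x fun i => encNat (a i * b i) :=
  loop (y := fun i k => encNat (a i * k)) (fun _ => List.length_replicate) hb hbb (const Data.nil)
    (add (refl _).snd.snd ha.liftData (hab.reindex Sigma.fst))

theorem tsub {a b : ι → ℕ} (ha : Feasible n s x fun i => encNat (a i))
    (hb : Feasible n s x fun i => encNat (b i)) (hbb : XBound n s b) :
    Feasible n s x fun i => encNat (a i - b i) := by
  refine loop (y := fun i k => encNat (a i - k)) (fun _ => List.length_replicate) hb hbb ha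
    (trans (y := fun j : Σ i, Fin (b i) => encNat (a j.1 - j.2)) (refl _).snd.snd ?_)
  -- The right subtree of the leaf is the leaf, which agrees with truncated subtraction.
  refine ⟨Prog.snd, fun _ => 1, XBound.const 1, fun j => ?_⟩
  dsimp only
  rw [← Nat.sub_sub]
  cases a j.1 - j.2 with
  | zero => exact ⟨_, Prog.Runs.snd_nil, le_rfl⟩
  | succ m => exact Prog.OutputsWithin.snd _ _

theorem le {a b : ι → ℕ} (ha : Feasible n s x fun i => encNat (a i))
    (hb : Feasible n s x fun i => encNat (b i)) (hbb : XBound n s b) :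
    Feasible n s x fun i => encProp (a i ≤ b i) := by
  refine (ha.tsub hb hbb).trans ⟨Prog.cond Prog.ident Prog.nil (Prog.pair Prog.nil Prog.nil),
    fun _ => 5, XBound.const 5, fun i => ?_⟩
  by_cases hab : a i ≤ b i
  · have h : a i - b i = 0 := by omega
    simp only [h, encProp_of hab]
    exact ⟨_, Prog.Runs.cond_false (Prog.Runs.ident _) (Prog.Runs.pair (Prog.Runs.nil _) (Prog.Runs.nil _)),
      le_rfl⟩
  · have h : a i - b i = (a i - b i - 1) + 1 := by omega
    simp only [encProp_of_not hab]
    rw [h, encNat_succ]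
    exact ⟨3, Prog.Runs.cond_true (Prog.Runs.ident _) (Prog.Runs.nil _), by norm_num⟩

theorem eq {v w : ∀ i, Fin (N i)} (hv : Feasible n s x fun i => encNat (v i))
    (hw : Feasible n s x fun i => encNat (w i)) (hNb : XBound n s N) :
    Feasible n s x fun i => encProp (v i = w i) :=
  ((hv.le hw (hNb.mono fun i => (w i).2.le)).and (hw.le hv (hNb.mono fun i => (v i).2.le))).congr
    fun i => by rw [← Nat.le_antisymm_iff, Fin.ext_iff]

end Feasible

/-! ## Computations with triples -/

namespace Feasible

open SeededTriple

variable {ι : Type} {n s : ι → ℕ} {x : ι → Data} {R : ∀ i, SeededTriple (Fin (n i))}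

theorem size (hR : Feasible n s x fun i => encTriple (R i)) : Feasible n s x fun i => encNat (n i) :=
  hR.fst.length XBound.size

theorem adj (hR : Feasible n s x fun i => encTriple (R i)) {u v : ∀ i, Fin (n i)}
    (hu : Feasible n s x fun i => encNat (u i)) (hv : Feasible n s x fun i => encNat (v i)) :
    Feasible n s x fun i => encProp ((R i).graph.Adj (u i) (v i)) :=
  (hR.fst.nth hu XBound.size).nth hv XBound.size

theorem mem_list (hR : Feasible n s x fun i => encTriple (R i)) {v : ∀ i, Fin (n i)}
    {j : ι → Fin 3} (hv : Feasible n s x fun i => encNat (v i))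
    (hj : Feasible n s x fun i => encNat (j i)) :
    Feasible n s x fun i => encProp (j i ∈ (R i).list (v i)) :=
  (hR.snd.fst.nth hv XBound.size).nth (N := fun _ => 3) hj (XBound.const 3)

theorem mem_seed (hR : Feasible n s x fun i => encTriple (R i)) {v : ∀ i, Fin (n i)}
    (hv : Feasible n s x fun i => encNat (v i)) :
    Feasible n s x fun i => encProp (v i ∈ (R i).seed) :=
  hR.snd.snd.nth hv XBound.size

theorem exists_vertex (hR : Feasible n s x fun i => encTriple (R i)) {φ : ∀ i, Fin (n i) → Prop}
    (hφ : Feasible (fun j : Σ i, Fin (n i) => n j.1) (fun j => s j.1)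
      (fun j => Data.cons (x j.1) (encNat j.2)) fun j => encProp (φ j.1 j.2)) :
    Feasible n s x fun i => encProp (∃ v, φ i v) :=
  exists_fin hR.size XBound.size hφ

theorem forall_vertex (hR : Feasible n s x fun i => encTriple (R i)) {φ : ∀ i, Fin (n i) → Prop}
    (hφ : Feasible (fun j : Σ i, Fin (n i) => n j.1) (fun j => s j.1)
      (fun j => Data.cons (x j.1) (encNat j.2)) fun j => encProp (φ j.1 j.2)) :
    Feasible n s x fun i => encProp (∀ v, φ i v) :=
  forall_fin hR.size XBound.size hφ

theorem exists_color {φ : ι → Fin 3 → Prop}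
    (hφ : Feasible (fun j : Σ _ : ι, Fin 3 => n j.1) (fun j => s j.1)
      (fun j => Data.cons (x j.1) (encNat j.2)) fun j => encProp (φ j.1 j.2)) :
    Feasible n s x fun i => encProp (∃ v, φ i v) :=
  exists_fin (N := fun _ => 3) (const _) (XBound.const 3) hφ

theorem forall_color {φ : ι → Fin 3 → Prop}
    (hφ : Feasible (fun j : Σ _ : ι, Fin 3 => n j.1) (fun j => s j.1)
      (fun j => Data.cons (x j.1) (encNat j.2)) fun j => encProp (φ j.1 j.2)) :
    Feasible n s x fun i => encProp (∀ v, φ i v) :=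
  forall_fin (N := fun _ => 3) (const _) (XBound.const 3) hφ

/-- The number that has been added last; the hypothesis fixes the context. -/
theorem newIn {y : ι → Data} (_h : Feasible n s x y) (N : ι → ℕ) :
    Feasible (fun j : Σ i, Fin (N i) => n j.1) (fun j => s j.1)
      (fun j => Data.cons (x j.1) (encNat j.2)) fun j => encNat j.2 :=
  new

/-- The vertex that has been added last; the hypothesis fixes the context. -/
theorem newVertex {y : ι → Data} (_h : Feasible n s x y) :
    Feasible (fun j : Σ i, Fin (n i) => n j.1) (fun j => s j.1)
      (fun j => Data.cons (x j.1) (encNat j.2)) fun j => encNat j.2 :=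
  new (N := n)

/-- The color that has been added last; the hypothesis fixes the context. -/
theorem newColor {y : ι → Data} (_h : Feasible n s x y) : Feasible (fun j : Σ _ : ι, Fin 3 => n j.1) (fun j => s j.1)
    (fun j => Data.cons (x j.1) (encNat j.2)) fun j => encNat j.2 :=
  new (N := fun _ => 3)

theorem liftColor {y : ι → Data} (h : Feasible n s x y) :
    Feasible (fun j : Σ _ : ι, Fin 3 => n j.1) (fun j => s j.1)
      (fun j => Data.cons (x j.1) (encNat j.2)) fun j => y j.1 :=
  h.lift (N := fun _ => 3)

theorem eq_color {j k : ι → Fin 3} (hj : Feasible n s x fun i => encNat (j i))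
    (hk : Feasible n s x fun i => encNat (k i)) : Feasible n s x fun i => encProp (j i = k i) :=
  eq (N := fun _ => 3) hj hk (XBound.const 3)

theorem list_eq_singleton (hR : Feasible n s x fun i => encTriple (R i)) {v : ∀ i, Fin (n i)}
    {j : ι → Fin 3} (hv : Feasible n s x fun i => encNat (v i))
    (hj : Feasible n s x fun i => encNat (j i)) :
    Feasible n s x fun i => encProp ((R i).list (v i) = {j i}) := by
  refine ((hR.mem_list hv hj).and (forall_color (φ := fun i k => k ∈ (R i).list (v i) → k = j i)
    ((mem_list hR.liftColor hv.liftColor hR.newColor).imp (eq_color hR.newColor hj.liftColor)))).congr fun i => ?_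
  rw [Finset.eq_singleton_iff_unique_mem]

/-- A triple on the same graph. -/
theorem triple {R' : ∀ i, SeededTriple (Fin (n i))} (hR : Feasible n s x fun i => encTriple (R i))
    (hg : ∀ i, (R' i).graph = (R i).graph)
    (hl : Feasible (fun k : Σ _ : (Σ i, Fin (n i)), Fin 3 => n k.1.1) (fun k => s k.1.1)
      (fun k => Data.cons (Data.cons (x k.1.1) (encNat k.1.2)) (encNat k.2))
      fun k => encProp (k.2 ∈ (R' k.1.1).list k.1.2))
    (hs : Feasible (fun j : Σ i, Fin (n i) => n j.1) (fun j => s j.1)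
      (fun j => Data.cons (x j.1) (encNat j.2)) fun j => encProp (j.2 ∈ (R' j.1).seed)) :
    Feasible n s x fun i => encTriple (R' i) := by
  refine pair (hR.fst.congr fun _ => ?_) (pair
    (tabulate (f := fun i v => encFun fun k : Fin 3 => encProp (k ∈ (R' i).list v))
      hR.size XBound.size
      (tabulate (N := fun _ => 3)
        (f := fun (j : Σ i, Fin (n i)) (k : Fin 3) => encProp (k ∈ (R' j.1).list j.2))
        (const _) (XBound.const 3) hl))
    (tabulate (f := fun i v => encProp (v ∈ (R' i).seed)) hR.size XBound.size hs))
  rw [hg]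

theorem propagate (hR : Feasible n s x fun i => encTriple (R i)) :
    Feasible n s x fun i => encTriple (R i).propagate := by
  refine hR.triple (fun _ => rfl) ?_ (mem_seed hR.lift hR.newVertex)
  have hR2 := (hR.lift (N := n)).liftColor
  have hv2 := hR.newVertex.liftColor
  have hc2 := hR.newVertex.newColor
  refine ((mem_list hR2 hv2 hc2).and (exists_vertex
    (φ := fun k u => (R k.1.1).graph.Adj k.1.2 u ∧ (R k.1.1).list u = {k.2}) hR2
    ((adj hR2.lift hv2.lift hR2.newVertex).and
      (list_eq_singleton hR2.lift hR2.newVertex hc2.lift))).not).congr fun k => ?_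
  rw [mem_propagate_list]

theorem update (hR : Feasible n s x fun i => encTriple (R i)) :
    Feasible n s x fun i => encTriple (R i).update := by
  have h := loop (l := fun i => List.replicate (3 * n i) Data.nil)
    (y := fun i k => encTriple (SeededTriple.propagate^[k] (R i))) (fun _ => List.length_replicate)
    ((const _ : Feasible n s x fun _ => encNat 3).mul hR.size (XBound.const 3) XBound.size)
    ((XBound.const 3).mul XBound.size) hR ?_
  · refine h.congr fun i => ?_
    rw [SeededTriple.update, Fintype.card_fin]
  · refine (propagate (R := fun j : Σ i, Fin (3 * n i) => SeededTriple.propagate^[j.2] (R j.1))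
      (refl _).snd.snd).congr fun j => ?_
    rw [Function.iterate_succ_apply']

theorem addSeed (hR : Feasible n s x fun i => encTriple (R i)) {v : ∀ i, Fin (n i)}
    {j : ι → Fin 3} (hv : Feasible n s x fun i => encNat (v i))
    (hj : Feasible n s x fun i => encNat (j i)) :
    Feasible n s x fun i => encTriple ((R i).addSeed (v i) (j i)) := by
  refine hR.triple (fun _ => rfl) ?_ (((eq hR.newVertex hv.lift XBound.size).or (mem_seed hR.lift hR.newVertex)).congr
    fun k => ?_)
  · have hR2 := (hR.lift (N := n)).liftColor
    have hv2 := hR.newVertex.liftColor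
    have hc2 := hR.newVertex.newColor
    have hj2 := (hj.lift (N := n)).liftColor
    refine ite ((eq hv2 hv.lift.liftColor XBound.size).and (mem_list hR2 hv2 hj2))
      (eq_color hc2 hj2) (mem_list hR2 hv2 hc2) (fun k hk => ?_) fun k hk => ?_
    · congr 1
      simp only [SeededTriple.addSeed]
      rw [if_pos hk, Finset.mem_singleton]
    · congr 1
      simp only [SeededTriple.addSeed]
      rw [if_neg hk]
  · simp [SeededTriple.addSeed]

theorem fixCommon (hR : Feasible n s x fun i => encTriple (R i)) {q : ∀ i, Fin 4 → Fin (n i)}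
    {j : ι → Fin 3} (hq : ∀ a, Feasible n s x fun i => encNat (q i a))
    (hj : Feasible n s x fun i => encNat (j i)) :
    Feasible n s x fun i => encTriple ((R i).fixCommon (q i) (j i)) := by
  refine hR.triple (fun _ => rfl) ?_ (mem_seed hR.lift hR.newVertex)
  have hR2 := (hR.lift (N := n)).liftColor
  have hv2 := hR.newVertex.liftColor
  have hc2 := hR.newVertex.newColor
  have hj2 := (hj.lift (N := n)).liftColor
  have hadj := fun a => adj hR2 hv2 (hq a).lift.liftColor
  refine ite ((((hadj 0).and (hadj 1)).and ((hadj 2).and (hadj 3))).and (mem_list hR2 hv2 hj2))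
    (eq_color hc2 hj2) (mem_list hR2 hv2 hc2) (fun k hk => ?_) fun k hk => ?_
  · congr 1
    simp only [SeededTriple.fixCommon]
    rw [if_pos, Finset.mem_singleton]
    refine ⟨fun a => ?_, hk.2⟩
    fin_cases a
    · exact hk.1.1.1
    · exact hk.1.1.2
    · exact hk.1.2.1
    · exact hk.1.2.2
  · congr 1
    simp only [SeededTriple.fixCommon]
    rw [if_neg]
    exact fun h => hk ⟨⟨⟨h.1 0, h.1 1⟩, h.1 2, h.1 3⟩, h.2⟩

end Feasible

/-! ### Quantifier forms of the predicates that the program decides -/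

namespace SeededTriple

variable {V : Type} {R : SeededTriple V}

theorem mem_fixed_iff {v : V} : v ∈ R.fixed ↔ ∃ j, R.list v = {j} := Finset.card_eq_one

theorem mem_boundary_iff_exists {v : V} : v ∈ R.boundary ↔ ∃ s, s ∈ R.seed ∧ R.graph.Adj v s ∧
    ∃ j, R.list s = {j} ∧ ∀ k, k ∈ R.list v ↔ ¬ k = j := by
  constructor
  · rintro ⟨h1, s, hs, hadj, h2⟩
    have h3 : (R.list s).card = 1 := by
      rw [h2, Finset.card_compl, h1, Fintype.card_fin]
    obtain ⟨j, hj⟩ := Finset.card_eq_one.1 h3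
    refine ⟨s, hs, hadj, j, hj, fun k => ?_⟩
    rw [← Finset.mem_singleton (a := j), ← hj, h2, Finset.mem_compl, not_not]
  · rintro ⟨s, hs, hadj, j, hj, hv⟩
    have h1 : R.list v = {j}ᶜ := by
      ext k
      rw [hv, Finset.mem_compl, Finset.mem_singleton]
    refine ⟨?_, s, hs, hadj, by rw [hj, h1, compl_compl]⟩
    rw [h1, Finset.card_compl, Fintype.card_fin, Finset.card_singleton]

theorem isNice_iff : R.IsNice ↔ ∀ b w w', b ∈ R.boundary → w ∈ R.wilderness → w' ∈ R.wilderness →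
    R.graph.Adj w w' → R.graph.Adj b w → R.graph.Adj b w' := by
  constructor
  · intro h b w w' hb hw hw' hadj hbw
    by_contra hbw'
    refine h b hb w hw w' hw' hadj ⟨?_, ⟨w, by simp, hbw⟩, w', by simp, hbw'⟩
    rintro (rfl | rfl)
    · exact hw (Or.inr hb)
    · exact hw' (Or.inr hb)
  · rintro h b hb w hw w' hw' hadj ⟨-, ⟨x, hx, hbx⟩, y, hy, hby⟩
    simp only [Set.mem_insert_iff, Set.mem_singleton_iff] at hx hy
    rcases hx with rfl | rfl <;> rcases hy with rfl | rfl
    · exact hby hbx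
    · exact hby (h b _ _ hb hw hw' hadj hbx)
    · exact hby (h b _ _ hb hw' hw hadj.symm hbx)
    · exact hby hbx

theorem boundary_union_wilderness : R.boundary ∪ R.wilderness = R.fixedᶜ := by
  ext v
  have h : v ∈ R.boundary → v ∉ R.fixed := fun h1 h2 => by
    have h3 := h1.1
    have h4 : (R.list v).card = 1 := h2
    omega
  simp only [wilderness, Set.mem_union, Set.mem_compl_iff]
  tauto

/-- The quantifier over embeddings becomes one over six-tuples, which can be searched in polynomial
time; injectivity comes back from the distinct neighbourhoods in P₆. -/
theorem isEasy_iff : R.IsEasy ↔ ¬ ∃ Q : Fin 6 → V, ∀ a, Q a ∉ R.fixed ∧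
    ∀ b, R.graph.Adj (Q a) (Q b) ↔ (a.val + 1 = b ∨ b.val + 1 = a) := by
  rw [IsEasy, boundary_union_wilderness, IsInducedFree, not_iff_not]
  constructor
  · rintro ⟨φ⟩
    refine ⟨fun a => (φ a : V), fun a => ⟨(φ a).2, fun b => ?_⟩⟩
    rw [← SimpleGraph.pathGraph_adj]
    exact φ.map_rel_iff
  · rintro ⟨Q, hQ⟩
    refine ⟨⟨⟨fun a => ⟨Q a, (hQ a).1⟩, fun a b hab => ?_⟩, fun {a b} => ?_⟩⟩
    · have h : Q a = Q b := congrArg Subtype.val hab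
      have h1 : ∀ d : Fin 6, (a.val + 1 = d ∨ d.val + 1 = a) ↔ (b.val + 1 = d ∨ d.val + 1 = b) :=
        fun d => by rw [← (hQ a).2, ← (hQ b).2, h]
      clear hab h
      revert a b
      decide
    · rw [SimpleGraph.pathGraph_adj]
      exact (hQ a).2 b

/-- The seed is colored, and the triple is nice or easy. -/
def IsGood (R : SeededTriple V) : Prop :=
  (∀ v, v ∈ R.seed → v ∈ R.fixed) ∧ (R.IsNice ∨ R.IsEasy)

end SeededTriple

/-! ## Tuples -/

/-- The concatenation of the lists that belong to the `k`-tuples. -/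
def tupleFlatten {α : Type} {n : ℕ} : (k : ℕ) → ((Fin k → Fin n) → List α) → List α
  | 0, f => f Fin.elim0
  | k + 1, f => (List.ofFn fun v => tupleFlatten k fun q => f (Fin.cons v q)).flatten

theorem mem_tupleFlatten {α : Type} {n k : ℕ} {f : (Fin k → Fin n) → List α} {a : α} :
    a ∈ tupleFlatten k f ↔ ∃ q, a ∈ f q := by
  induction k with
  | zero =>
    exact ⟨fun h => ⟨_, h⟩, fun ⟨q, h⟩ => by rwa [Subsingleton.elim q Fin.elim0] at h⟩
  | succ k ih =>
    simp only [tupleFlatten, List.mem_flatten, List.mem_ofFn]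
    constructor
    · rintro ⟨_, ⟨v, rfl⟩, h⟩
      obtain ⟨q, hq⟩ := ih.1 h
      exact ⟨_, hq⟩
    · rintro ⟨q, h⟩
      exact ⟨_, ⟨q 0, rfl⟩, ih.2 ⟨Fin.tail q, by rwa [Fin.cons_self_tail]⟩⟩

theorem length_tupleFlatten_le {α : Type} {n k U : ℕ} {f : (Fin k → Fin n) → List α}
    (hf : ∀ q, (f q).length ≤ U) : (tupleFlatten k f).length ≤ n ^ k * U := by
  induction k with
  | zero => simpa [tupleFlatten] using hf _
  | succ k ih =>
    rw [tupleFlatten, List.length_flatten]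
    refine (List.sum_le_card_nsmul _ (n ^ k * U) ?_).trans (le_of_eq ?_)
    · simp only [List.map_ofFn, List.mem_ofFn, forall_exists_index, forall_apply_eq_imp_iff,
        Function.comp]
      exact fun v => ih fun q => hf _
    · rw [List.length_map, List.length_ofFn, smul_eq_mul]
      ring

theorem map_tupleFlatten {α β : Type} {n k : ℕ} (e : α → β) (f : (Fin k → Fin n) → List α) :
    (tupleFlatten k f).map e = tupleFlatten k fun q => (f q).map e := by
  induction k with
  | zero => rfl
  | succ k ih =>
    rw [tupleFlatten, List.map_flatten, List.map_ofFn]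
    simp only [tupleFlatten, ← ih]
    rfl

namespace Feasible

open SeededTriple

variable {ι : Type} {n s : ι → ℕ} {x : ι → Data}

/-- Regroups the context: a number bound first, followed by a k-tuple, is read as a (k+1)-tuple.
This is the inductive step for quantifying over tuples. -/
theorem tuple_aux {k : ℕ} {y : (Σ i, Fin (k + 1) → Fin (n i)) → Data}
    (h : Feasible (fun j : Σ i, Fin (k + 1) → Fin (n i) => n j.1) (fun j => s j.1)
      (fun j => Data.cons (x j.1) (encFun fun a => encNat (j.2 a))) y) :
    Feasible (fun j : Σ j : (Σ i, Fin (n i)), Fin k → Fin (n j.1) => n j.1.1) (fun j => s j.1.1)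
      (fun j => Data.cons (Data.cons (x j.1.1) (encNat j.1.2)) (encFun fun a => encNat (j.2 a)))
      fun j => y ⟨j.1.1, Fin.cons j.1.2 j.2⟩ := by
  refine trans (y := fun j => Data.cons (x j.1.1) (Data.cons (encNat j.1.2)
    (encFun fun a => encNat (j.2 a)))) ((refl _).fst.fst.pair ((refl _).fst.snd.pair (refl _).snd)) ?_
  have h' := h.reindex (fun j : Σ j : (Σ i, Fin (n i)), Fin k → Fin (n j.1) =>
    (⟨j.1.1, Fin.cons j.1.2 j.2⟩ : Σ i, Fin (k + 1) → Fin (n i)))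
  have he : ∀ j : Σ j : (Σ i, Fin (n i)), Fin k → Fin (n j.1),
      (encFun fun a => encNat ((Fin.cons j.1.2 j.2 : Fin (k + 1) → Fin (n j.1.1)) a)) =
        Data.cons (encNat j.1.2) (encFun fun a => encNat (j.2 a)) := by
    intro j
    rw [encFun, List.ofFn_succ]
    rfl
  simp only [he] at h'
  exact h'

theorem exists_tuple (k : ℕ) {φ : ∀ i, (Fin k → Fin (n i)) → Prop}
    (hn : Feasible n s x fun i => encNat (n i))
    (hφ : Feasible (fun j : Σ i, Fin k → Fin (n i) => n j.1) (fun j => s j.1)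
      (fun j => Data.cons (x j.1) (encFun fun a => encNat (j.2 a))) fun j => encProp (φ j.1 j.2)) :
    Feasible n s x fun i => encProp (∃ q, φ i q) := by
  induction k generalizing ι with
  | zero =>
    refine (trans ((refl x).pair (const (encList []))) (hφ.reindex fun i => ⟨i, Fin.elim0⟩)).congr
      fun i => ?_
    congr 1
    exact propext ⟨fun h => ⟨_, h⟩, fun ⟨q, h⟩ => by rwa [Subsingleton.elim q Fin.elim0] at h⟩
  | succ k ih =>
    refine (exists_fin (φ := fun i v => ∃ q, φ i (Fin.cons v q)) hn XBound.size (ih hn.lift (φ := fun j q => φ j.1 (Fin.cons j.2 q))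
      (tuple_aux hφ))).congr fun i => ?_
    congr 1
    exact propext ⟨fun ⟨v, q, h⟩ => ⟨_, h⟩, fun ⟨q, h⟩ => ⟨q 0, Fin.tail q, by rwa [Fin.cons_self_tail]⟩⟩

theorem tupleFlatten (k U : ℕ) {f : ∀ i, (Fin k → Fin (n i)) → List Data}
    (hn : Feasible n s x fun i => encNat (n i)) (hU : ∀ i q, (f i q).length ≤ U)
    (hf : Feasible (fun j : Σ i, Fin k → Fin (n i) => n j.1) (fun j => s j.1)
      (fun j => Data.cons (x j.1) (encFun fun a => encNat (j.2 a))) fun j => encList (f j.1 j.2)) :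
    Feasible n s x fun i => encList (_root_.tupleFlatten k (f i)) := by
  induction k generalizing ι with
  | zero => exact trans ((refl x).pair (const (encList []))) (hf.reindex fun i => ⟨i, Fin.elim0⟩)
  | succ k ih =>
    refine flatten hn XBound.size (ih hn.lift (f := fun j q => f j.1 (Fin.cons j.2 q))
      (fun _ _ => hU _ _) (tuple_aux hf)) ?_
    refine (((XBound.size.pow_param fun _ => k).mul (XBound.const U)).reindex Sigma.fst).mono
      fun j => length_tupleFlatten_le fun q => hU _ _

/-! ### Nice and easy triples -/

variable {R : ∀ i, SeededTriple (Fin (n i))}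

theorem mem_fixed (hR : Feasible n s x fun i => encTriple (R i)) {v : ∀ i, Fin (n i)}
    (hv : Feasible n s x fun i => encNat (v i)) :
    Feasible n s x fun i => encProp (v i ∈ (R i).fixed) := by
  refine (exists_color (φ := fun i j => (R i).list (v i) = {j})
    (list_eq_singleton hR.liftColor hv.liftColor hR.newColor)).congr fun i => ?_
  rw [mem_fixed_iff]

theorem mem_boundary (hR : Feasible n s x fun i => encTriple (R i)) {v : ∀ i, Fin (n i)}
    (hv : Feasible n s x fun i => encNat (v i)) :
    Feasible n s x fun i => encProp (v i ∈ (R i).boundary) := by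
  refine (exists_vertex (φ := fun i u => u ∈ (R i).seed ∧ (R i).graph.Adj (v i) u ∧
    ∃ j, (R i).list u = {j} ∧ ∀ k, k ∈ (R i).list (v i) ↔ ¬ k = j) hR
    ((mem_seed hR.lift hR.newVertex).and ((adj hR.lift hv.lift hR.newVertex).and
      (exists_color (φ := fun (j : Σ i, Fin (n i)) c => (R j.1).list j.2 = {c} ∧
        ∀ k, k ∈ (R j.1).list (v j.1) ↔ ¬ k = c)
        ((list_eq_singleton hR.lift.liftColor hR.newVertex.liftColor hR.lift.newColor).and
          (forall_color (φ := fun (j : Σ _ : (Σ i, Fin (n i)), Fin 3) k => k ∈ (R j.1.1).list (v j.1.1) ↔ ¬ k = j.2)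
            ((mem_list hR.lift.liftColor.liftColor hv.lift.liftColor.liftColor
              hR.lift.liftColor.newColor).iff
              (eq_color hR.lift.liftColor.newColor hR.lift.newColor.liftColor).not))))))).congr
    fun i => ?_
  rw [mem_boundary_iff_exists]

theorem mem_wilderness (hR : Feasible n s x fun i => encTriple (R i)) {v : ∀ i, Fin (n i)}
    (hv : Feasible n s x fun i => encNat (v i)) :
    Feasible n s x fun i => encProp (v i ∈ (R i).wilderness) :=
  ((hR.mem_fixed hv).or (hR.mem_boundary hv)).not

theorem isNice (hR : Feasible n s x fun i => encTriple (R i)) :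
    Feasible n s x fun i => encProp (R i).IsNice := by
  have hR1 := hR.lift (N := n)
  have hR2 := hR1.lift (N := fun j => n j.1)
  have hR3 := hR2.lift (N := fun j => n j.1.1)
  have hb := hR.newVertex.lift (N := fun j => n j.1) |>.lift (N := fun j => n j.1.1)
  have hw := hR1.newVertex.lift (N := fun j => n j.1.1)
  have hw' := hR2.newVertex
  refine (forall_vertex (φ := fun i b => ∀ w w', b ∈ (R i).boundary → w ∈ (R i).wilderness →
    w' ∈ (R i).wilderness → (R i).graph.Adj w w' → (R i).graph.Adj b w → (R i).graph.Adj b w') hR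
    (forall_vertex (φ := fun j w => ∀ w', j.2 ∈ (R j.1).boundary → w ∈ (R j.1).wilderness →
      w' ∈ (R j.1).wilderness → (R j.1).graph.Adj w w' → (R j.1).graph.Adj j.2 w →
      (R j.1).graph.Adj j.2 w') hR1
      (forall_vertex (φ := fun j w' => j.1.2 ∈ (R j.1.1).boundary → j.2 ∈ (R j.1.1).wilderness →
        w' ∈ (R j.1.1).wilderness → (R j.1.1).graph.Adj j.2 w' → (R j.1.1).graph.Adj j.1.2 j.2 →
        (R j.1.1).graph.Adj j.1.2 w') hR2
        ((mem_boundary hR3 hb).imp ((mem_wilderness hR3 hw).imp ((mem_wilderness hR3 hw').imp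
          ((adj hR3 hw hw').imp ((adj hR3 hb hw).imp (adj hR3 hb hw'))))))))).congr fun i => ?_
  rw [isNice_iff]

theorem isEasy (hR : Feasible n s x fun i => encTriple (R i)) :
    Feasible n s x fun i => encProp (R i).IsEasy := by
  have hR1 : Feasible (fun j : Σ i, Fin 6 → Fin (n i) => n j.1) (fun j => s j.1)
      (fun j => Data.cons (x j.1) (encFun fun a => encNat (j.2 a))) fun j => encTriple (R j.1) :=
    (refl _).fst.trans (hR.reindex Sigma.fst)
  have hq : Feasible (fun j : Σ i, Fin 6 → Fin (n i) => n j.1) (fun j => s j.1)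
      (fun j => Data.cons (x j.1) (encFun fun a => encNat (j.2 a)))
      fun j => encFun fun a => encNat (j.2 a) := (refl _).snd
  have hR2 := hR1.lift (N := fun _ => 6)
  have hR3 := hR2.lift (N := fun _ => 6)
  have hq2 := hq.lift (N := fun _ => 6)
  have hq3 := hq2.lift (N := fun _ => 6)
  have ha2 := hR1.newIn fun _ => 6
  have ha3 := ha2.lift (N := fun _ => 6)
  have hb3 := hR2.newIn fun _ => 6
  have hsucc : ∀ {κ : Type} {n s a : κ → ℕ} {x : κ → Data}, Feasible n s x (fun i => encNat (a i)) →
      Feasible n s x fun i => encNat (a i + 1) := fun h => (const Data.nil).pair h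
  have hle : ∀ {κ : Type} {n s : κ → ℕ} {a b : κ → Fin 6} {x : κ → Data},
      Feasible n s x (fun i => encNat (a i)) → Feasible n s x (fun i => encNat (b i)) →
        Feasible n s x fun i => encProp ((a i).val + 1 = b i) := fun {κ n s a b x} ha hb =>
    (((hsucc ha).le hb ((XBound.const 6).mono fun i => (b i).2.le)).and
      (hb.le (hsucc ha) ((XBound.const 6).mono fun i => (a i).2))).congr fun i => by
        rw [← Nat.le_antisymm_iff]
  refine (exists_tuple 6 (φ := fun i Q => ∀ a, Q a ∉ (R i).fixed ∧
    ∀ b, (R i).graph.Adj (Q a) (Q b) ↔ (a.val + 1 = b ∨ b.val + 1 = a)) hR.size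
    (forall_fin (N := fun _ => 6) (φ := fun (j : Σ i, Fin 6 → Fin (n i)) a => j.2 a ∉ (R j.1).fixed ∧
      ∀ b, (R j.1).graph.Adj (j.2 a) (j.2 b) ↔ (a.val + 1 = b ∨ b.val + 1 = a)) (const _)
      (XBound.const 6) ((mem_fixed hR2 (hq2.nth ha2 (XBound.const 6))).not.and
        (forall_fin (N := fun _ => 6)
          (φ := fun (j : Σ _ : (Σ i, Fin 6 → Fin (n i)), Fin 6) b =>
            (R j.1.1).graph.Adj (j.1.2 j.2) (j.1.2 b) ↔ (j.2.val + 1 = b ∨ b.val + 1 = j.2))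
          (const _) (XBound.const 6)
          ((adj hR3 (hq3.nth ha3 (XBound.const 6)) (hq3.nth hb3 (XBound.const 6))).iff
            ((hle ha3 hb3).or (hle hb3 ha3))))))).not.congr fun i => ?_
  rw [isEasy_iff]

theorem isGood (hR : Feasible n s x fun i => encTriple (R i)) :
    Feasible n s x fun i => encProp (R i).IsGood :=
  (forall_vertex (φ := fun i v => v ∈ (R i).seed → v ∈ (R i).fixed) hR
    ((mem_seed hR.lift hR.newVertex).imp (mem_fixed hR.lift hR.newVertex))).and
    (hR.isNice.or hR.isEasy)

end Feasible

/-! ## The collection -/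

namespace SeededTriple

variable {n : ℕ}

/-- The results of one move, for a given tuple of vertices. -/
noncomputable def movesAt (R : SeededTriple (Fin n)) (q : Fin 4 → Fin n) :
    List (SeededTriple (Fin n)) :=
  [(R.addSeed (q 0) 0).update, (R.addSeed (q 0) 1).update, (R.addSeed (q 0) 2).update,
    (R.fixCommon q 0).update, (R.fixCommon q 1).update, (R.fixCommon q 2).update]

/-- The results of one move. -/
noncomputable def moves (R : SeededTriple (Fin n)) : List (SeededTriple (Fin n)) :=
  tupleFlatten 4 R.movesAt

theorem mem_moves {R R' : SeededTriple (Fin n)} : R' ∈ R.moves ↔ Step R R' := by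
  rw [moves, mem_tupleFlatten]
  constructor
  · rintro ⟨q, h⟩
    simp only [movesAt, List.mem_cons, List.not_mem_nil, or_false] at h
    rcases h with h | h | h | h | h | h
    · exact Or.inl ⟨_, _, h⟩
    · exact Or.inl ⟨_, _, h⟩
    · exact Or.inl ⟨_, _, h⟩
    · exact Or.inr ⟨_, _, h⟩
    · exact Or.inr ⟨_, _, h⟩
    · exact Or.inr ⟨_, _, h⟩
  · rintro (⟨v, j, rfl⟩ | ⟨q, j, rfl⟩)
    · refine ⟨fun _ => v, ?_⟩
      fin_cases j <;> simp [movesAt]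
    · refine ⟨q, ?_⟩
      fin_cases j <;> simp [movesAt]

theorem length_moves_le (R : SeededTriple (Fin n)) : R.moves.length ≤ n ^ 4 * 6 :=
  length_tupleFlatten_le fun _ => le_rfl

/-- The results of `m` moves. -/
noncomputable def candidates (P : SeededTriple (Fin n)) : ℕ → List (SeededTriple (Fin n))
  | 0 => [P]
  | m + 1 => (P.candidates m).flatMap moves

theorem mem_candidates {P R : SeededTriple (Fin n)} {m : ℕ} : R ∈ P.candidates m ↔ Reach m P R := by
  induction m generalizing R with
  | zero => exact List.mem_singleton
  | succ m ih =>
    simp only [candidates, List.mem_flatMap, ih, mem_moves]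
    rfl

theorem length_flatMap_le {α β : Type} {l : List α} {f : α → List β} {U : ℕ}
    (h : ∀ a, (f a).length ≤ U) : (l.flatMap f).length ≤ l.length * U := by
  rw [List.length_flatMap]
  refine (List.sum_le_card_nsmul _ U ?_).trans (by rw [List.length_map, smul_eq_mul])
  simp only [List.mem_map, forall_exists_index, and_imp, forall_apply_eq_imp_iff₂]
  exact fun a _ => h a

theorem length_candidates_le (P : SeededTriple (Fin n)) (m : ℕ) :
    (P.candidates m).length ≤ (n ^ 4 * 6) ^ m := by
  induction m with
  | zero => rfl
  | succ m ih =>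
    rw [pow_succ]
    exact (length_flatMap_le length_moves_le).trans (Nat.mul_le_mul_right _ ih)

open Classical in
/-- The nice and easy triples after `moveBound` moves. -/
noncomputable def collection (P : SeededTriple (Fin n)) : List (SeededTriple (Fin n)) :=
  (P.candidates (moveBound P.seed.card)).flatMap fun R => if R.IsGood then [R] else []

theorem mem_collection {P R : SeededTriple (Fin n)} :
    R ∈ P.collection ↔ Reach (moveBound P.seed.card) P R ∧ R.IsGood := by
  simp only [collection, List.mem_flatMap, mem_candidates]
  constructor
  · rintro ⟨R', h1, h2⟩
    split_ifs at h2 with h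
    · rw [List.mem_singleton.1 h2]
      exact ⟨h1, h⟩
    · exact absurd h2 List.not_mem_nil
  · rintro ⟨h1, h2⟩
    exact ⟨R, h1, by rw [if_pos h2]; exact List.mem_singleton_self R⟩

theorem length_collection_le (P : SeededTriple (Fin n)) :
    P.collection.length ≤ (n ^ 4 * 6) ^ moveBound P.seed.card := by
  refine (length_flatMap_le (U := 1) fun R => ?_).trans
    (by rw [mul_one]; exact length_candidates_le _ _)
  split_ifs <;> simp

theorem Reach.isUpdated {V : Type} [Fintype V] {P R : SeededTriple V} {m : ℕ} (hm : 0 < m)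
    (h : Reach m P R) : R.IsUpdated := by
  obtain ⟨m, rfl⟩ := Nat.exists_eq_succ_of_ne_zero hm.ne'
  obtain ⟨R₁, -, ⟨v, j, rfl⟩ | ⟨q, j, rfl⟩⟩ := h <;> exact update_isUpdated _

theorem Reach.isSeededPrecoloring {V : Type} [Fintype V] {P R : SeededTriple V} {m r : ℕ}
    {L' : V → Finset (Fin 3)} (hm : 0 < m) (h : Reach m P R) (hP : P.IsSeededPrecoloring r L')
    (hR : ∀ v ∈ R.seed, v ∈ R.fixed) : R.IsSeededPrecoloring r P.list := by
  have href := h.refines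
  refine ⟨hR, fun v _ => href.list v, fun u hu v _ hadj heq => ?_, ?_⟩
  -- Adjacent seed vertices with the same singleton list would contradict exhaustive propagation; so
  -- filtering for a colored seed is enough.
  · exact h.isUpdated hm u v hadj (hR u hu) heq.subset
  · refine hP.2.2.2.trans ?_
    rw [href.graph]
    exact ⟨SimpleGraph.induceHomOfLE P.graph href.seed⟩

end SeededTriple

/-! ## Computing numbers -/

/-- A program computes `f s` from `s` in unary. -/
structure UnaryComputable (f : ℕ → ℕ) : Prop where
  feasible : ∀ {ι : Type} {n s : ι → ℕ} {x : ι → Data}, Feasible n s x (fun i => encNat (s i)) →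
    Feasible n s x fun i => encNat (f (s i))

namespace UnaryComputable

variable {f g : ℕ → ℕ}

theorem id : UnaryComputable fun a => a := ⟨fun h => h⟩

theorem const (k : ℕ) : UnaryComputable fun _ => k := ⟨fun _ => Feasible.const _⟩

theorem add (hf : UnaryComputable f) (hg : UnaryComputable g) : UnaryComputable fun a => f a + g a :=
  ⟨fun h => (hf.feasible h).add (hg.feasible h) (XBound.param g)⟩

theorem mul (hf : UnaryComputable f) (hg : UnaryComputable g) : UnaryComputable fun a => f a * g a :=
  ⟨fun h => (hf.feasible h).mul (hg.feasible h) (XBound.param f) (XBound.param g)⟩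

theorem pow (hf : UnaryComputable f) (k : ℕ) : UnaryComputable fun a => f a ^ k := by
  induction k with
  | zero => exact const 1
  | succ k ih => exact ih.mul hf

theorem netBound (t : ℕ) (hf : UnaryComputable f) : UnaryComputable fun a => netBound t a (f a) := by
  have h1 : UnaryComputable fun a => 4 * a + 9 := ((const 4).mul id).add (const 9)
  have h2 : UnaryComputable fun a => tupleBound t a (f a) :=
    ((const 2).mul hf).mul (((const (72 * t ^ 3)).mul h1).add (const 1))
  exact (((const (2 * t ^ 2)).mul h1).mul
    (((const (24 * t)).mul ((h2.pow 3).add (const 1))).pow 2)).add (const 1)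

theorem niceBound (hf : UnaryComputable f) : UnaryComputable fun a => SeededTriple.niceBound a (f a) :=
  ((const 18).add ((const 216).mul hf)).add ((const 4).mul (netBound 96 ((const 9).mul id)))

/-- The program has to know the number of rounds, which it computes from the size of the seed. The
intermediate numbers depend on the parameter only, so unary arithmetic is affordable. -/
theorem moveBound : UnaryComputable SeededTriple.moveBound := by
  have h1 : UnaryComputable fun a => 7 * (2 * _root_.netBound 96 a 3) :=
    (const 7).mul ((const 2).mul (netBound 96 (const 3)))
  exact (const 1).add (h1.add (niceBound ((id.add (const 1)).add h1)))

end UnaryComputable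

namespace Feasible

open SeededTriple

variable {ι : Type} {n s : ι → ℕ} {x : ι → Data} {R : ∀ i, SeededTriple (Fin (n i))}

theorem card_seed (hR : Feasible n s x fun i => encTriple (R i)) :
    Feasible n s x fun i => encNat (R i).seed.card := by
  classical
  have h := countdown_of
    (y := fun i k => encNat (Finset.univ.filter fun v : Fin (n i) => k ≤ v ∧ v ∈ (R i).seed).card)
    hR.size XBound.size (mem_seed hR.lift hR.newVertex) ((const Data.nil).congr fun i => ?_) ?_
  · simpa using h
  · rw [Finset.filter_false_of_mem]
    · rfl
    · rintro v - ⟨h, -⟩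
      exact absurd h (by omega)
  · refine ite (refl _).fst (y := fun j : Σ i, Fin (n i) => encNat ((Finset.univ.filter
      fun v : Fin (n j.1) => j.2 + 1 ≤ v.val ∧ v ∈ (R j.1).seed).card + 1))
      ((const Data.nil).pair (refl _).snd) (refl _).snd (fun j hj => ?_) fun j hj => ?_
    · rw [← Finset.card_insert_of_notMem (a := j.2) (by simp)]
      congr 2
      ext v
      simp only [Finset.mem_filter, Finset.mem_univ, true_and, Finset.mem_insert]
      constructor
      · rintro ⟨h1, h2⟩
        rcases h1.eq_or_lt with h | h
        · exact Or.inl (Fin.ext h.symm)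
        · exact Or.inr ⟨h, h2⟩
      · rintro (rfl | ⟨h1, h2⟩)
        · exact ⟨le_rfl, hj⟩
        · exact ⟨by omega, h2⟩
    · congr 2
      ext v
      simp only [Finset.mem_filter, Finset.mem_univ, true_and]
      constructor
      · rintro ⟨h1, h2⟩
        refine ⟨lt_of_le_of_ne h1 fun h => hj ?_, h2⟩
        rwa [Fin.ext h]
      · rintro ⟨h1, h2⟩
        exact ⟨by omega, h2⟩

theorem moves (hR : Feasible n s x fun i => encTriple (R i)) :
    Feasible n s x fun i => encList ((R i).moves.map encTriple) := by
  refine (Feasible.tupleFlatten 4 6 (f := fun i q => ((R i).movesAt q).map encTriple) hR.size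
    (fun i q => le_rfl) ?_).congr fun i => ?_
  · have hR1 : Feasible (fun j : Σ i, Fin 4 → Fin (n i) => n j.1) (fun j => s j.1)
        (fun j => Data.cons (x j.1) (encFun fun a => encNat (j.2 a))) fun j => encTriple (R j.1) :=
      (refl _).fst.trans (hR.reindex Sigma.fst)
    have hq : ∀ a, Feasible (fun j : Σ i, Fin 4 → Fin (n i) => n j.1) (fun j => s j.1)
        (fun j => Data.cons (x j.1) (encFun fun a => encNat (j.2 a))) fun j => encNat (j.2 a) :=
      fun a => nth (N := fun _ => 4) (v := fun _ => a)
        (f := fun (j : Σ i, Fin 4 → Fin (n i)) a => encNat (j.2 a)) (refl _).snd (const _)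
        (XBound.const 4)
    have h1 := fun c : Fin 3 => (hR1.addSeed (hq 0) (const (encNat c))).update
    have h2 := fun c : Fin 3 => (hR1.fixCommon hq (const (encNat c))).update
    exact (h1 0).pair ((h1 1).pair ((h1 2).pair ((h2 0).pair ((h2 1).pair ((h2 2).pair
      (const Data.nil))))))
  · rw [SeededTriple.moves, map_tupleFlatten]

theorem candidates (hR : Feasible n s x fun i => encTriple (R i)) {m : ℕ → ℕ}
    (hm : Feasible n s x fun i => encNat (m (s i))) :
    Feasible n s x fun i => encList (((R i).candidates (m (s i))).map encTriple) := by
  -- The summand 1 keeps the base positive, so that this bound also covers all earlier rounds.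
  have hlen : XBound n s fun i => (n i ^ 4 * 6 + 1) ^ m (s i) :=
    ((XBound.size.pow_param fun _ => 4).mul (XBound.const 6)).succ.pow_param m
  refine loop (y := fun i k => encList (((R i).candidates k).map encTriple))
    (fun _ => List.length_replicate) hm (XBound.param m) (hR.pair (const Data.nil)) ?_
  refine (Feasible.flatMap (Q := fun j : Σ i, Fin (m (s i)) => (R j.1).candidates j.2)
    (e := fun _ => encTriple) (f := fun _ R => R.moves.map encTriple)
    (U := fun j => n j.1 ^ 4 * 6) (refl _).snd.snd ?_ (moves (refl _).snd)
    ((XBound.size.pow_param fun _ => 4).mul (XBound.const 6)) fun j R => ?_).congr fun j => ?_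
  · refine (hlen.reindex Sigma.fst).mono fun j => (length_candidates_le _ _).trans ?_
    exact (Nat.pow_le_pow_left (Nat.le_succ _) _).trans
      (Nat.pow_le_pow_right (Nat.succ_pos _) j.2.2.le)
  · rw [List.length_map]
    exact length_moves_le R
  · rw [SeededTriple.candidates, List.map_flatMap]

end Feasible

namespace Feasible

open SeededTriple

theorem collection {ι : Type} {n s : ι → ℕ} {x : ι → Data} {R : ∀ i, SeededTriple (Fin (n i))}
    (hR : Feasible n s x fun i => encTriple (R i)) (hs : ∀ i, (R i).seed.card = s i) :
    Feasible n s x fun i => encCollection (R i).collection := by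
  classical
  have hm : Feasible n s x fun i => encNat (moveBound (s i)) :=
    UnaryComputable.moveBound.feasible (hR.card_seed.congr fun i => by rw [hs])
  refine (Feasible.flatMap (Q := fun i => (R i).candidates (moveBound (s i)))
    (e := fun _ => encTriple) (f := fun _ R => if R.IsGood then [encTriple R] else [])
    (U := fun _ => 1) (hR.candidates hm) ?_ ?_ (XBound.const 1) fun i R => ?_).congr fun i => ?_
  · exact (((XBound.size.pow_param fun _ => 4).mul (XBound.const 6)).pow_param moveBound).mono
      fun i => length_candidates_le _ _
  · refine ite (isGood (refl _).snd) (pair (refl _).snd (const Data.nil)) (const Data.nil)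
      (fun j hj => ?_) fun j hj => ?_
    · rw [if_pos hj]; rfl
    · rw [if_neg hj]; rfl
  · split_ifs <;> simp
  · rw [encCollection, SeededTriple.collection, List.map_flatMap, hs]
    congr 2
    funext R
    split_ifs <;> rfl

end Feasible

/-! ### Equivalence and the final bounds -/

theorem SeededTriple.isEquivalentCollection_collection {n r : ℕ} {P : SeededTriple (Fin n)}
    {L' : Fin n → Finset (Fin 3)} (hr : 1 ≤ r)
    (hfree : IsInducedFree (pathSixAddPathThree r) P.graph) (hP : P.IsSeededPrecoloring r L') :
    IsEquivalentCollection (Prog.comp Prog.snd Prog.snd) 3 P P.collection := by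
  refine ⟨⟨?_, ?_⟩, ?_⟩
  · rintro ⟨c, hc⟩
    obtain ⟨R, h1, h2, h3⟩ := exists_reach_moveBound hr hfree hP hc
    refine ⟨R, mem_collection.2 ⟨h1, fun v hv => ?_, h3⟩, c, h2.extension⟩
    exact mem_fixed_iff.2 ⟨_, h2.seed v hv⟩
  · rintro ⟨R, hR, c, hc⟩
    exact ⟨c, (mem_collection.1 hR).1.refines.isExtension hc⟩
  · intro R hR c hc
    exact ⟨c, (mem_collection.1 hR).1.refines.isExtension hc,
      (Prog.OutputsWithin.snd _ _).comp (Prog.OutputsWithin.snd _ _)⟩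

theorem mainTheorem4 :
    ∃ (g₁ : ℕ → ℕ) (build back : Prog) (C k : ℕ),
      ∀ (r : ℕ), 1 ≤ r →
      ∀ (n : ℕ) (P : SeededTriple (Fin n)) (L' : Fin n → Finset (Fin 3)),
        IsInducedFree (pathSixAddPathThree r) P.graph →
        P.graph.CliqueFree 4 →
        P.IsSeededPrecoloring r L' →
        ∃ Q : List (SeededTriple (Fin n)),
          (∀ P' ∈ Q, P'.graph = P.graph ∧ P'.IsSeededPrecoloring r P.list ∧ P'.IsUpdated) ∧
          IsEquivalentCollection back (C * n ^ k) P Q ∧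
          (∀ P' ∈ Q, P'.IsNice ∨ P'.IsEasy) ∧
          (∀ P' ∈ Q, P'.seed.card ≤ g₁ P.seed.card) ∧
          Q.length ≤ n ^ g₁ P.seed.card ∧
          build.OutputsWithin (encTriple P) (encCollection Q) (C * n ^ g₁ P.seed.card) := by
  obtain ⟨build, T, ⟨g, hg⟩, hbuild⟩ := Feasible.collection
    (n := fun i : Σ n, SeededTriple (Fin n) => i.1) (s := fun i => i.2.seed.card)
    (R := fun i => i.2) (Feasible.refl _) fun _ => rfl
  -- The three summands serve the running time, the number of members and the size of the seeds. The
  -- constants 3 and 0 say that `back`, a mere projection, takes three steps.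
  refine ⟨fun a => 2 * g a + 5 * SeededTriple.moveBound a + (a + SeededTriple.moveBound a), build,
    Prog.comp Prog.snd Prog.snd, 3, 0, ?_⟩
  intro r hr n P L' hfree _ hP
  have hm : 0 < SeededTriple.moveBound P.seed.card := Nat.add_pos_left one_pos _
  -- The seed contains a P₆. With n ≥ 6 the factor 6 in the number of moves and the base n + 2 are
  -- absorbed into powers of n.
  have hn : 6 ≤ n := by
    have h1 := SeededTriple.le_card_seed_of_isSeededPrecoloring hP
    have h2 := Finset.card_le_univ P.seed
    rw [Fintype.card_fin] at h2
    exact (Nat.le_add_right _ _).trans (h1.trans h2)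
  refine ⟨P.collection, ?_, ?_, ?_, ?_, ?_, ?_⟩
  · intro R hR
    obtain ⟨h1, h2, -⟩ := SeededTriple.mem_collection.1 hR
    exact ⟨h1.refines.graph, h1.isSeededPrecoloring hm hP h2, h1.isUpdated hm⟩
  · exact SeededTriple.isEquivalentCollection_collection hr hfree hP
  · exact fun R hR => (SeededTriple.mem_collection.1 hR).2.2
  · exact fun R hR => ((SeededTriple.mem_collection.1 hR).1.card_seed_le).trans (Nat.le_add_left _ _)
  · refine (SeededTriple.length_collection_le P).trans ?_
    have h1 : n ^ 4 * 6 ≤ n ^ 5 := by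
      rw [pow_succ n 4]; exact Nat.mul_le_mul_left _ hn
    refine (Nat.pow_le_pow_left h1 _).trans ?_
    rw [← pow_mul]
    refine Nat.pow_le_pow_right (by omega) ?_
    dsimp only
    omega
  · refine (hbuild ⟨n, P⟩).mono ((hg ⟨n, P⟩).trans ?_)
    have h1 : n + 2 ≤ n ^ 2 := by nlinarith
    refine (Nat.pow_le_pow_left h1 _).trans ?_
    rw [← pow_mul]
    refine (Nat.pow_le_pow_right (by omega) ?_).trans (Nat.le_mul_of_pos_left _ (by norm_num))
    dsimp only
    omega
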